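/- Conventions. All tensor products $\otimes$ of C*-algebras are minimal, $\odot$ is the algebraic tensor product, $M(\cdot)$ is the multiplier algebra, and $I$ is the unit of $M(\mathcal A)$. For $1\le n\le\infty$ let $\mathbb F_n$ be the free group on generators $g^{(n)}_1,g^{(n)}_2,\dots$ ($n$ of them, countably many if $n=\infty$), $C^*(\mathbb F_n)$ its full group C*-algebra, and identify the group algebra $\mathbb C\mathbb F_n$ with its canonical image in $C^*(\mathbb F_n)$. For $1\le m,l<\infty$ let $$\varphi_{m,l}:C^*(\mathbb F_{ml})\to C^*(\mathbb F_m)\otimes C^*(\mathbb F_l),\qquad \varphi_{m,l}\big(g^{(ml)}_{l(i-1)+j}\big)=g^{(m)}_i\otimes g^{(l)}_j\quad(1\le i\le m,\ 1\le j\le l),$$ and for $1\le n<\infty$ let $$\varphi_{\infty,n}:C^*(\mathbb F_\infty)\to C^*(\mathbb F_\infty)\otimes C^*(\mathbb F_n),\qquad \varphi_{\infty,n}\big(g^{(\infty)}_{n(i-1)+j}\big)=g^{(\infty)}_i\otimes g^{(n)}_j\quad(i\ge1,\ 1\le j\le n)$$ be the unital $*$-homomorphisms with these values on the generators. A strictly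 proper C*-bialgebra is a pair $(A,\Delta)$ of a C*-algebra $A$ and a $*$-homomorphism $\Delta:A\to A\otimes A$ such that the elements $\Delta(a)(b\otimes c)$ span a dense subspace of $A\otimes A$ and $(\Delta\otimes\mathrm{id})\Delta=(\mathrm{id}\otimes\Delta)\Delta$. It is unital if $A$ and $\Delta$ are. A counit is a $*$-homomorphism $\varepsilon:A\to\mathbb C$ with $(\varepsilon\otimes\mathrm{id})\Delta=\mathrm{id}=(\mathrm{id}\otimes\varepsilon)\Delta$. **Theorem.** Let $\mathcal A=\bigoplus_{1\le n<\infty}C^*(\mathbb F_n)$ be the C*-algebraic ($c_0$-) direct sum. There are $*$-homomorphisms $\Delta_\varphi:\mathcal A\to\mathcal A\otimes\mathcal A$, $\varepsilon:\mathcal A\to\mathbb C$ and $\Gamma_\varphi:C^*(\mathbb F_\infty)\to M(C^*(\mathbb F_\infty)\otimes\mathcal A)$ given by $$\Delta_\varphi(x)=\sum_{ml=n}\varphi_{m,l}(x)\quad(x\in C^*(\mathbb F_n)),$$ by $\varepsilon=1$ on $\mathbb F_1\subset C^*(\mathbb F_1)$ and $\varepsilon=0$ on $C^*(\mathbb F_n)$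 for $n\ge2$, and by $\Gamma_\varphi(x)=\prod_{n\ge1}\varphi_{\infty,n}(x)$, that is, $\Gamma_\varphi(x)\,t=\varphi_{\infty,n}(x)\,t$ for all $x\in C^*(\mathbb F_\infty)$, $n\ge 1$ and $t\in C^*(\mathbb F_\infty)\otimes C^*(\mathbb F_n)$. They have the following properties. 1. $(\mathcal A,\Delta_\varphi)$ is a strictly proper C*-bialgebra with counit $\varepsilon$, and it is not cocommutative: $\tau\circ\Delta_\varphi\ne\Delta_\varphi$ for the flip $\tau$ of $\mathcal A\otimes\mathcal A$. 2. $(\mathcal A,\Delta_\varphi)$ satisfies the cancellation law: the linear spans of $\{\Delta_\varphi(a)(I\otimes b):a,b\in\mathcal A\}$ and of $\{\Delta_\varphi(a)(b\otimes I):a,b\in\mathcal A\}$ are dense in $\mathcal A\otimes\mathcal A$. 3. On the smallest unitization $\tilde{\mathcal A}=\mathcal A\oplus\mathbb C$ there are $*$-homomorphisms $\hat\Delta_\varphi:\tilde{\mathcal A}\to\tilde{\mathcal A}\otimes\tilde{\mathcal A}$ and $\tilde\varepsilon:\tilde{\mathcal A}\to\mathbb C$, both unital, which extend $\Delta_\varphi$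 and $\varepsilon$, such that $(\tilde{\mathcal A},\hat\Delta_\varphi,\tilde\varepsilon)$ is a unital counital C*-bialgebra. 4. No dense unital counital subbialgebra of $(\tilde{\mathcal A},\hat\Delta_\varphi,\tilde\varepsilon)$ has an antipode: if $B\subset\tilde{\mathcal A}$ is a norm-dense unital subalgebra with $\hat\Delta_\varphi(B)\subset B\odot B$, there is no linear map $S:B\to B$ with $m(\mathrm{id}\otimes S)\hat\Delta_\varphi(b)=\tilde\varepsilon(b)1=m(S\otimes\mathrm{id})\hat\Delta_\varphi(b)$ for all $b\in B$, where $m$ is the multiplication of $B$. 5. If $\mathbb C\mathbb F_*\subset\mathcal A$ denotes the algebraic direct sum of the group algebras $\mathbb C\mathbb F_n$, $1\le n<\infty$, then $\Delta_\varphi(\mathbb C\mathbb F_*)\subset\mathbb C\mathbb F_*\odot\mathbb C\mathbb F_*$. 6. $C^*(\mathbb F_\infty)$ is a right comodule-C*-algebra of $(\mathcal A,\Delta_\varphi)$ with coaction $\Gamma_\varphi$: $\Gamma_\varphi$ is non-degenerate, and $(\Gamma_\varphi\otimes\mathrm{id})\Gamma_\varphi=(\mathrm{id}\otimes\Delta_\varphi)\Gamma_\varphi$,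 where $\Gamma_\varphi\otimes\mathrm{id}$ and $\mathrm{id}\otimes\Delta_\varphi$ are extended to unital $*$-homomorphisms from $M(C^*(\mathbb F_\infty)\otimes\mathcal A)$ to $M(C^*(\mathbb F_\infty)\otimes\mathcal A\otimes\mathcal A)$. -/

import Mathlib

open scoped TensorProduct InnerProductSpace ENNReal Topology MultiplierAlgebra

set_option linter.unusedSectionVars false

noncomputable section

/-! ### Completion of a complex `*`-algebra with respect to a C*-seminorm -/

/-- A C*-seminorm on a (possibly non-unital) complex `*`-algebra. -/
structure CStarSeminorm (X : Type) [NonUnitalRing X] [StarRing X] [Module ℂ X]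
    extends Seminorm ℂ X where
  mul_le' : ∀ x y : X, toFun (x * y) ≤ toFun x * toFun y
  star_mul_self' : ∀ x : X, toFun (star x * x) = toFun x * toFun x

namespace CStarSeminorm

variable {X : Type} [NonUnitalRing X] [StarRing X] [Module ℂ X] [IsScalarTower ℂ X X]
  [SMulCommClass ℂ X X] [StarModule ℂ X]

/-- The value of a C*-seminorm. -/
def val (p : CStarSeminorm X) (x : X) : ℝ := p.toSeminorm x

theorem val_nonneg (p : CStarSeminorm X) (x : X) : 0 ≤ p.val x := apply_nonneg p.toSeminorm x

theorem val_mul_le (p : CStarSeminorm X) (x y : X) : p.val (x * y) ≤ p.val x * p.val y :=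
  p.mul_le' x y

theorem val_star_mul_self (p : CStarSeminorm X) (x : X) :
    p.val (star x * x) = p.val x * p.val x := p.star_mul_self' x

theorem val_le_star (p : CStarSeminorm X) (x : X) : p.val x ≤ p.val (star x) := by
  rcases (p.val_nonneg x).eq_or_lt with h | h
  · rw [← h]; exact p.val_nonneg _
  · have h1 := p.val_mul_le (star x) x
    rw [p.val_star_mul_self] at h1
    exact le_of_mul_le_mul_right h1 h

theorem val_star (p : CStarSeminorm X) (x : X) : p.val (star x) = p.val x :=
  le_antisymm (by simpa using p.val_le_star (star x)) (p.val_le_star x)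

/-- The `*`-algebra `X`, regarded as a seminormed space by means of `p`. -/
@[nolint unusedArguments]
def Pre (_p : CStarSeminorm X) : Type := X

variable (p : CStarSeminorm X)

instance : NonUnitalRing p.Pre := inferInstanceAs (NonUnitalRing X)
instance : StarRing p.Pre := inferInstanceAs (StarRing X)
instance : Module ℂ p.Pre := inferInstanceAs (Module ℂ X)
instance : IsScalarTower ℂ p.Pre p.Pre := inferInstanceAs (IsScalarTower ℂ X X)
instance : SMulCommClass ℂ p.Pre p.Pre := inferInstanceAs (SMulCommClass ℂ X X)
instance : StarModule ℂ p.Pre := inferInstanceAs (StarModule ℂ X)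

/-- The identity map from `X` to the seminormed space `p.Pre`. -/
def toPre : X ≃ₗ[ℂ] p.Pre := LinearEquiv.refl ℂ X

/-- The seminorm `p`, regarded as a seminorm on `p.Pre`. -/
def preSeminorm : AddGroupSeminorm p.Pre where
  toFun := p.val
  map_zero' := map_zero p.toSeminorm
  add_le' := map_add_le_add p.toSeminorm
  neg' := map_neg_eq_map p.toSeminorm

instance : SeminormedAddCommGroup p.Pre := p.preSeminorm.toSeminormedAddCommGroup

theorem norm_pre (x : p.Pre) : ‖x‖ = p.val x := rfl

instance : NormedSpace ℂ p.Pre where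
  norm_smul_le c x := (map_smul_eq_mul p.toSeminorm c x).le

instance : NonUnitalSeminormedRing p.Pre where
  __ := (inferInstance : SeminormedAddCommGroup p.Pre)
  __ := (inferInstance : NonUnitalRing p.Pre)
  norm_mul_le := p.val_mul_le

theorem norm_star_pre (x : p.Pre) : ‖star x‖ = ‖x‖ := p.val_star x

/-- The Hausdorff completion of `X` with respect to the C*-seminorm `p`: the quotient of `X` by the
null space of `p`, completed in the induced norm. -/
def Completion : Type := UniformSpace.Completion p.Pre

namespace Completion

open UniformSpace.Completion

instance : NormedAddCommGroup p.Completion :=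
  inferInstanceAs (NormedAddCommGroup (UniformSpace.Completion p.Pre))
instance : NormedSpace ℂ p.Completion :=
  inferInstanceAs (NormedSpace ℂ (UniformSpace.Completion p.Pre))
instance : CompleteSpace p.Completion :=
  inferInstanceAs (CompleteSpace (UniformSpace.Completion p.Pre))

/-- The canonical map from `X` to its completion. -/
def of : X →ₗ[ℂ] p.Completion where
  toFun x := ((p.toPre x : p.Pre) : UniformSpace.Completion p.Pre)
  map_add' x y := UniformSpace.Completion.coe_add (p.toPre x) (p.toPre y)
  map_smul' c x := UniformSpace.Completion.coe_smul c (p.toPre x)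

theorem norm_of (x : X) : ‖of p x‖ = p.val x := UniformSpace.Completion.norm_coe (p.toPre x)

theorem denseRange_of : DenseRange (of p) :=
  UniformSpace.Completion.denseRange_coe (α := p.Pre)

variable {p} in
theorem ind {P : p.Completion → Prop} (a : p.Completion) (h : IsClosed {x | P x})
    (h' : ∀ x, P (of p x)) : P a :=
  UniformSpace.Completion.induction_on (α := p.Pre) a h h'

variable {p} in
theorem ind₂ {P : p.Completion → p.Completion → Prop} (a b : p.Completion)
    (h : IsClosed {x : p.Completion × p.Completion | P x.1 x.2})
    (h' : ∀ x y, P (of p x) (of p y)) : P a b :=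
  UniformSpace.Completion.induction_on₂ (α := p.Pre) (β := p.Pre) a b h h'

variable {p} in
theorem ind₃ {P : p.Completion → p.Completion → p.Completion → Prop} (a b c : p.Completion)
    (h : IsClosed {x : p.Completion × p.Completion × p.Completion | P x.1 x.2.1 x.2.2})
    (h' : ∀ x y z, P (of p x) (of p y) (of p z)) : P a b c :=
  UniformSpace.Completion.induction_on₃ (α := p.Pre) (β := p.Pre) (γ := p.Pre) a b c h h'

/-- The multiplication of the completion extends that of `X` continuously. -/
instance : Mul p.Completion :=
  ⟨Function.curry <| (isDenseInducing_coe.prodMap isDenseInducing_coe).extend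
    (((↑) : p.Pre → UniformSpace.Completion p.Pre) ∘ Function.uncurry (· * ·))⟩

theorem of_mul (x y : X) : of p (x * y) = of p x * of p y :=
  ((isDenseInducing_coe.prodMap isDenseInducing_coe).extend_eq
    ((continuous_coe p.Pre).comp (@continuous_mul p.Pre _ _ _)) (p.toPre x, p.toPre y)).symm

instance : ContinuousMul p.Completion where
  continuous_mul := by
    let m := (AddMonoidHom.mul : p.Pre →+ p.Pre →+ p.Pre).compr₂ toCompl
    have : Continuous fun q : p.Pre × p.Pre => m q.1 q.2 :=
      (continuous_coe p.Pre).comp continuous_mul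
    have di : IsDenseInducing (toCompl : p.Pre → UniformSpace.Completion p.Pre) :=
      isDenseInducing_coe
    exact di.extend_Z_bilin di this

theorem uniformContinuous_star_pre : UniformContinuous (star : p.Pre → p.Pre) :=
  (AddMonoidHomClass.isometry_of_norm (starAddEquiv : p.Pre ≃+ p.Pre)
    p.norm_star_pre).uniformContinuous

/-- The involution of the completion extends that of `X` continuously. -/
instance : Star p.Completion :=
  ⟨UniformSpace.Completion.map (star : p.Pre → p.Pre)⟩

theorem of_star (x : X) : of p (star x) = star (of p x) :=
  (UniformSpace.Completion.map_coe (uniformContinuous_star_pre p) (p.toPre x)).symm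

instance : ContinuousStar p.Completion where
  continuous_star := by
    exact UniformSpace.Completion.continuous_map (f := (star : p.Pre → p.Pre))

theorem ring_aux (a b c : p.Completion) :
    (0 * a = 0 ∧ a * 0 = 0) ∧ a * b * c = a * (b * c) ∧ a * (b + c) = a * b + a * c ∧
      (a + b) * c = a * c + b * c := by
  refine ⟨⟨?_, ?_⟩, ?_, ?_, ?_⟩
  · induction a using ind with
    | h => exact isClosed_eq (by fun_prop) (by fun_prop)
    | h' x => rw [← map_zero (of p), ← of_mul, zero_mul]
  · induction a using ind with
    | h => exact isClosed_eq (by fun_prop) (by fun_prop)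
    | h' x => rw [← map_zero (of p), ← of_mul, mul_zero]
  · induction a, b, c using ind₃ with
    | h => exact isClosed_eq (by fun_prop) (by fun_prop)
    | h' x y z => simp only [← of_mul, mul_assoc]
  · induction a, b, c using ind₃ with
    | h => exact isClosed_eq (by fun_prop) (by fun_prop)
    | h' x y z => simp only [← of_mul, ← map_add, mul_add]
  · induction a, b, c using ind₃ with
    | h => exact isClosed_eq (by fun_prop) (by fun_prop)
    | h' x y z => simp only [← of_mul, ← map_add, add_mul]

theorem star_aux (a b : p.Completion) :
    star (star a) = a ∧ star (a * b) = star b * star a ∧ star (a + b) = star a + star b := by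
  refine ⟨?_, ?_, ?_⟩
  · induction a using ind with
    | h => exact isClosed_eq (by fun_prop) (by fun_prop)
    | h' x => simp only [← of_star, star_star]
  · induction a, b using ind₂ with
    | h => exact isClosed_eq (by fun_prop) (by fun_prop)
    | h' x y => simp only [← of_mul, ← of_star, star_mul]
  · induction a, b using ind₂ with
    | h => exact isClosed_eq (by fun_prop) (by fun_prop)
    | h' x y => simp only [← map_add, ← of_star, star_add]

theorem norm_aux (a b : p.Completion) : ‖a * b‖ ≤ ‖a‖ * ‖b‖ ∧ ‖a‖ * ‖a‖ ≤ ‖star a * a‖ := by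
  refine ⟨?_, ?_⟩
  · induction a, b using ind₂ with
    | h => exact isClosed_le (by fun_prop) (by fun_prop)
    | h' x y => rw [← of_mul, norm_of, norm_of, norm_of]; exact p.val_mul_le x y
  · induction a using ind with
    | h => exact isClosed_le (by fun_prop) (by fun_prop)
    | h' x => rw [← of_star, ← of_mul, norm_of, norm_of, p.val_star_mul_self]

theorem smul_aux (c : ℂ) (a b : p.Completion) :
    (c • a) * b = c • (a * b) ∧ a * (c • b) = c • (a * b) ∧ star (c • a) = star c • star a := by
  have hc : Continuous fun a : p.Completion => c • a := continuous_const_smul c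
  have hc' : Continuous fun a : p.Completion => star c • a := continuous_const_smul (star c)
  have hm : Continuous fun a : p.Completion × p.Completion => a.1 * a.2 := continuous_mul
  refine ⟨?_, ?_, ?_⟩
  · refine ind₂ (P := fun a b => (c • a) * b = c • (a * b)) a b (isClosed_eq
      (hm.comp ((hc.comp continuous_fst).prodMk continuous_snd)) (hc.comp hm)) fun x y => ?_
    rw [← map_smul, ← of_mul, ← of_mul, ← map_smul, smul_mul_assoc]
  · refine ind₂ (P := fun a b => a * (c • b) = c • (a * b)) a b (isClosed_eq
      (hm.comp (continuous_fst.prodMk (hc.comp continuous_snd))) (hc.comp hm)) fun x y => ?_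
    rw [← map_smul, ← of_mul, ← of_mul, ← map_smul, mul_smul_comm]
  · refine ind (P := fun a => star (c • a) = star c • star a) a (isClosed_eq
      (continuous_star.comp hc) (hc'.comp continuous_star)) fun x => ?_
    rw [← map_smul, ← of_star, ← of_star, ← map_smul, star_smul]

instance : NonUnitalNormedRing p.Completion where
  __ := (inferInstance : NormedAddCommGroup p.Completion)
  __ := (inferInstance : Mul p.Completion)
  zero_mul a := (ring_aux p a a a).1.1
  mul_zero a := (ring_aux p a a a).1.2
  mul_assoc a b c := (ring_aux p a b c).2.1
  left_distrib a b c := (ring_aux p a b c).2.2.1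
  right_distrib a b c := (ring_aux p a b c).2.2.2
  norm_mul_le a b := (norm_aux p a b).1

instance : StarRing p.Completion where
  star_involutive a := (star_aux p a a).1
  star_mul a b := (star_aux p a b).2.1
  star_add a b := (star_aux p a b).2.2

instance : NonUnitalCStarAlgebra p.Completion where
  __ := (inferInstance : NormedSpace ℂ p.Completion)
  norm_mul_self_le a := (norm_aux p a a).2
  smul_assoc c a b := (smul_aux p c a b).1
  smul_comm c a b := ((smul_aux p c a b).2.1).symm
  star_smul c a := (smul_aux p c a a).2.2
  complete := CompleteSpace.complete

/-- A linear map into a C*-algebra which is contractive for `p` extends to the completion. -/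
def liftCLM {D : Type} [NonUnitalCStarAlgebra D] (f : X →ₗ[ℂ] D) (hf : ∀ x, ‖f x‖ ≤ p.val x) :
    p.Completion →L[ℂ] D :=
  (LinearMap.mkContinuous (E := p.Pre) (f ∘ₗ p.toPre.symm.toLinearMap) 1
    fun x => by rw [one_mul]; exact hf x).fromCompletion

theorem liftCLM_of {D : Type} [NonUnitalCStarAlgebra D] (f : X →ₗ[ℂ] D)
    (hf : ∀ x, ‖f x‖ ≤ p.val x) (x : X) : liftCLM p f hf (of p x) = f x :=
  ContinuousLinearMap.fromCompletion_apply_coe (α := p.Pre) _ (p.toPre x)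

/-- A `*`-homomorphism which is contractive for `p` extends to the completion. -/
def lift {D : Type} [NonUnitalCStarAlgebra D] (f : X →⋆ₙₐ[ℂ] D) (hf : ∀ x, ‖f x‖ ≤ p.val x) :
    p.Completion →⋆ₙₐ[ℂ] D :=
  let f' : X →ₗ[ℂ] D := { toFun := fun x => f x, map_add' := map_add f, map_smul' := map_smul f }
  have hf' : ∀ x, ‖f' x‖ ≤ p.val x := hf
  have hF : ∀ x, liftCLM p f' hf' (of p x) = f x := liftCLM_of p f' hf'
  { toFun := liftCLM p f' hf'
    map_smul' := map_smul _
    map_zero' := map_zero _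
    map_add' := map_add _
    map_mul' := fun a b => by
      induction a, b using ind₂ with
      | h => exact isClosed_eq (by fun_prop) (by fun_prop)
      | h' x y => rw [← of_mul, hF, hF, hF, map_mul]
    map_star' := fun a => by
      induction a using ind with
      | h => exact isClosed_eq (by fun_prop) (by fun_prop)
      | h' x => rw [← of_star, hF, hF, map_star] }

@[simp]
theorem lift_of {D : Type} [NonUnitalCStarAlgebra D] (f : X →⋆ₙₐ[ℂ] D)
    (hf : ∀ x, ‖f x‖ ≤ p.val x) (x : X) : lift p f hf (of p x) = f x :=
  liftCLM_of p _ _ x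

/-- The canonical map from `X` to its completion, as a `*`-homomorphism. -/
def ofHom : X →⋆ₙₐ[ℂ] p.Completion where
  toFun := of p
  map_smul' := map_smul (of p)
  map_zero' := map_zero (of p)
  map_add' := map_add (of p)
  map_mul' := of_mul p
  map_star' := of_star p

end Completion

end CStarSeminorm

/-! ### Representations on Hilbert spaces -/

/-- A `*`-representation of a `*`-algebra by bounded operators on a complex Hilbert space. -/
structure HilbertRep (X : Type) [NonUnitalRing X] [StarRing X] [Module ℂ X] : Type 1 where
  H : Type
  [normed : NormedAddCommGroup H]
  [inner : InnerProductSpace ℂ H]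
  [complete : CompleteSpace H]
  hom : X →⋆ₙₐ[ℂ] (H →L[ℂ] H)

attribute [instance] HilbertRep.normed HilbertRep.inner HilbertRep.complete

namespace HilbertRep

variable {X Y : Type} [NonUnitalRing X] [StarRing X] [Module ℂ X]
  [NonUnitalRing Y] [StarRing Y] [Module ℂ Y]

/-- The pull-back of a representation along a `*`-homomorphism. -/
def comap (π : HilbertRep Y) (f : X →⋆ₙₐ[ℂ] Y) : HilbertRep X where
  H := π.H
  hom := π.hom.comp f

@[simp]
theorem comap_hom_apply (π : HilbertRep Y) (f : X →⋆ₙₐ[ℂ] Y) (x : X) :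
    (π.comap f).hom x = π.hom (f x) := rfl

/-- The C*-seminorm `x ↦ sup_i ‖ρ_i(x)‖` given by a pointwise bounded family of representations. -/
def seminorm {ι : Type*} (ρ : ι → HilbertRep X)
    (hρ : ∀ x, BddAbove (Set.range fun i => ‖(ρ i).hom x‖)) : CStarSeminorm X where
  toFun x := ⨆ i, ‖(ρ i).hom x‖
  map_zero' := by simp
  add_le' x y := Real.iSup_le (fun i => by
      rw [map_add]
      exact (norm_add_le _ _).trans (add_le_add (le_ciSup (hρ x) i) (le_ciSup (hρ y) i)))
    (add_nonneg (Real.iSup_nonneg fun _ => norm_nonneg _) (Real.iSup_nonneg fun _ => norm_nonneg _))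
  neg' x := by simp
  smul' c x := by
    simp only [map_smul, norm_smul]
    rw [Real.mul_iSup_of_nonneg (norm_nonneg c)]
  mul_le' x y := Real.iSup_le (fun i => by
      rw [map_mul]
      exact (norm_mul_le _ _).trans (mul_le_mul (le_ciSup (hρ x) i) (le_ciSup (hρ y) i)
        (norm_nonneg _) (Real.iSup_nonneg fun _ => norm_nonneg _)))
    (mul_nonneg (Real.iSup_nonneg fun _ => norm_nonneg _) (Real.iSup_nonneg fun _ => norm_nonneg _))
  star_mul_self' x := by
    have h0 : 0 ≤ ⨆ i, ‖(ρ i).hom x‖ := Real.iSup_nonneg fun _ => norm_nonneg _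
    have h1 : ∀ i, ‖(ρ i).hom (star x * x)‖ = ‖(ρ i).hom x‖ * ‖(ρ i).hom x‖ := fun i => by
      rw [map_mul, map_star, CStarRing.norm_star_mul_self]
    apply le_antisymm
    · refine Real.iSup_le (fun i => ?_) (mul_nonneg h0 h0)
      rw [h1]
      exact mul_le_mul (le_ciSup (hρ x) i) (le_ciSup (hρ x) i) (norm_nonneg _) h0
    · have h2 : (⨆ i, ‖(ρ i).hom x‖) ≤ √(⨆ i, ‖(ρ i).hom (star x * x)‖) :=
        Real.iSup_le (fun i => Real.le_sqrt_of_sq_le (by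
          rw [sq, ← h1]; exact le_ciSup (hρ (star x * x)) i)) (Real.sqrt_nonneg _)
      calc _ ≤ √(⨆ i, ‖(ρ i).hom (star x * x)‖) * √(⨆ i, ‖(ρ i).hom (star x * x)‖) :=
            mul_le_mul h2 h2 h0 (Real.sqrt_nonneg _)
        _ = _ := Real.mul_self_sqrt (Real.iSup_nonneg fun _ => norm_nonneg _)

theorem seminorm_val {ι : Type*} (ρ : ι → HilbertRep X)
    (hρ : ∀ x, BddAbove (Set.range fun i => ‖(ρ i).hom x‖)) (x : X) :
    (seminorm ρ hρ).val x = ⨆ i, ‖(ρ i).hom x‖ := rfl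

theorem le_seminorm_val {ι : Type*} (ρ : ι → HilbertRep X)
    (hρ : ∀ x, BddAbove (Set.range fun i => ‖(ρ i).hom x‖)) (i : ι) (x : X) :
    ‖(ρ i).hom x‖ ≤ (seminorm ρ hρ).val x := le_ciSup (hρ x) i

end HilbertRep

/-! ### The minimal tensor product -/

section TensorStar

variable {A B A' B' : Type} [NonUnitalCStarAlgebra A] [NonUnitalCStarAlgebra B]
  [NonUnitalCStarAlgebra A'] [NonUnitalCStarAlgebra B']

/-- The algebraic tensor product of two C*-algebras is a `*`-algebra. -/
instance tensorStarRing : StarRing (A ⊗[ℂ] B) where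
  star_mul x y := by
    induction x with
    | zero => simp
    | add x₁ x₂ h₁ h₂ => rw [add_mul, star_add, h₁, h₂, star_add, mul_add]
    | tmul a b =>
      induction y with
      | zero => simp
      | add y₁ y₂ h₁ h₂ => rw [mul_add, star_add, h₁, h₂, star_add, add_mul]
      | tmul c d =>
        simp only [TensorProduct.star_tmul, Algebra.TensorProduct.tmul_mul_tmul, star_mul]
  star_add := star_add

/-- The tensor product of two `*`-homomorphisms on the algebraic tensor product. -/
def algTensorMap (f : A →⋆ₙₐ[ℂ] A') (g : B →⋆ₙₐ[ℂ] B') : A ⊗[ℂ] B →⋆ₙₐ[ℂ] A' ⊗[ℂ] B' :=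
  let F : A ⊗[ℂ] B →ₗ[ℂ] A' ⊗[ℂ] B' :=
    TensorProduct.map { toFun := f, map_add' := map_add f, map_smul' := map_smul f }
      { toFun := g, map_add' := map_add g, map_smul' := map_smul g }
  { toFun := F
    map_smul' := map_smul F
    map_zero' := map_zero F
    map_add' := map_add F
    map_mul' := fun x y => by
      induction x with
      | zero => simp
      | add x₁ x₂ h₁ h₂ => rw [add_mul, map_add, h₁, h₂, map_add, add_mul]
      | tmul a b =>
        induction y with
        | zero => simp
        | add y₁ y₂ h₁ h₂ => rw [mul_add, map_add, h₁, h₂, map_add, mul_add]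
        | tmul c d => simp [F, Algebra.TensorProduct.tmul_mul_tmul]
    map_star' := fun x => by
      induction x with
      | zero => simp
      | add x₁ x₂ h₁ h₂ => rw [star_add, map_add, h₁, h₂, map_add, star_add]
      | tmul a b => simp [F, map_star] }

@[simp]
theorem algTensorMap_tmul (f : A →⋆ₙₐ[ℂ] A') (g : B →⋆ₙₐ[ℂ] B') (a : A) (b : B) :
    algTensorMap f g (a ⊗ₜ b) = f a ⊗ₜ g b := rfl

end TensorStar

namespace HilbertRep

section

variable {H K : Type} [NormedAddCommGroup H] [InnerProductSpace ℂ H]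
  [NormedAddCommGroup K] [InnerProductSpace ℂ K]

variable (H K) in
/-- The Hilbert space tensor product of `H` and `K`: the completion of the algebraic tensor product
with respect to `⟪x ⊗ y, x' ⊗ y'⟫ = ⟪x, x'⟫ * ⟪y, y'⟫`. -/
def HilbertTensor : Type := UniformSpace.Completion (H ⊗[ℂ] K)

instance : NormedAddCommGroup (HilbertTensor H K) :=
  inferInstanceAs (NormedAddCommGroup (UniformSpace.Completion (H ⊗[ℂ] K)))
instance : InnerProductSpace ℂ (HilbertTensor H K) :=
  inferInstanceAs (InnerProductSpace ℂ (UniformSpace.Completion (H ⊗[ℂ] K)))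
instance : CompleteSpace (HilbertTensor H K) :=
  inferInstanceAs (CompleteSpace (UniformSpace.Completion (H ⊗[ℂ] K)))

variable (H K) in
/-- The canonical isometric embedding of the algebraic tensor product. -/
def incl : H ⊗[ℂ] K →ₗᵢ[ℂ] HilbertTensor H K :=
  (UniformSpace.Completion.toComplₗᵢ : (H ⊗[ℂ] K) →ₗᵢ[ℂ] UniformSpace.Completion (H ⊗[ℂ] K))

theorem inner_incl (x y : H ⊗[ℂ] K) : ⟪incl H K x, incl H K y⟫_ℂ = ⟪x, y⟫_ℂ :=
  UniformSpace.Completion.inner_coe x y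

theorem ind {P : HilbertTensor H K → Prop} (z : HilbertTensor H K) (h : IsClosed {z | P z})
    (h' : ∀ x, P (incl H K x)) : P z :=
  UniformSpace.Completion.induction_on (α := H ⊗[ℂ] K) z h h'

/-- The operator `S ⊗ T` on the Hilbert space tensor product. -/
def opTensor (S : H →L[ℂ] H) (T : K →L[ℂ] K) : HilbertTensor H K →L[ℂ] HilbertTensor H K :=
  LinearMap.mkContinuous
    { toFun := (TensorProduct.mapL S T).completion
      map_add' := map_add (TensorProduct.mapL S T).completion
      map_smul' := map_smul (TensorProduct.mapL S T).completion } (‖S‖ * ‖T‖) fun z => by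
    induction z using ind with
    | h =>
      exact isClosed_le ((TensorProduct.mapL S T).completion.continuous.norm)
        (continuous_const.mul continuous_norm)
    | h' z =>
      refine ((congrArg norm (ContinuousLinearMap.completion_apply_coe
        (TensorProduct.mapL S T) z)).trans (UniformSpace.Completion.norm_coe _)).trans_le ?_
      rw [LinearIsometry.norm_map]
      exact ((TensorProduct.mapL S T).le_opNorm z).trans
        (mul_le_mul_of_nonneg_right (TensorProduct.norm_mapL_le S T) (norm_nonneg _))

theorem opTensor_incl (S : H →L[ℂ] H) (T : K →L[ℂ] K) (x : H ⊗[ℂ] K) :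
    opTensor S T (incl H K x) = incl H K (TensorProduct.mapL S T x) :=
  ContinuousLinearMap.completion_apply_coe (TensorProduct.mapL S T) x

theorem opTensor_tmul (S : H →L[ℂ] H) (T : K →L[ℂ] K) (x : H) (y : K) :
    opTensor S T (incl H K (x ⊗ₜ y)) = incl H K (S x ⊗ₜ T y) := opTensor_incl S T _

theorem op_ext {S T : HilbertTensor H K →L[ℂ] HilbertTensor H K}
    (h : ∀ (x : H) (y : K), S (incl H K (x ⊗ₜ y)) = T (incl H K (x ⊗ₜ y))) : S = T := by
  ext z
  induction z using ind with
  | h => exact isClosed_eq (by fun_prop) (by fun_prop)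
  | h' z =>
    induction z with
    | zero => simp
    | add x y hx hy => rw [map_add, map_add, map_add, hx, hy]
    | tmul x y => exact h x y

theorem norm_opTensor_le (S : H →L[ℂ] H) (T : K →L[ℂ] K) :
    ‖opTensor S T‖ ≤ ‖S‖ * ‖T‖ :=
  LinearMap.mkContinuous_norm_le _ (by positivity) _

/-- `opTensor` as a bilinear map. -/
def opTensorBilin : (H →L[ℂ] H) →ₗ[ℂ] (K →L[ℂ] K) →ₗ[ℂ]
    (HilbertTensor H K →L[ℂ] HilbertTensor H K) :=
  LinearMap.mk₂ ℂ opTensor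
    (fun S S' T => op_ext fun x y => by
      simp [opTensor_tmul, TensorProduct.add_tmul])
    (fun c S T => op_ext fun x y => by
      simp [opTensor_tmul, TensorProduct.smul_tmul])
    (fun S T T' => op_ext fun x y => by
      simp [opTensor_tmul, TensorProduct.tmul_add])
    (fun c S T => op_ext fun x y => by
      simp [opTensor_tmul])

theorem opTensor_mul (S S' : H →L[ℂ] H) (T T' : K →L[ℂ] K) :
    opTensor (S * S') (T * T') = opTensor S T * opTensor S' T' :=
  op_ext fun x y => by simp [opTensor_tmul]

theorem opTensor_star [CompleteSpace H] [CompleteSpace K] (S : H →L[ℂ] H) (T : K →L[ℂ] K) :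
    opTensor (star S) (star T) = star (opTensor S T) := by
  rw [ContinuousLinearMap.star_eq_adjoint (opTensor S T), ContinuousLinearMap.eq_adjoint_iff]
  intro z w
  induction z using ind with
  | h => exact isClosed_eq (by fun_prop) (by fun_prop)
  | h' z =>
  induction w using ind with
  | h => exact isClosed_eq (by fun_prop) (by fun_prop)
  | h' w =>
    rw [opTensor_incl, opTensor_incl, inner_incl, inner_incl]
    induction z with
    | zero => simp
    | add x y hx hy => rw [map_add, inner_add_left, hx, hy, inner_add_left]
    | tmul x y =>
      induction w with
      | zero => simp
      | add x y hx hy => rw [map_add, inner_add_right, hx, hy, inner_add_right]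
      | tmul x' y' =>
        simp [TensorProduct.inner_tmul, ContinuousLinearMap.star_eq_adjoint,
          ContinuousLinearMap.adjoint_inner_left]

end

variable {A B : Type} [NonUnitalCStarAlgebra A] [NonUnitalCStarAlgebra B]

/-- The linear map underlying the tensor product of two representations. -/
def tensorLin (π : HilbertRep A) (σ : HilbertRep B) : A ⊗[ℂ] B →ₗ[ℂ]
    (HilbertTensor π.H σ.H →L[ℂ] HilbertTensor π.H σ.H) :=
  TensorProduct.lift (opTensorBilin.compl₁₂
    ({ toFun := π.hom, map_add' := map_add π.hom, map_smul' := map_smul π.hom } :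
      A →ₗ[ℂ] (π.H →L[ℂ] π.H))
    ({ toFun := σ.hom, map_add' := map_add σ.hom, map_smul' := map_smul σ.hom } :
      B →ₗ[ℂ] (σ.H →L[ℂ] σ.H)))

theorem tensorLin_tmul (π : HilbertRep A) (σ : HilbertRep B) (a : A) (b : B) :
    tensorLin π σ (a ⊗ₜ b) = opTensor (π.hom a) (σ.hom b) := rfl

theorem tensorLin_mul (π : HilbertRep A) (σ : HilbertRep B) (x y : A ⊗[ℂ] B) :
    tensorLin π σ (x * y) = tensorLin π σ x * tensorLin π σ y := by
  induction x with
  | zero => rw [zero_mul, map_zero, zero_mul]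
  | add x₁ x₂ h₁ h₂ => rw [add_mul, map_add, h₁, h₂, map_add, add_mul]
  | tmul a b =>
    induction y with
    | zero => rw [mul_zero, map_zero, mul_zero]
    | add y₁ y₂ h₁ h₂ => rw [mul_add, map_add, h₁, h₂, map_add, mul_add]
    | tmul c d =>
      rw [Algebra.TensorProduct.tmul_mul_tmul, tensorLin_tmul, tensorLin_tmul,
        tensorLin_tmul, map_mul, map_mul, opTensor_mul]

theorem tensorLin_star (π : HilbertRep A) (σ : HilbertRep B) (x : A ⊗[ℂ] B) :
    tensorLin π σ (star x) = star (tensorLin π σ x) := by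
  induction x with
  | zero => rw [star_zero, map_zero, star_zero]
  | add x₁ x₂ h₁ h₂ => rw [star_add, map_add, h₁, h₂, map_add, star_add]
  | tmul a b =>
    rw [TensorProduct.star_tmul, tensorLin_tmul, tensorLin_tmul, map_star, map_star,
      opTensor_star]

/-- The tensor product `π ⊗ σ` of two representations: a representation of the algebraic tensor
product with `(π ⊗ σ)(a ⊗ b) = π(a) ⊗ σ(b)`. -/
def tensor (π : HilbertRep A) (σ : HilbertRep B) : HilbertRep (A ⊗[ℂ] B) where
  H := HilbertTensor π.H σ.H
  hom :=
    { toFun := tensorLin π σ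
      map_smul' := map_smul _
      map_zero' := map_zero _
      map_add' := map_add _
      map_mul' := tensorLin_mul π σ
      map_star' := tensorLin_star π σ }

theorem tensor_hom_tmul (π : HilbertRep A) (σ : HilbertRep B) (a : A) (b : B) :
    (π.tensor σ).hom (a ⊗ₜ b) = opTensor (π.hom a) (σ.hom b) := rfl

theorem bddAbove_tensor (x : A ⊗[ℂ] B) : BddAbove (Set.range
    fun i : HilbertRep A × HilbertRep B => ‖(i.1.tensor i.2).hom x‖) := by
  induction x with
  | zero => exact ⟨0, by rintro _ ⟨i, rfl⟩; simp⟩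
  | add x y hx hy =>
    obtain ⟨c, hc⟩ := hx
    obtain ⟨d, hd⟩ := hy
    refine ⟨c + d, ?_⟩
    rintro _ ⟨i, rfl⟩
    simp only [map_add]
    exact (norm_add_le _ _).trans (add_le_add (hc ⟨i, rfl⟩) (hd ⟨i, rfl⟩))
  | tmul a b =>
    refine ⟨‖a‖ * ‖b‖, ?_⟩
    rintro _ ⟨i, rfl⟩
    exact (norm_opTensor_le _ _).trans (mul_le_mul (NonUnitalStarAlgHom.norm_apply_le i.1.hom a)
      (NonUnitalStarAlgHom.norm_apply_le i.2.hom b) (norm_nonneg _) (norm_nonneg _))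

theorem tensor_comap {A' B' : Type} [NonUnitalCStarAlgebra A'] [NonUnitalCStarAlgebra B']
    (f : A →⋆ₙₐ[ℂ] A') (g : B →⋆ₙₐ[ℂ] B') (π : HilbertRep A') (σ : HilbertRep B') (x : A ⊗[ℂ] B) :
    (π.tensor σ).hom (algTensorMap f g x) = ((π.comap f).tensor (σ.comap g)).hom x := by
  induction x with
  | zero => rw [map_zero, map_zero]; exact (map_zero _).symm
  | add x y hx hy => rw [map_add, map_add, hx, hy]; exact (map_add _ x y).symm
  | tmul a b => rfl

end HilbertRep

section MinTensor

variable (A B : Type) [NonUnitalCStarAlgebra A] [NonUnitalCStarAlgebra B]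

/-- The minimal (spatial) C*-norm on the algebraic tensor product: the supremum of `‖(π ⊗ σ)(x)‖`
over all representations `π` of `A` and `σ` of `B` on Hilbert spaces. -/
def minSeminorm : CStarSeminorm (A ⊗[ℂ] B) :=
  HilbertRep.seminorm (fun i : HilbertRep A × HilbertRep B => i.1.tensor i.2)
    HilbertRep.bddAbove_tensor

/-- The minimal C*-tensor product of two C*-algebras. -/
def MinTensor : Type := (minSeminorm A B).Completion

instance : NonUnitalCStarAlgebra (MinTensor A B) :=
  inferInstanceAs (NonUnitalCStarAlgebra (minSeminorm A B).Completion)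

end MinTensor

/-- Notation for the minimal C*-tensor product. -/
infixl:70 " ⊗ᵐ " => MinTensor

namespace MinTensor

variable {A B A' B' : Type} [NonUnitalCStarAlgebra A] [NonUnitalCStarAlgebra B]
  [NonUnitalCStarAlgebra A'] [NonUnitalCStarAlgebra B']

/-- The canonical `*`-homomorphism from the algebraic to the minimal tensor product. -/
def ofAlg : A ⊗[ℂ] B →⋆ₙₐ[ℂ] A ⊗ᵐ B := CStarSeminorm.Completion.ofHom (minSeminorm A B)

/-- The elementary tensor `a ⊗ b` in the minimal tensor product. -/
def tmul (a : A) (b : B) : A ⊗ᵐ B := ofAlg (a ⊗ₜ b)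

/-- The tensor product `f ⊗ g` of two `*`-homomorphisms. -/
def map (f : A →⋆ₙₐ[ℂ] A') (g : B →⋆ₙₐ[ℂ] B') : A ⊗ᵐ B →⋆ₙₐ[ℂ] A' ⊗ᵐ B' :=
  CStarSeminorm.Completion.lift (minSeminorm A B) (ofAlg.comp (algTensorMap f g)) fun x => by
    refine (CStarSeminorm.Completion.norm_of (minSeminorm A' B') (algTensorMap f g x)).trans_le ?_
    refine Real.iSup_le (fun i => ?_) (CStarSeminorm.val_nonneg _ x)
    rw [HilbertRep.tensor_comap]
    exact HilbertRep.le_seminorm_val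
      (fun i : HilbertRep A × HilbertRep B => i.1.tensor i.2) HilbertRep.bddAbove_tensor
      (i.1.comap f, i.2.comap g) x

@[simp]
theorem map_ofAlg (f : A →⋆ₙₐ[ℂ] A') (g : B →⋆ₙₐ[ℂ] B') (x : A ⊗[ℂ] B) :
    map f g (ofAlg x) = ofAlg (algTensorMap f g x) :=
  CStarSeminorm.Completion.lift_of (minSeminorm A B) _ _ x

@[simp]
theorem map_tmul (f : A →⋆ₙₐ[ℂ] A') (g : B →⋆ₙₐ[ℂ] B') (a : A) (b : B) :
    map f g (tmul a b) = tmul (f a) (g b) := map_ofAlg f g (a ⊗ₜ b)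

end MinTensor

/-! ### Full group C*-algebras -/

section GroupAlgebra

variable {G : Type} [Group G]

/-- The involution of the complex group algebra: `g ↦ g⁻¹`, extended conjugate-linearly. -/
instance groupAlgStar : Star (MonoidAlgebra ℂ G) :=
  ⟨fun x => MonoidAlgebra.ofCoeff
    ((x.coeff.mapRange (starRingEnd ℂ) (map_zero _)).equivMapDomain (Equiv.inv G))⟩

theorem coeff_star (x : MonoidAlgebra ℂ G) (g : G) :
    (star x).coeff g = starRingEnd ℂ (x.coeff g⁻¹) := rfl

theorem star_single (g : G) (c : ℂ) :
    star (MonoidAlgebra.single g c) = MonoidAlgebra.single g⁻¹ (starRingEnd ℂ c) := by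
  ext h
  rw [coeff_star]
  by_cases hh : g = h⁻¹
  · subst hh; simp
  · have h' : g⁻¹ ≠ h := fun e => hh (by rw [← e, inv_inv])
    simp [MonoidAlgebra.coeff_single, hh, h']

theorem groupAlg_star_add (x y : MonoidAlgebra ℂ G) : star (x + y) = star x + star y := by
  ext h
  rw [MonoidAlgebra.coeff_add, Finsupp.add_apply]
  simp only [coeff_star, MonoidAlgebra.coeff_add, Finsupp.add_apply, map_add]

theorem groupAlg_star_zero : star (0 : MonoidAlgebra ℂ G) = 0 := by
  ext h
  simp [coeff_star]

instance groupAlgStarRing : StarRing (MonoidAlgebra ℂ G) where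
  star_involutive x := by
    ext h
    simp [coeff_star]
  star_add := groupAlg_star_add
  star_mul x y := by
    induction x using MonoidAlgebra.induction_linear with
    | zero => simp [groupAlg_star_zero]
    | add x₁ x₂ h₁ h₂ =>
      rw [add_mul, groupAlg_star_add, h₁, h₂, groupAlg_star_add, mul_add]
    | single g a =>
      induction y using MonoidAlgebra.induction_linear with
      | zero => simp [groupAlg_star_zero]
      | add y₁ y₂ h₁ h₂ =>
        rw [mul_add, groupAlg_star_add, h₁, h₂, groupAlg_star_add, add_mul]
      | single h b =>
        simp only [MonoidAlgebra.single_mul_single, star_single, mul_inv_rev, map_mul, mul_comm]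

instance groupAlgStarModule : StarModule ℂ (MonoidAlgebra ℂ G) where
  star_smul c x := by
    ext h
    simp [coeff_star]

/-- The `*`-homomorphism on the group algebra given by a multiplicative map `v` from the group into
a complex `*`-algebra with `v g⁻¹ = (v g)*`. -/
def groupAlgLift {X : Type} [NonUnitalRing X] [StarRing X] [Module ℂ X] [IsScalarTower ℂ X X]
    [SMulCommClass ℂ X X] [StarModule ℂ X] (v : G → X) (hmul : ∀ g h, v (g * h) = v g * v h)
    (hstar : ∀ g, v g⁻¹ = star (v g)) : MonoidAlgebra ℂ G →⋆ₙₐ[ℂ] X :=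
  let F : MonoidAlgebra ℂ G →ₗ[ℂ] X :=
    (Finsupp.linearCombination ℂ v) ∘ₗ (MonoidAlgebra.coeffLinearEquiv ℂ).toLinearMap
  have hF : ∀ g c, F (MonoidAlgebra.single g c) = c • v g := fun g c => by
    simp [F]
  { toFun := F
    map_smul' := map_smul F
    map_zero' := map_zero F
    map_add' := map_add F
    map_mul' := fun x y => by
      induction x using MonoidAlgebra.induction_linear with
      | zero => simp
      | add x₁ x₂ h₁ h₂ => rw [add_mul, map_add, h₁, h₂, map_add, add_mul]
      | single g a =>
        induction y using MonoidAlgebra.induction_linear with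
        | zero => simp
        | add y₁ y₂ h₁ h₂ => rw [mul_add, map_add, h₁, h₂, map_add, mul_add]
        | single h b =>
          rw [MonoidAlgebra.single_mul_single, hF, hF, hF, hmul, smul_mul_smul_comm]
    map_star' := fun x => by
      induction x using MonoidAlgebra.induction_linear with
      | zero => simp
      | add x₁ x₂ h₁ h₂ => rw [star_add, map_add, h₁, h₂, map_add, star_add]
      | single g a => rw [star_single, hF, hF, hstar, star_smul]; rfl }

theorem groupAlgLift_single {X : Type} [NonUnitalRing X] [StarRing X] [Module ℂ X]
    [IsScalarTower ℂ X X] [SMulCommClass ℂ X X] [StarModule ℂ X] (v : G → X)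
    (hmul : ∀ g h, v (g * h) = v g * v h) (hstar : ∀ g, v g⁻¹ = star (v g)) (g : G) (c : ℂ) :
    groupAlgLift v hmul hstar (MonoidAlgebra.single g c) = c • v g := by
  change (Finsupp.linearCombination ℂ v) (MonoidAlgebra.single g c).coeff = _
  simp

theorem norm_rep_single_le (π : HilbertRep (MonoidAlgebra ℂ G)) (g : G) (c : ℂ) :
    ‖π.hom (MonoidAlgebra.single g c)‖ ≤ ‖c‖ := by
  have key : ∀ g : G, ‖π.hom (MonoidAlgebra.single g 1)‖ * ‖π.hom (MonoidAlgebra.single g 1)‖ =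
      ‖π.hom (MonoidAlgebra.single 1 1)‖ := fun g => by
    rw [← CStarRing.norm_star_mul_self, ← map_star, ← map_mul, star_single,
      MonoidAlgebra.single_mul_single]
    simp
  have h1 : ‖π.hom (MonoidAlgebra.single (1 : G) 1)‖ ≤ 1 := by
    have := key 1
    nlinarith [norm_nonneg (π.hom (MonoidAlgebra.single (1 : G) 1))]
  have h2 : ‖π.hom (MonoidAlgebra.single g 1)‖ ≤ 1 := by
    have := key g
    nlinarith [norm_nonneg (π.hom (MonoidAlgebra.single g 1))]
  have h3 : MonoidAlgebra.single g c = c • MonoidAlgebra.single g (1 : ℂ) := by simp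
  rw [h3, map_smul, norm_smul]
  exact mul_le_of_le_one_right (norm_nonneg c) h2

theorem bddAbove_groupAlg (x : MonoidAlgebra ℂ G) : BddAbove (Set.range
    fun π : HilbertRep (MonoidAlgebra ℂ G) => ‖π.hom x‖) := by
  induction x using MonoidAlgebra.induction_linear with
  | zero => exact ⟨0, by rintro _ ⟨i, rfl⟩; simp⟩
  | add x y hx hy =>
    obtain ⟨c, hc⟩ := hx
    obtain ⟨d, hd⟩ := hy
    refine ⟨c + d, ?_⟩
    rintro _ ⟨i, rfl⟩
    simp only [map_add]
    exact (norm_add_le _ _).trans (add_le_add (hc ⟨i, rfl⟩) (hd ⟨i, rfl⟩))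
  | single g c => exact ⟨‖c‖, by rintro _ ⟨i, rfl⟩; exact norm_rep_single_le i g c⟩

variable (G)

/-- The universal C*-norm on the group algebra: the supremum of `‖π(x)‖` over all
`*`-representations `π` on Hilbert spaces (the non-degenerate ones are exactly the linear extensions
of the unitary representations of `G`). -/
def fullSeminorm : CStarSeminorm (MonoidAlgebra ℂ G) :=
  HilbertRep.seminorm (fun π : HilbertRep (MonoidAlgebra ℂ G) => π) bddAbove_groupAlg

/-- The full group C*-algebra `C*(G)`. -/
def GroupCStar : Type := (fullSeminorm G).Completion

instance : NonUnitalCStarAlgebra (GroupCStar G) :=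
  inferInstanceAs (NonUnitalCStarAlgebra (fullSeminorm G).Completion)

namespace GroupCStar

variable {G}

/-- The canonical map from the group algebra into `C*(G)`. -/
def ofAlg : MonoidAlgebra ℂ G →⋆ₙₐ[ℂ] GroupCStar G :=
  CStarSeminorm.Completion.ofHom (fullSeminorm G)

/-- The canonical unitary in `C*(G)` given by a group element. -/
def u (g : G) : GroupCStar G := ofAlg (MonoidAlgebra.single g 1)

theorem u_mul (g h : G) : u (g * h) = u g * u h := by
  rw [u, u, u, ← map_mul, MonoidAlgebra.single_mul_single, one_mul]

theorem u_inv (g : G) : u g⁻¹ = star (u g) := by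
  rw [u, u, ← map_star, star_single, map_one]

/-- For group homomorphisms `θ : G → G₁` and `θ' : G → G₂`, the `*`-homomorphism from the group
algebra of `G` to the algebraic tensor product with `g ↦ θ(g) ⊗ θ'(g)`. -/
def algComul {G₁ G₂ : Type} [Group G₁] [Group G₂] (θ : G →* G₁) (θ' : G →* G₂) :
    MonoidAlgebra ℂ G →⋆ₙₐ[ℂ] GroupCStar G₁ ⊗[ℂ] GroupCStar G₂ :=
  groupAlgLift (fun g => u (θ g) ⊗ₜ u (θ' g))
    (fun g h => by
      rw [map_mul, map_mul, u_mul, u_mul, Algebra.TensorProduct.tmul_mul_tmul])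
    (fun g => by rw [map_inv, map_inv, u_inv, u_inv, TensorProduct.star_tmul])

theorem algComul_single {G₁ G₂ : Type} [Group G₁] [Group G₂] (θ : G →* G₁) (θ' : G →* G₂) (g : G) :
    algComul θ θ' (MonoidAlgebra.single g 1) = u (θ g) ⊗ₜ u (θ' g) :=
  (groupAlgLift_single _ _ _ g 1).trans (one_smul ℂ _)

/-- For group homomorphisms `θ : G → G₁` and `θ' : G → G₂`, the `*`-homomorphism
`C*(G) → C*(G₁) ⊗ C*(G₂)` with `g ↦ θ(g) ⊗ θ'(g)`. -/
def comul {G₁ G₂ : Type} [Group G₁] [Group G₂] (θ : G →* G₁) (θ' : G →* G₂) :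
    GroupCStar G →⋆ₙₐ[ℂ] GroupCStar G₁ ⊗ᵐ GroupCStar G₂ :=
  CStarSeminorm.Completion.lift (fullSeminorm G) (MinTensor.ofAlg.comp (algComul θ θ')) fun x => by
    refine (CStarSeminorm.Completion.norm_of (minSeminorm _ _) (algComul θ θ' x)).trans_le ?_
    refine Real.iSup_le (fun i => ?_) (CStarSeminorm.val_nonneg _ x)
    exact HilbertRep.le_seminorm_val (fun π : HilbertRep (MonoidAlgebra ℂ G) => π)
      bddAbove_groupAlg ((i.1.tensor i.2).comap (algComul θ θ')) x

@[simp]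
theorem comul_u {G₁ G₂ : Type} [Group G₁] [Group G₂] (θ : G →* G₁) (θ' : G →* G₂) (g : G) :
    comul θ θ' (u g) = MinTensor.tmul (u (θ g)) (u (θ' g)) := by
  refine (CStarSeminorm.Completion.lift_of (fullSeminorm G) _ _ _).trans ?_
  exact congrArg MinTensor.ofAlg (algComul_single θ θ' g)

end GroupCStar

end GroupAlgebra

/-! ### Direct sums of C*-algebras -/

section DirectSum

variable {ι : Type} (E : ι → Type) [∀ i, NonUnitalCStarAlgebra (E i)]

/-- The C*-algebraic direct sum of a family of C*-algebras: the bounded families `x` for which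
`‖x i‖` tends to `0` along the cofinite filter, with the supremum norm. -/
def c0Sum : NonUnitalStarSubalgebra ℂ (lp E ∞) where
  carrier := {x | Filter.Tendsto (fun i => ‖x i‖) Filter.cofinite (𝓝 0)}
  add_mem' {x y} hx hy := by
    refine squeeze_zero (fun _ => norm_nonneg _) (fun i => norm_add_le (x i) (y i)) ?_
    simpa using Filter.Tendsto.add hx hy
  zero_mem' := by
    refine Filter.Tendsto.congr (fun i => ?_) tendsto_const_nhds
    exact (norm_zero (E := E i)).symm
  mul_mem' {x y} hx hy := by
    refine squeeze_zero (fun _ => norm_nonneg _) (fun i => norm_mul_le (x i) (y i)) ?_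
    simpa using Filter.Tendsto.mul hx hy
  smul_mem' c x hx := by
    refine squeeze_zero (fun _ => norm_nonneg _) (fun i => (norm_smul c (x i)).le) ?_
    simpa using Filter.Tendsto.const_mul ‖c‖ hx
  star_mem' {x} hx := by
    have h : (fun i => ‖(star x : lp E ∞) i‖) = fun i => ‖x i‖ := funext fun i => norm_star (x i)
    change Filter.Tendsto (fun i => ‖(star x : lp E ∞) i‖) Filter.cofinite (𝓝 0)
    rw [h]; exact hx

theorem mem_c0Sum {x : lp E ∞} :
    x ∈ c0Sum E ↔ Filter.Tendsto (fun i => ‖x i‖) Filter.cofinite (𝓝 0) := Iff.rfl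

theorem isClosed_c0Sum : IsClosed (c0Sum E : Set (lp E ∞)) := by
  refine isClosed_of_closure_subset fun x hx => ?_
  rw [SetLike.mem_coe, mem_c0Sum, Metric.tendsto_nhds]
  intro ε hε
  obtain ⟨y, hy, hxy⟩ := Metric.mem_closure_iff.1 hx (ε / 2) (half_pos hε)
  rw [SetLike.mem_coe, mem_c0Sum, Metric.tendsto_nhds] at hy
  filter_upwards [hy (ε / 2) (half_pos hε)] with i hi
  rw [dist_zero_right, norm_norm] at hi ⊢
  have h1 : ‖(x - y) i‖ ≤ ‖x - y‖ := lp.norm_apply_le_norm ENNReal.top_ne_zero (x - y) i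
  rw [dist_eq_norm] at hxy
  have h2 : ‖x i‖ ≤ ‖(x - y) i‖ + ‖y i‖ := by
    have := norm_add_le ((x - y) i) (y i)
    simpa using this
  linarith

instance : NonUnitalCStarAlgebra (c0Sum E) :=
  NonUnitalStarSubalgebra.nonUnitalCStarAlgebra (c0Sum E) (h_closed := isClosed_c0Sum E)

variable {E} [DecidableEq ι]

/-- The inclusion of the `i`-th summand into the C*-algebraic direct sum. -/
def c0Incl (i : ι) : E i →⋆ₙₐ[ℂ] c0Sum E where
  toFun a := ⟨lp.single ∞ i a, by
    rw [mem_c0Sum]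
    refine Filter.Tendsto.congr' ?_ tendsto_const_nhds
    filter_upwards [(Set.finite_singleton i).compl_mem_cofinite] with j hj
    rw [lp.single_apply_ne _ _ _ hj, norm_zero]⟩
  map_smul' c a := Subtype.ext (lp.single_smul ∞ i c a)
  map_zero' := Subtype.ext (lp.single_zero ∞ i)
  map_add' a b := Subtype.ext (lp.single_add ∞ i a b)
  map_mul' a b := by
    refine Subtype.ext (lp.ext (funext fun j => ?_))
    change lp.single ∞ i (a * b) j = lp.single ∞ i a j * lp.single ∞ i b j
    rcases eq_or_ne j i with rfl | h
    · rw [lp.single_apply_self, lp.single_apply_self, lp.single_apply_self]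
    · rw [lp.single_apply_ne _ _ _ h, lp.single_apply_ne _ _ _ h, zero_mul]
  map_star' a := by
    refine Subtype.ext (lp.ext (funext fun j => ?_))
    change lp.single ∞ i (star a) j = star (lp.single ∞ i a j)
    rcases eq_or_ne j i with rfl | h
    · rw [lp.single_apply_self, lp.single_apply_self]
    · rw [lp.single_apply_ne _ _ _ h, lp.single_apply_ne _ _ _ h, star_zero]

end DirectSum

/-! ### C*-bialgebras and comodules -/

section Bialgebra

open MinTensor

variable {A B C : Type} [NonUnitalCStarAlgebra A] [NonUnitalCStarAlgebra B]
  [NonUnitalCStarAlgebra C]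

/-- `α` is the canonical isomorphism `(A ⊗ B) ⊗ C ≅ A ⊗ (B ⊗ C)`. It is determined by this
condition, since elementary tensors span a dense subspace. -/
def IsAssociator (α : (A ⊗ᵐ B) ⊗ᵐ C ≃⋆ₐ[ℂ] A ⊗ᵐ (B ⊗ᵐ C)) : Prop :=
  ∀ a b c, α (tmul (tmul a b) c) = tmul a (tmul b c)

/-- `τ` is the flip automorphism of `A ⊗ A`. -/
def IsFlip (τ : A ⊗ᵐ A ≃⋆ₐ[ℂ] A ⊗ᵐ A) : Prop := ∀ a b, τ (tmul a b) = tmul b a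

/-- `(A, Δ)` is a strictly proper C*-bialgebra: `Δ` is a `*`-homomorphism with values in `A ⊗ A`
(rather than in its multiplier algebra), the elements `Δ(a)(b ⊗ c)` span a dense subspace of
`A ⊗ A`, and `(Δ ⊗ id) ∘ Δ = (id ⊗ Δ) ∘ Δ`. -/
structure IsStrictlyProperBialgebra (Δ : A →⋆ₙₐ[ℂ] A ⊗ᵐ A) : Prop where
  dense_span : Dense
    (Submodule.span ℂ {t : A ⊗ᵐ A | ∃ a b c, t = Δ a * tmul b c} : Set (A ⊗ᵐ A))
  coassoc : ∃ α : (A ⊗ᵐ A) ⊗ᵐ A ≃⋆ₐ[ℂ] A ⊗ᵐ (A ⊗ᵐ A), IsAssociator α ∧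
    ∀ x, α (map Δ (NonUnitalStarAlgHom.id ℂ A) (Δ x)) = map (NonUnitalStarAlgHom.id ℂ A) Δ (Δ x)

/-- `ε` is a counit: `(ε ⊗ id) ∘ Δ = id = (id ⊗ ε) ∘ Δ`, where `ℂ ⊗ A` and `A ⊗ ℂ` are identified
with `A` by means of `a ↦ 1 ⊗ a` and `a ↦ a ⊗ 1`. -/
def IsCounit (Δ : A →⋆ₙₐ[ℂ] A ⊗ᵐ A) (ε : A →⋆ₙₐ[ℂ] ℂ) : Prop :=
  ∀ a, map ε (NonUnitalStarAlgHom.id ℂ A) (Δ a) = tmul (1 : ℂ) a ∧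
    map (NonUnitalStarAlgHom.id ℂ A) ε (Δ a) = tmul a (1 : ℂ)

/-- `Δ` is cocommutative: it is invariant under the flip. -/
def IsCocommutative (Δ : A →⋆ₙₐ[ℂ] A ⊗ᵐ A) : Prop :=
  ∀ τ : A ⊗ᵐ A ≃⋆ₐ[ℂ] A ⊗ᵐ A, IsFlip τ → ∀ x, τ (Δ x) = Δ x

/-- The canonical embedding of `A` into its unitization `A ⊕ ℂ`. -/
def unitEmb : A →⋆ₙₐ[ℂ] Unitization ℂ A := Unitization.inrNonUnitalStarAlgHom ℂ A

/-- The canonical embedding of `A ⊗ A` into the tensor square of the unitization. -/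
def unitEmb₂ : A ⊗ᵐ A →⋆ₙₐ[ℂ] Unitization ℂ A ⊗ᵐ Unitization ℂ A := map unitEmb unitEmb

/-- The cancellation law: the linear spans of `Δ(A)(I ⊗ A)` and of `Δ(A)(A ⊗ I)` are dense in
`A ⊗ A`. The products are formed in the tensor square of the unitization of `A`. -/
def CancellationLaw (Δ : A →⋆ₙₐ[ℂ] A ⊗ᵐ A) : Prop :=
  closure (Submodule.span ℂ {t | ∃ a b : A, t = unitEmb₂ (Δ a) * tmul 1 (unitEmb b)} :
    Set (Unitization ℂ A ⊗ᵐ Unitization ℂ A)) = Set.range (unitEmb₂ (A := A)) ∧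
  closure (Submodule.span ℂ {t | ∃ a b : A, t = unitEmb₂ (Δ a) * tmul (unitEmb b) 1} :
    Set (Unitization ℂ A ⊗ᵐ Unitization ℂ A)) = Set.range (unitEmb₂ (A := A))

/-- `(B, Γ)` is a right comodule-C*-algebra of the strictly proper C*-bialgebra `(A, Δ)`:
`Γ : B → M(B ⊗ A)` is a non-degenerate `*`-homomorphism, and `(Γ ⊗ id) ∘ Γ = (id ⊗ Δ) ∘ Γ`. Here
`L` and `R` are the (unique) extensions of `Γ ⊗ id` and `id ⊗ Δ` to unital `*`-homomorphisms on
`M(B ⊗ A)`, and multipliers are compared through their action `m.fst t = m t`. -/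
structure IsRightComodule (Δ : A →⋆ₙₐ[ℂ] A ⊗ᵐ A) (Γ : B →⋆ₙₐ[ℂ] 𝓜(ℂ, B ⊗ᵐ A)) : Prop where
  nondegenerate : Dense
    (Submodule.span ℂ {t : B ⊗ᵐ A | ∃ b s, t = (Γ b).fst s} : Set (B ⊗ᵐ A))
  coaction : ∃ (L : 𝓜(ℂ, B ⊗ᵐ A) →⋆ₐ[ℂ] 𝓜(ℂ, (B ⊗ᵐ A) ⊗ᵐ A))
    (R : 𝓜(ℂ, B ⊗ᵐ A) →⋆ₐ[ℂ] 𝓜(ℂ, B ⊗ᵐ (A ⊗ᵐ A)))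
    (α : (B ⊗ᵐ A) ⊗ᵐ A ≃⋆ₐ[ℂ] B ⊗ᵐ (A ⊗ᵐ A)),
    (∀ b a s a', (L (DoubleCentralizer.coe ℂ (tmul b a))).fst (tmul s a') =
      tmul ((Γ b).fst s) (a * a')) ∧
    (∀ t, R (DoubleCentralizer.coe ℂ t) =
      DoubleCentralizer.coe ℂ (map (NonUnitalStarAlgHom.id ℂ B) Δ t)) ∧
    IsAssociator α ∧
    ∀ b s, α ((L (Γ b)).fst s) = (R (Γ b)).fst (α s)

end Bialgebra

section Antipode

variable {E : Type} [CStarAlgebra E]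

/-- The unital subalgebra `S` of `E` is a subbialgebra for `Δ`, with comultiplication
`δ : S → S ⊙ S` into the algebraic tensor product: `δ` is the restriction of `Δ`. -/
def IsSubbialgebra (Δ : E →⋆ₙₐ[ℂ] E ⊗ᵐ E) (S : Subalgebra ℂ E) (δ : S →ₗ[ℂ] S ⊗[ℂ] S) : Prop :=
  ∀ s, MinTensor.ofAlg (TensorProduct.map S.val.toLinearMap S.val.toLinearMap (δ s)) = Δ s

/-- The linear map `T : S → S` is an antipode: `m ∘ (id ⊗ T) ∘ δ = η ∘ ε = m ∘ (T ⊗ id) ∘ δ`. -/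
def IsAntipode (ε : E →⋆ₙₐ[ℂ] ℂ) (S : Subalgebra ℂ E) (δ : S →ₗ[ℂ] S ⊗[ℂ] S)
    (T : S →ₗ[ℂ] S) : Prop :=
  ∀ s : S, LinearMap.mul' ℂ S (TensorProduct.map LinearMap.id T (δ s)) = algebraMap ℂ S (ε s) ∧
    LinearMap.mul' ℂ S (TensorProduct.map T LinearMap.id (δ s)) = algebraMap ℂ S (ε s)

end Antipode

/-! ### The direct sum of the free group C*-algebras -/

section FreeGroups

open scoped DirectSum

/-- `C*(F_n)` for `1 ≤ n < ∞`. -/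
abbrev FreeCStar (n : ℕ+) : Type := GroupCStar (FreeGroup (Fin n))

/-- `C*(F_∞)`, where `F_∞` is free on countably many generators. -/
abbrev FreeCStarInf : Type := GroupCStar (FreeGroup ℕ)

/-- The C*-algebraic direct sum of the `C*(F_n)` for `1 ≤ n < ∞`. -/
abbrev FreeSum : Type := c0Sum FreeCStar

/-- The inclusion of `C*(F_n)` as the `n`-th summand. -/
abbrev freeIncl (n : ℕ+) : FreeCStar n →⋆ₙₐ[ℂ] FreeSum := c0Incl (E := FreeCStar) n

/-- The quotient `k / l`, as an index below `m`, for `k` below `n = m * l`. -/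
def idxDiv {m l n : ℕ+} (h : m * l = n) (k : Fin n) : Fin m :=
  ⟨k / l, Nat.div_lt_of_lt_mul (by
    have h' : (m : ℕ) * l = n := by rw [← h]; rfl
    rw [mul_comm, h']; exact k.2)⟩

/-- The remainder `k % l`, as an index below `l`. -/
def idxMod (l : ℕ+) (k : ℕ) : Fin l := ⟨k % l, Nat.mod_lt k l.pos⟩

/-- The `*`-homomorphism `φ_{m,l} : C*(F_n) → C*(F_m) ⊗ C*(F_l)` for `n = m * l`. With generators
indexed from `0` it is given by `g_{l i + j} ↦ g_i ⊗ g_j` for `i < m` and `j < l`. -/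
def phi {m l n : ℕ+} (h : m * l = n) : FreeCStar n →⋆ₙₐ[ℂ] FreeCStar m ⊗ᵐ FreeCStar l :=
  GroupCStar.comul (FreeGroup.map (idxDiv h)) (FreeGroup.map fun k : Fin n => idxMod l k)

/-- The `*`-homomorphism `φ_{∞,n} : C*(F_∞) → C*(F_∞) ⊗ C*(F_n)`. With generators indexed from `0`
it is given by `g_{n i + j} ↦ g_i ⊗ g_j` for `j < n`. -/
def phiInf (n : ℕ+) : FreeCStarInf →⋆ₙₐ[ℂ] FreeCStarInf ⊗ᵐ FreeCStar n :=
  GroupCStar.comul (FreeGroup.map fun k : ℕ => k / (n : ℕ)) (FreeGroup.map (idxMod n))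

/-- There are finitely many factorizations `n = m * l`. -/
instance fintypeFactorizations (n : ℕ+) : Fintype {p : ℕ+ × ℕ+ // p.1 * p.2 = n} :=
  Set.Finite.fintype (s := {p : ℕ+ × ℕ+ | p.1 * p.2 = n})
    (((Set.finite_Iic n).prod (Set.finite_Iic n)).subset fun p (hp : p.1 * p.2 = n) =>
      ⟨PNat.le_of_dvd (Dvd.intro _ hp), PNat.le_of_dvd (Dvd.intro_left _ hp)⟩)

/-- The algebraic direct sum of the group algebras of the groups `F_n` for `1 ≤ n < ∞`. -/
abbrev FreeAlgSum : Type := ⨁ n : ℕ+, MonoidAlgebra ℂ (FreeGroup (Fin n))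

/-- The canonical map of the algebraic direct sum of the group algebras into the C*-algebraic direct
sum of the group C*-algebras. -/
def freeAlgIncl : FreeAlgSum →ₗ[ℂ] FreeSum :=
  DirectSum.toModule ℂ ℕ+ FreeSum fun n =>
    { toFun := fun x => freeIncl n (GroupCStar.ofAlg x)
      map_add' := fun x y => by rw [map_add, map_add]
      map_smul' := fun c x => by rw [map_smul, map_smul]; rfl }

end FreeGroups

end

/-! On the canonical unitaries, whose span is dense, the comultiplication is arithmetic of digits:
`phi` splits a generator index `i` into the quotient `i / l` and the remainder `i % l`. For `n = j *
k * l` either way of iterating the comultiplication produces the three mixed-radix digits `i / (k *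
l)`, `(i / l) % k` and `i % l`, and both iterations sum over the same triples of factors; this is
coassociativity. The comodule identity is the same computation with `i` unbounded.
Non-cocommutativity says that reading the digits in the opposite order gives something else: the
index `1` below `4` has digits `(0, 1)`.

The blocks of `FreeSum ⊗ᵐ FreeSum` belonging to different pairs `(m, l)` annihilate each other, and
the block `(m, l)` is reached only from the summand `n = m * l`. So multiplying a value of the
comultiplication by an element of one block, or by an element of one summand in one leg, leaves at
most one term. This gives properness. It also gives cancellation: the maps of free groups induced by
quotient and remainder are onto, so one leg can be prescribed and the other corrected by a group
element. The counit is supported on the summand `n = 1`, the unit of the monoid of indices.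

Antipodes are excluded by the character `ω` of the unitization that vanishes on `FreeSum`. It
satisfies `(ω ⊗ id) Δ = ω(·) 1`, since the comultiplication maps `FreeSum` into `FreeSum ⊗ᵐ
FreeSum`. Applying `ω` to the antipode equation then shows that the counit is a multiple of `ω` on
the dense subalgebra; evaluating at `1`, it equals `ω`, which is false on `FreeSum`.

Two analytic ingredients support this. The triple minimal tensor product is associative because the
spatial norm can be computed from any jointly faithful family of representations of one factor
(`HilbertRep.norm_tensorLin_le_of_faithful`), in particular from the product representations of an
inner tensor product. The coaction and the extensions of `Γ ⊗ id` and `id ⊗ Δ` to multipliers are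
strictly convergent sums of orthogonal `*`-homomorphisms (`LocalizedBy.strictSum`); the extensions
first cut a multiplier down to the blocks by central projections (`IsCentralProjection.corner`). -/

noncomputable section

open scoped CStarAlgebra

/-! ### Matrix amplifications of representations -/

section MatrixAmplification

variable {D K : Type} [NonUnitalCStarAlgebra D]
  [NormedAddCommGroup K] [InnerProductSpace ℂ K] [CompleteSpace K] {n : ℕ}

/-- The operator on `Kⁿ` given by a matrix of operators on `K`. -/
def matOp (X : Fin n → Fin n → (K →L[ℂ] K)) :
    PiLp 2 (fun _ : Fin n => K) →L[ℂ] PiLp 2 (fun _ : Fin n => K) :=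
  (PiLp.continuousLinearEquiv 2 ℂ (fun _ : Fin n => K)).symm.toContinuousLinearMap ∘L
    (ContinuousLinearMap.pi fun j => ∑ k, X j k ∘L ContinuousLinearMap.proj k) ∘L
      (PiLp.continuousLinearEquiv 2 ℂ (fun _ : Fin n => K)).toContinuousLinearMap

theorem matOp_apply (X : Fin n → Fin n → (K →L[ℂ] K)) (v : PiLp 2 (fun _ : Fin n => K))
    (j : Fin n) : matOp X v j = ∑ k, X j k (v k) := by
  simp [matOp]

/-- The amplification of a representation of `D` on `K` to a representation of the matrix algebra
over `D` on `Kⁿ`. -/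
def matRep (ρ : D →⋆ₙₐ[ℂ] (K →L[ℂ] K)) (n : ℕ) : CStarMatrix (Fin n) (Fin n) D →⋆ₙₐ[ℂ]
    (PiLp 2 (fun _ : Fin n => K) →L[ℂ] PiLp 2 (fun _ : Fin n => K)) where
  toFun X := matOp fun j k => ρ (X j k)
  map_smul' c X := by
    ext v j
    simp [matOp_apply, Finset.smul_sum]
  map_zero' := by
    ext v j
    simp [matOp_apply]
  map_add' X Y := by
    ext v j
    simp [matOp_apply, Finset.sum_add_distrib]
  map_mul' X Y := by
    ext v j
    simp only [matOp_apply, CStarMatrix.mul_apply, map_sum, map_mul, sum_apply,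
      mul_apply_eq_comp]
    rw [Finset.sum_comm]
  map_star' X := by
    rw [ContinuousLinearMap.star_eq_adjoint, ContinuousLinearMap.eq_adjoint_iff]
    intro v w
    simp only [PiLp.inner_apply, matOp_apply, sum_inner, inner_sum, CStarMatrix.star_apply,
      map_star, ContinuousLinearMap.star_eq_adjoint, ContinuousLinearMap.adjoint_inner_left]
    rw [Finset.sum_comm]

theorem matRep_apply (ρ : D →⋆ₙₐ[ℂ] (K →L[ℂ] K)) (X : CStarMatrix (Fin n) (Fin n) D)
    (v : PiLp 2 (fun _ : Fin n => K)) (j : Fin n) :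
    matRep ρ n X v j = ∑ k, ρ (X j k) (v k) := matOp_apply _ v j

/-- This makes the amplifications of a jointly faithful family jointly faithful on matrices. -/
theorem matRep_eq_zero (ρ : D →⋆ₙₐ[ℂ] (K →L[ℂ] K)) (X : CStarMatrix (Fin n) (Fin n) D)
    (h : matRep ρ n X = 0) (j k : Fin n) : ρ (X j k) = 0 := by
  ext y
  -- The vector with `y` in place `k` and zeros elsewhere isolates the entry `(j, k)`.
  have := congrArg (fun T => T (PiLp.single 2 k y) j) h
  simpa [matRep_apply, Pi.single_apply, apply_ite] using this

end MatrixAmplification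

/-! ### Jointly faithful families of `*`-homomorphisms are jointly isometric -/

section Product

variable {ι : Type*} {Y : Type*} [NonUnitalCStarAlgebra Y] {E : ι → Type*}
  [∀ i, NonUnitalCStarAlgebra (E i)]

/-- The product of a family of `*`-homomorphisms, as a `*`-homomorphism into the algebra of bounded
families. -/
def lpPi (f : ∀ i, Y →⋆ₙₐ[ℂ] E i) : Y →⋆ₙₐ[ℂ] lp E ∞ where
  toFun y := ⟨fun i => f i y, memℓp_infty ⟨‖y‖, by
    rintro _ ⟨i, rfl⟩
    exact NonUnitalStarAlgHom.norm_apply_le (f i) y⟩⟩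
  map_smul' c y := Subtype.ext (funext fun i => map_smul (f i) c y)
  map_zero' := Subtype.ext (funext fun i => map_zero (f i))
  map_add' y z := Subtype.ext (funext fun i => map_add (f i) y z)
  map_mul' y z := Subtype.ext (funext fun i => map_mul (f i) y z)
  map_star' y := Subtype.ext (funext fun i => map_star (f i) y)

/-- The product homomorphism into the bounded families is injective, and an injective
`*`-homomorphism of C*-algebras is isometric. -/
theorem norm_le_of_forall_hom_norm_le (f : ∀ i, Y →⋆ₙₐ[ℂ] E i)
    (hf : ∀ y, (∀ i, f i y = 0) → y = 0) {M : ℝ} (hM : 0 ≤ M) (y : Y)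
    (h : ∀ i, ‖f i y‖ ≤ M) : ‖y‖ ≤ M := by
  have hinj : Function.Injective (lpPi f) := by
    refine (injective_iff_map_eq_zero (lpPi f)).2 fun y hy => hf y fun i => ?_
    exact congrArg (fun z : lp E ∞ => z i) hy
  rw [← NonUnitalStarAlgHom.norm_map (lpPi f) hinj y]
  exact lp.norm_le_of_forall_le hM h

end Product

/-- The bound is homogeneous in both vectors, so it passes to the closure of the range by
continuity. The map `k` need not be linear: it is used for the algebraic tensors inside a Hilbert
space tensor product and for the identity. -/
theorem ContinuousLinearMap.norm_le_of_denseRange_inner {V H : Type*} [NormedAddCommGroup H]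
    [InnerProductSpace ℂ H] {k : V → H} (hk : DenseRange k) (T : H →L[ℂ] H)
    {M : ℝ} (hM : 0 ≤ M) (h : ∀ u v, ‖⟪k u, T (k v)⟫_ℂ‖ ≤ M * ‖k u‖ * ‖k v‖) : ‖T‖ ≤ M := by
  have key : ∀ x y, ‖⟪x, T y⟫_ℂ‖ ≤ M * ‖x‖ * ‖y‖ := fun x y => by
    refine hk.induction_on₂ (p := fun x y => ‖⟪x, T y⟫_ℂ‖ ≤ M * ‖x‖ * ‖y‖) ?_ h x y
    exact isClosed_le (by fun_prop) (by fun_prop)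
  refine T.opNorm_le_of_re_inner_le hM fun x y hx hy => ?_
  have h1 := key y x
  rw [hx, hy, mul_one, mul_one, norm_inner_symm] at h1
  exact (RCLike.re_le_norm _).trans h1

/-! ### Independence of the spatial norm of the choice of a faithful family -/

section OrthonormalSum

variable {H K : Type} [NormedAddCommGroup H] [InnerProductSpace ℂ H]
  [NormedAddCommGroup K] [InnerProductSpace ℂ K] {n : ℕ}

/-- The vector `∑ j, e j ⊗ u j`. -/
def sumTmul (e : Fin n → H) (u : PiLp 2 (fun _ : Fin n => K)) : H ⊗[ℂ] K := ∑ j, e j ⊗ₜ u j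

theorem norm_sumTmul {e : Fin n → H} (he : Orthonormal ℂ e) (u : PiLp 2 (fun _ : Fin n => K)) :
    ‖sumTmul e u‖ = ‖u‖ := by
  have h : ⟪sumTmul e u, sumTmul e u⟫_ℂ = ⟪u, u⟫_ℂ := by
    rw [PiLp.inner_apply]
    simp [sumTmul, sum_inner, inner_sum, TensorProduct.inner_tmul, orthonormal_iff_ite.1 he]
  have h := (inner_self_eq_norm_sq_to_K (𝕜 := ℂ) (sumTmul e u)).symm.trans
    (h.trans (inner_self_eq_norm_sq_to_K (𝕜 := ℂ) u))
  have h' : ‖sumTmul e u‖ ^ 2 = ‖u‖ ^ 2 := by exact_mod_cast h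
  exact (sq_eq_sq₀ (norm_nonneg _) (norm_nonneg _)).1 h'

/-- Both tensors lie in `H' ⊗ K` for one finite-dimensional `H'`, and an orthonormal basis of `H'`
serves for the two of them. A common family is needed to express a matrix coefficient of an operator
through a single matrix of slices. -/
theorem exists_sumTmul (x y : H ⊗[ℂ] K) : ∃ (n : ℕ) (e : Fin n → H)
    (u v : PiLp 2 (fun _ : Fin n => K)), Orthonormal ℂ e ∧ x = sumTmul e u ∧ y = sumTmul e v := by
  obtain ⟨H', hfin, hs⟩ := TensorProduct.exists_finite_submodule_left_of_setFinite
    ({x, y} : Set (H ⊗[ℂ] K)) (Set.toFinite _)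
  let b := stdOrthonormalBasis ℂ H'
  have key : ∀ z ∈ ({x, y} : Set (H ⊗[ℂ] K)), ∃ u : PiLp 2 (fun _ : Fin (Module.finrank ℂ H') => K),
      z = sumTmul (fun j => (b j : H)) u := fun z hz => by
    obtain ⟨w, rfl⟩ := hs hz
    clear hz
    induction w with
    | zero => exact ⟨0, by simp [sumTmul]⟩
    | add w₁ w₂ h₁ h₂ =>
      obtain ⟨u₁, h₁⟩ := h₁
      obtain ⟨u₂, h₂⟩ := h₂
      refine ⟨u₁ + u₂, ?_⟩
      rw [map_add, h₁, h₂]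
      simp [sumTmul, TensorProduct.tmul_add, Finset.sum_add_distrib]
    | tmul h k =>
      refine ⟨WithLp.toLp 2 fun j => b.repr h j • k, ?_⟩
      simp only [sumTmul, LinearMap.rTensor_tmul, Submodule.subtype_apply]
      conv_lhs => rw [← b.sum_repr h]
      simp [TensorProduct.sum_tmul, TensorProduct.smul_tmul]
  obtain ⟨u, hu⟩ := key x (by simp)
  obtain ⟨v, hv⟩ := key y (by simp)
  exact ⟨_, _, u, v, b.orthonormal.comp_linearIsometry H'.subtypeₗᵢ, hu, hv⟩

end OrthonormalSum

namespace HilbertRep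

variable {A D : Type} [NonUnitalCStarAlgebra A] [NonUnitalCStarAlgebra D]

theorem denseRange_incl (H K : Type) [NormedAddCommGroup H] [InnerProductSpace ℂ H]
    [NormedAddCommGroup K] [InnerProductSpace ℂ K] : DenseRange (incl H K) :=
  UniformSpace.Completion.denseRange_coe (α := H ⊗[ℂ] K)

/-- The slice of an element of `A ⊗ D` by a vector functional of a representation of `A`. -/
def slice (π : HilbertRep A) (e f : π.H) : A ⊗[ℂ] D →ₗ[ℂ] D :=
  TensorProduct.lift (LinearMap.mk₂ ℂ (fun a d => ⟪e, π.hom a f⟫_ℂ • d)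
    (fun a b d => by simp [add_smul])
    (fun c a d => by simp [mul_smul])
    (fun a d d' => by simp)
    (fun c a d => by rw [smul_comm]))

theorem slice_tmul (π : HilbertRep A) (e f : π.H) (a : A) (d : D) :
    slice π e f (a ⊗ₜ d) = ⟪e, π.hom a f⟫_ℂ • d := rfl

theorem inner_tensorLin (π : HilbertRep A) (ρ : HilbertRep D) (x : A ⊗[ℂ] D) (e f : π.H)
    (y z : ρ.H) : ⟪incl π.H ρ.H (e ⊗ₜ y), tensorLin π ρ x (incl π.H ρ.H (f ⊗ₜ z))⟫_ℂ =
      ⟪y, ρ.hom (slice π e f x) z⟫_ℂ := by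
  induction x with
  | zero => simp
  | add x x' h h' =>
    rw [map_add, map_add, map_add, add_apply, add_apply, inner_add_right, inner_add_right, h, h']
  | tmul a d =>
    rw [tensorLin_tmul, opTensor_tmul, inner_incl, slice_tmul, TensorProduct.inner_tmul, map_smul]
    simp

/-- The matrix of slices of an element of `A ⊗ D` by a finite family of vectors. -/
def sliceMatrix {n : ℕ} (π : HilbertRep A) (e : Fin n → π.H) (x : A ⊗[ℂ] D) :
    CStarMatrix (Fin n) (Fin n) D := fun j k => slice π (e j) (e k) x

theorem inner_tensorLin_sumTmul {n : ℕ} (π : HilbertRep A) (ρ : HilbertRep D) (x : A ⊗[ℂ] D)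
    (e : Fin n → π.H) (u v : PiLp 2 (fun _ : Fin n => ρ.H)) :
    ⟪incl π.H ρ.H (sumTmul e u), tensorLin π ρ x (incl π.H ρ.H (sumTmul e v))⟫_ℂ =
      ⟪u, matRep ρ.hom n (sliceMatrix π e x) v⟫_ℂ := by
  simp only [sumTmul, map_sum, sum_inner, inner_sum, inner_tensorLin, PiLp.inner_apply, matRep_apply]
  rw [Finset.sum_comm]
  rfl

/-- For a finite orthonormal family `e`, the matrix coefficients of `(π ⊗ ρ)(x)` on the span of the
`e j ⊗ y` are those of the amplification of `ρ` at the matrix of slices of `x`. That matrix lies in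
a C*-algebra not involving `ρ`. Its norm is controlled by the amplified `σ i`, which are jointly
faithful, and each of these gives a compression of `(π ⊗ σ i)(x)`. Hence a jointly faithful family
already computes the spatial norm. -/
theorem norm_tensorLin_le_of_faithful {ι : Type*} (π : HilbertRep A) (ρ : HilbertRep D)
    (σ : ι → HilbertRep D) (hσ : ∀ d, (∀ i, (σ i).hom d = 0) → d = 0) (x : A ⊗[ℂ] D) {M : ℝ}
    (hM : 0 ≤ M) (h : ∀ i, ‖tensorLin π (σ i) x‖ ≤ M) : ‖tensorLin π ρ x‖ ≤ M := by
  -- The C*-norm on matrices over `D` refers to an order on `D`; the spectral order supplies it.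
  let _ := CStarAlgebra.spectralOrder D
  have _ := CStarAlgebra.spectralOrderedRing D
  refine ContinuousLinearMap.norm_le_of_denseRange_inner (denseRange_incl π.H ρ.H) _ hM
    fun s t => ?_
  obtain ⟨n, e, u, v, he, rfl, rfl⟩ := exists_sumTmul s t
  have hX : ‖sliceMatrix π e x‖ ≤ M := by
    refine norm_le_of_forall_hom_norm_le (fun i => matRep (σ i).hom n) (fun X hX => ?_) hM _
      fun i => ?_
    · ext j k
      exact hσ _ fun i => matRep_eq_zero _ X (hX i) j k
    -- The amplified `σ i` at the matrix of slices is the compression of `(π ⊗ σ i)(x)` along the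
    -- isometry `u ↦ ∑ j, e j ⊗ u j`, so it inherits the bound `M`.
    · refine ContinuousLinearMap.norm_le_of_denseRange_inner denseRange_id _ hM fun u v => ?_
      rw [id, id, ← inner_tensorLin_sumTmul]
      refine (norm_inner_le_norm _ _).trans ?_
      rw [LinearIsometry.norm_map, norm_sumTmul he]
      refine (mul_le_mul_of_nonneg_left (ContinuousLinearMap.le_opNorm _ _)
        (norm_nonneg _)).trans ?_
      rw [LinearIsometry.norm_map, norm_sumTmul he, mul_comm M, mul_assoc]
      exact mul_le_mul_of_nonneg_left (mul_le_mul_of_nonneg_right (h i) (norm_nonneg _))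
        (norm_nonneg _)
  rw [inner_tensorLin_sumTmul, LinearIsometry.norm_map, LinearIsometry.norm_map, norm_sumTmul he,
    norm_sumTmul he, mul_comm M, mul_assoc]
  refine (norm_inner_le_norm _ _).trans (mul_le_mul_of_nonneg_left ?_ (norm_nonneg _))
  exact (ContinuousLinearMap.le_opNorm _ _).trans (mul_le_mul_of_nonneg_right
    ((NonUnitalStarAlgHom.norm_apply_le (matRep ρ.hom n) _).trans hX) (norm_nonneg _))

end HilbertRep

/-! ### Elementary properties of the minimal tensor product -/

namespace MinTensor

variable {A B C A' B' A'' B'' : Type} [NonUnitalCStarAlgebra A] [NonUnitalCStarAlgebra B]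
  [NonUnitalCStarAlgebra C] [NonUnitalCStarAlgebra A'] [NonUnitalCStarAlgebra B']
  [NonUnitalCStarAlgebra A''] [NonUnitalCStarAlgebra B'']

theorem tmul_add (a : A) (b b' : B) : tmul a (b + b') = tmul a b + tmul a b' := by
  rw [tmul, TensorProduct.tmul_add, map_add]; rfl

theorem add_tmul (a a' : A) (b : B) : tmul (a + a') b = tmul a b + tmul a' b := by
  rw [tmul, TensorProduct.add_tmul, map_add]; rfl

theorem tmul_smul (c : ℂ) (a : A) (b : B) : tmul a (c • b) = c • tmul a b := by
  rw [tmul, TensorProduct.tmul_smul, map_smul]; rfl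

theorem smul_tmul (c : ℂ) (a : A) (b : B) : tmul (c • a) b = c • tmul a b := by
  rw [tmul, ← TensorProduct.smul_tmul', map_smul]; rfl

variable (A B) in
/-- The elementary tensor as a bilinear map. -/
def tmulBilin : A →ₗ[ℂ] B →ₗ[ℂ] A ⊗ᵐ B :=
  LinearMap.mk₂ ℂ tmul add_tmul smul_tmul tmul_add tmul_smul

@[simp]
theorem tmulBilin_apply (a : A) (b : B) : tmulBilin A B a b = tmul a b := rfl

@[simp]
theorem zero_tmul (b : B) : tmul (0 : A) b = 0 := by simp [← tmulBilin_apply]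

@[simp]
theorem tmul_zero (a : A) : tmul a (0 : B) = 0 := by simp [← tmulBilin_apply]

theorem sum_tmul {ι : Type*} (s : Finset ι) (f : ι → A) (b : B) :
    tmul (∑ i ∈ s, f i) b = ∑ i ∈ s, tmul (f i) b := by simp [← tmulBilin_apply]

theorem tmul_sum {ι : Type*} (s : Finset ι) (a : A) (f : ι → B) :
    tmul a (∑ i ∈ s, f i) = ∑ i ∈ s, tmul a (f i) := by simp [← tmulBilin_apply]

@[simp]
theorem tmul_mul_tmul (a a' : A) (b b' : B) :
    tmul a b * tmul a' b' = tmul (a * a') (b * b') := by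
  rw [tmul, tmul, ← map_mul, Algebra.TensorProduct.tmul_mul_tmul]; rfl

@[simp]
theorem star_tmul (a : A) (b : B) : star (tmul a b) = tmul (star a) (star b) := by
  rw [tmul, ← map_star, TensorProduct.star_tmul]; rfl

theorem norm_ofAlg (x : A ⊗[ℂ] B) :
    ‖(ofAlg x : A ⊗ᵐ B)‖ = ⨆ i : HilbertRep A × HilbertRep B, ‖HilbertRep.tensorLin i.1 i.2 x‖ :=
  CStarSeminorm.Completion.norm_of (minSeminorm A B) x

theorem norm_ofAlg_le {x : A ⊗[ℂ] B} {M : ℝ} (hM : 0 ≤ M)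
    (h : ∀ (π : HilbertRep A) (σ : HilbertRep B), ‖HilbertRep.tensorLin π σ x‖ ≤ M) :
    ‖(ofAlg x : A ⊗ᵐ B)‖ ≤ M := by
  rw [norm_ofAlg]
  exact Real.iSup_le (fun i => h i.1 i.2) hM

theorem norm_tensorLin_le (π : HilbertRep A) (σ : HilbertRep B) (x : A ⊗[ℂ] B) :
    ‖HilbertRep.tensorLin π σ x‖ ≤ ‖(ofAlg x : A ⊗ᵐ B)‖ := by
  rw [norm_ofAlg]
  exact le_ciSup (f := fun i : HilbertRep A × HilbertRep B => ‖HilbertRep.tensorLin i.1 i.2 x‖)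
    (HilbertRep.bddAbove_tensor x) (π, σ)

theorem norm_tmul_le (a : A) (b : B) : ‖tmul a b‖ ≤ ‖a‖ * ‖b‖ :=
  norm_ofAlg_le (by positivity) fun π σ =>
    (HilbertRep.norm_opTensor_le _ _).trans (mul_le_mul (NonUnitalStarAlgHom.norm_apply_le π.hom a)
      (NonUnitalStarAlgHom.norm_apply_le σ.hom b) (norm_nonneg _) (norm_nonneg _))

variable (A B) in
/-- The elementary tensor as a continuous bilinear map. -/
def tmulL : A →L[ℂ] B →L[ℂ] A ⊗ᵐ B :=
  (tmulBilin A B).mkContinuous₂ 1 fun a b => by simpa using norm_tmul_le a b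

@[fun_prop]
theorem continuous_tmul {X : Type*} [TopologicalSpace X] {f : X → A} {g : X → B}
    (hf : Continuous f) (hg : Continuous g) : Continuous fun x => tmul (f x) (g x) := by
  have h : Continuous fun x => tmulL A B (f x) (g x) :=
    ((tmulL A B).continuous.comp hf).clm_apply hg
  exact h

theorem denseRange_ofAlg : DenseRange (ofAlg : A ⊗[ℂ] B → A ⊗ᵐ B) :=
  CStarSeminorm.Completion.denseRange_of (minSeminorm A B)

theorem induction {P : A ⊗ᵐ B → Prop} (hc : IsClosed {t | P t})
    (hadd : ∀ s t, P s → P t → P (s + t)) (h : ∀ a b, P (tmul a b)) (t : A ⊗ᵐ B) : P t := by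
  refine denseRange_ofAlg.induction_on t hc fun x => ?_
  induction x with
  | zero => simpa using h 0 0
  | add x y hx hy => rw [map_add]; exact hadd _ _ hx hy
  | tmul a b => exact h a b

theorem induction₂ {P : A ⊗ᵐ B → A' ⊗ᵐ B' → Prop} (hc : ∀ s, IsClosed {t | P s t})
    (hc' : ∀ t, IsClosed {s | P s t})
    (hadd : ∀ s s' t, P s t → P s' t → P (s + s') t)
    (hadd' : ∀ s t t', P s t → P s t' → P s (t + t'))
    (h : ∀ a b a' b', P (tmul a b) (tmul a' b')) (s : A ⊗ᵐ B) (t : A' ⊗ᵐ B') : P s t :=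
  induction (P := fun s => P s t) (hc' t) (fun s s' => hadd s s' t)
    (fun a b => induction (P := fun t => P (tmul a b) t) (hc _) (hadd' _) (h a b) t) s

theorem hom_ext {E : Type*} [NonUnitalCStarAlgebra E] {f g : A ⊗ᵐ B →⋆ₙₐ[ℂ] E}
    (h : ∀ a b, f (tmul a b) = g (tmul a b)) : f = g := by
  ext t
  exact induction (P := fun t => f t = g t) (isClosed_eq (map_continuous f) (map_continuous g))
    (fun s t hs ht => by rw [map_add, map_add, hs, ht]) h t

theorem map_map (f : A →⋆ₙₐ[ℂ] A') (g : B →⋆ₙₐ[ℂ] B') (f' : A' →⋆ₙₐ[ℂ] A'')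
    (g' : B' →⋆ₙₐ[ℂ] B'') (t : A ⊗ᵐ B) :
    map f' g' (map f g t) = map (f'.comp f) (g'.comp g) t := by
  have h : (map f' g').comp (map f g) = map (f'.comp f) (g'.comp g) :=
    hom_ext fun a b => by simp
  exact DFunLike.congr_fun h t

theorem dense_span_of_tmul_mem {S : Submodule ℂ (A ⊗ᵐ B)}
    (h : ∀ a b, tmul a b ∈ S.topologicalClosure) : Dense (S : Set (A ⊗ᵐ B)) := by
  intro t
  refine induction (P := fun t => t ∈ S.topologicalClosure) S.isClosed_topologicalClosure
    (fun s t hs ht => add_mem hs ht) h t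

end MinTensor

/-! ### The representations of the minimal tensor product given by pairs of representations -/

namespace HilbertRep

variable {A B C : Type} [NonUnitalCStarAlgebra A] [NonUnitalCStarAlgebra B]
  [NonUnitalCStarAlgebra C]

/-- The tensor product of two representations as a representation of the minimal tensor product. -/
def minTensor (π : HilbertRep A) (σ : HilbertRep B) : HilbertRep (A ⊗ᵐ B) where
  H := HilbertTensor π.H σ.H
  hom := CStarSeminorm.Completion.lift (minSeminorm A B) (π.tensor σ).hom
    fun x => (MinTensor.norm_tensorLin_le π σ x).trans_eq
      (CStarSeminorm.Completion.norm_of (minSeminorm A B) x)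

theorem minTensor_ofAlg (π : HilbertRep A) (σ : HilbertRep B) (x : A ⊗[ℂ] B) :
    (π.minTensor σ).hom (MinTensor.ofAlg x) = tensorLin π σ x :=
  CStarSeminorm.Completion.lift_of (minSeminorm A B) _ _ x

theorem minTensor_tmul (π : HilbertRep A) (σ : HilbertRep B) (a : A) (b : B) :
    (π.minTensor σ).hom (MinTensor.tmul a b) = opTensor (π.hom a) (σ.hom b) :=
  minTensor_ofAlg π σ (a ⊗ₜ b)

/-- On algebraic tensors this is the definition of the norm; the general case follows by
approximation, because representations are contractive. -/
theorem norm_le_of_minTensor {t : A ⊗ᵐ B} {M : ℝ} (hM : 0 ≤ M)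
    (h : ∀ (π : HilbertRep A) (σ : HilbertRep B), ‖(π.minTensor σ).hom t‖ ≤ M) : ‖t‖ ≤ M := by
  refine le_of_forall_pos_le_add fun ε hε => ?_
  obtain ⟨x, hx⟩ := MinTensor.denseRange_ofAlg.exists_dist_lt t (half_pos hε)
  rw [dist_eq_norm] at hx
  have h1 : ‖(MinTensor.ofAlg x : A ⊗ᵐ B)‖ ≤ M + ε / 2 := by
    refine MinTensor.norm_ofAlg_le (by positivity) fun π σ => ?_
    have h2 : (π.minTensor σ).hom (MinTensor.ofAlg x) =
        (π.minTensor σ).hom t - (π.minTensor σ).hom (t - MinTensor.ofAlg x) := by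
      rw [map_sub, sub_sub_cancel]
    rw [← minTensor_ofAlg, h2]
    exact (norm_sub_le _ _).trans (add_le_add (h π σ)
      ((NonUnitalStarAlgHom.norm_apply_le (π.minTensor σ).hom _).trans hx.le))
  calc ‖t‖ ≤ ‖t - MinTensor.ofAlg x‖ + ‖(MinTensor.ofAlg x : A ⊗ᵐ B)‖ := by
        simpa using norm_add_le (t - MinTensor.ofAlg x) (MinTensor.ofAlg x)
    _ ≤ M + ε := by linarith

/-- The product representations thus form a jointly faithful family of the minimal tensor product,
which is the input required by `norm_tensorLin_le_of_faithful`. -/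
theorem eq_zero_of_minTensor {t : A ⊗ᵐ B}
    (h : ∀ i : HilbertRep A × HilbertRep B, (i.1.minTensor i.2).hom t = 0) : t = 0 := by
  have := norm_le_of_minTensor (t := t) le_rfl fun π σ => by rw [h (π, σ), norm_zero]
  simpa using this

/-- The two operators act through the same vectors of `V`, which `k` and `k'` embed with equal
norms. This compares operators on two completions without constructing a unitary between them. Only
the range of `k` has to be dense. -/
theorem norm_le_of_intertwine {V H H' : Type*} [AddCommGroup V] [Module ℂ V]
    [NormedAddCommGroup H] [NormedSpace ℂ H] [NormedAddCommGroup H'] [NormedSpace ℂ H']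
    {k : V →ₗ[ℂ] H} {k' : V →ₗ[ℂ] H'} (hk : DenseRange k) (hkk' : ∀ v, ‖k v‖ = ‖k' v‖)
    (T : H →L[ℂ] H) (T' : H' →L[ℂ] H')
    (h : ∀ v, ∃ w, T (k v) = k w ∧ T' (k' v) = k' w) : ‖T‖ ≤ ‖T'‖ := by
  refine T.opNorm_le_bound (norm_nonneg _) fun z => ?_
  refine hk.induction_on (p := fun z => ‖T z‖ ≤ ‖T'‖ * ‖z‖) z ?_ fun v => ?_
  · exact isClosed_le (by fun_prop) (by fun_prop)
  · obtain ⟨w, hw, hw'⟩ := h v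
    rw [hw, hkk', ← hw', hkk']
    exact T'.le_opNorm _

theorem intertwine_add {V H H' : Type*} [AddCommGroup V] [Module ℂ V]
    [NormedAddCommGroup H] [NormedSpace ℂ H] [NormedAddCommGroup H'] [NormedSpace ℂ H']
    {k : V →ₗ[ℂ] H} {k' : V →ₗ[ℂ] H'} {T S : H →L[ℂ] H} {T' S' : H' →L[ℂ] H'}
    (h₁ : ∀ v, ∃ w, T (k v) = k w ∧ T' (k' v) = k' w)
    (h₂ : ∀ v, ∃ w, S (k v) = k w ∧ S' (k' v) = k' w) (v : V) :
    ∃ w, (T + S) (k v) = k w ∧ (T' + S') (k' v) = k' w := by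
  obtain ⟨w₁, h, h'⟩ := h₁ v
  obtain ⟨w₂, g, g'⟩ := h₂ v
  exact ⟨w₁ + w₂, by simp [h, g], by simp [h', g']⟩

theorem dense_of_incl_tmul {H K : Type} [NormedAddCommGroup H] [InnerProductSpace ℂ H]
    [NormedAddCommGroup K] [InnerProductSpace ℂ K] {S : Submodule ℂ (HilbertTensor H K)}
    (h : ∀ x y, incl H K (x ⊗ₜ y) ∈ S.topologicalClosure) :
    Dense (S : Set (HilbertTensor H K)) := by
  intro z
  refine ind (P := fun z => z ∈ S.topologicalClosure) z S.isClosed_topologicalClosure fun x => ?_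
  induction x with
  | zero => rw [map_zero]; exact zero_mem _
  | add x y hx hy => rw [map_add]; exact add_mem hx hy
  | tmul x y => exact h x y

theorem continuous_incl_tmul {H K X : Type} [NormedAddCommGroup H] [InnerProductSpace ℂ H]
    [NormedAddCommGroup K] [InnerProductSpace ℂ K] [TopologicalSpace X] {f : X → H} {g : X → K}
    (hf : Continuous f) (hg : Continuous g) : Continuous fun x => incl H K (f x ⊗ₜ g x) :=
  (incl H K).continuous.comp (TensorProduct.continuous_tmul.comp (hf.prodMk hg))

theorem norm_tensorLin_comm_le (π : HilbertRep A) (σ : HilbertRep B) (x : A ⊗[ℂ] B) :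
    ‖tensorLin σ π (TensorProduct.comm ℂ A B x)‖ ≤ ‖tensorLin π σ x‖ := by
  refine norm_le_of_intertwine
    -- The algebraic tensor product of the two spaces is embedded once through the flip and once
    -- directly.
    (k := (incl σ.H π.H).toLinearMap ∘ₗ (TensorProduct.comm ℂ π.H σ.H).toLinearMap)
    (k' := (incl π.H σ.H).toLinearMap) ?_ (fun v => ?_) _ _ fun v => ?_
  · exact (denseRange_incl σ.H π.H).comp (TensorProduct.comm ℂ π.H σ.H).surjective.denseRange
      (incl σ.H π.H).continuous
  · simp
  · induction x generalizing v with
    | zero => exact ⟨0, by simp, by simp⟩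
    | add x y hx hy =>
      rw [map_add, map_add, map_add]
      exact intertwine_add hx hy v
    | tmul a b =>
      refine ⟨TensorProduct.mapL (π.hom a) (σ.hom b) v, ?_, ?_⟩
      · rw [TensorProduct.comm_tmul, tensorLin_tmul]
        refine (opTensor_incl _ _ _).trans (congrArg (incl σ.H π.H) ?_)
        induction v with
        | zero => simp
        | add v w hv hw => rw [map_add, map_add, map_add, hv, hw, map_add]
        | tmul v w => simp
      · exact opTensor_incl _ _ _

theorem norm_tensorLin_comm (π : HilbertRep A) (σ : HilbertRep B) (x : A ⊗[ℂ] B) :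
    ‖tensorLin σ π (TensorProduct.comm ℂ A B x)‖ = ‖tensorLin π σ x‖ := by
  refine le_antisymm (norm_tensorLin_comm_le π σ x) ?_
  simpa using norm_tensorLin_comm_le σ π (TensorProduct.comm ℂ A B x)

/-- The flip carries the statement for the second factor over to the first. -/
theorem norm_tensorLin_le_of_faithful_left {ι : Type*} (ρ : HilbertRep A) (σ : HilbertRep B)
    (π : ι → HilbertRep A) (hπ : ∀ a, (∀ i, (π i).hom a = 0) → a = 0) (x : A ⊗[ℂ] B) {M : ℝ}
    (hM : 0 ≤ M) (h : ∀ i, ‖tensorLin (π i) σ x‖ ≤ M) : ‖tensorLin ρ σ x‖ ≤ M := by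
  rw [← norm_tensorLin_comm]
  refine norm_tensorLin_le_of_faithful σ ρ π hπ _ hM fun i => ?_
  rw [norm_tensorLin_comm]
  exact h i

end HilbertRep

namespace MinTensor

variable {A B C A' B' C' : Type} [NonUnitalCStarAlgebra A] [NonUnitalCStarAlgebra B]
  [NonUnitalCStarAlgebra C] [NonUnitalCStarAlgebra A'] [NonUnitalCStarAlgebra B']
  [NonUnitalCStarAlgebra C']

theorem norm_ofAlg_comm (x : A ⊗[ℂ] B) :
    ‖(ofAlg (TensorProduct.comm ℂ A B x) : B ⊗ᵐ A)‖ = ‖(ofAlg x : A ⊗ᵐ B)‖ := by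
  have key : ∀ {A B : Type} [NonUnitalCStarAlgebra A] [NonUnitalCStarAlgebra B] (x : A ⊗[ℂ] B),
      ‖(ofAlg (TensorProduct.comm ℂ A B x) : B ⊗ᵐ A)‖ ≤ ‖(ofAlg x : A ⊗ᵐ B)‖ := fun {A B} _ _ x => by
    refine norm_ofAlg_le (norm_nonneg _) fun σ π => ?_
    rw [HilbertRep.norm_tensorLin_comm]
    exact norm_tensorLin_le π σ x
  exact le_antisymm (key x) (by simpa using key (TensorProduct.comm ℂ A B x))

variable (A B) in
/-- The canonical map from the algebraic to the minimal tensor product, as a linear map. -/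
def ofAlgₗ : A ⊗[ℂ] B →ₗ[ℂ] A ⊗ᵐ B :=
  { toFun := ofAlg, map_add' := map_add ofAlg, map_smul' := map_smul ofAlg }

variable (A B) in
/-- The flip `A ⊗ B ≅ B ⊗ A`. -/
def flip : A ⊗ᵐ B ≃⋆ₐ[ℂ] B ⊗ᵐ A :=
  let e : A ⊗ᵐ B ≃ₗᵢ[ℂ] B ⊗ᵐ A := (TensorProduct.comm ℂ A B).extendOfIsometry (ofAlgₗ A B)
    (ofAlgₗ B A) denseRange_ofAlg denseRange_ofAlg norm_ofAlg_comm
  have he : ∀ a b, e (tmul a b) = tmul b a := fun a b =>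
    LinearEquiv.extendOfIsometry_eq _ _ _ _ _ _ (a ⊗ₜ b)
  { e with
    map_smul' := map_smul e
    map_mul' := fun s t => by
      refine induction₂ (P := fun s t => e (s * t) = e s * e t) (fun s => ?_) (fun s => ?_)
        (fun s s' t h h' => ?_) (fun s s' t h h' => ?_) (fun a b a' b' => ?_) s t
      · exact isClosed_eq (by fun_prop) (by fun_prop)
      · exact isClosed_eq (by fun_prop) (by fun_prop)
      · rw [add_mul, map_add, map_add, h, h', add_mul]
      · rw [mul_add, map_add, map_add, h, h', mul_add]
      · simp only [tmul_mul_tmul, he]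
    map_star' := fun s => by
      refine induction (P := fun s => e (star s) = star (e s)) ?_ (fun s t h h' => ?_)
        (fun a b => ?_) s
      · exact isClosed_eq (by fun_prop) (by fun_prop)
      · rw [star_add, map_add, map_add, h, h', star_add]
      · simp only [star_tmul, he] }

@[simp]
theorem flip_tmul (a : A) (b : B) : flip A B (tmul a b) = tmul b a :=
  LinearEquiv.extendOfIsometry_eq _ _ _ _ _ _ (a ⊗ₜ b)

end MinTensor

/-! ### Associativity of the minimal tensor product -/

namespace HilbertRep

section Assoc

variable (H K L : Type) [NormedAddCommGroup H] [InnerProductSpace ℂ H]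
  [NormedAddCommGroup K] [InnerProductSpace ℂ K] [NormedAddCommGroup L] [InnerProductSpace ℂ L]

/-- The canonical map of the algebraic tensor product into the left bracketed Hilbert space tensor
product. -/
def inclLeft : (H ⊗[ℂ] K) ⊗[ℂ] L →ₗ[ℂ] HilbertTensor (HilbertTensor H K) L :=
  (incl (HilbertTensor H K) L).toLinearMap ∘ₗ
    (TensorProduct.mapIsometry (incl H K) (LinearIsometry.id : L →ₗᵢ[ℂ] L)).toLinearMap

/-- The canonical map of the algebraic tensor product into the right bracketed Hilbert space tensor
product. -/
def inclRight : (H ⊗[ℂ] K) ⊗[ℂ] L →ₗ[ℂ] HilbertTensor H (HilbertTensor K L) :=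
  (incl H (HilbertTensor K L)).toLinearMap ∘ₗ
    (TensorProduct.mapIsometry (LinearIsometry.id : H →ₗᵢ[ℂ] H) (incl K L)).toLinearMap ∘ₗ
      (TensorProduct.assoc ℂ H K L).toLinearMap

variable {H K L}

theorem norm_inclLeft (v : (H ⊗[ℂ] K) ⊗[ℂ] L) : ‖inclLeft H K L v‖ = ‖v‖ := by
  simp only [inclLeft, LinearMap.comp_apply, LinearIsometry.coe_toLinearMap,
    LinearIsometry.norm_map]

theorem norm_inclRight (v : (H ⊗[ℂ] K) ⊗[ℂ] L) : ‖inclRight H K L v‖ = ‖v‖ := by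
  simp only [inclRight, LinearMap.comp_apply, LinearIsometry.coe_toLinearMap,
    LinearIsometry.norm_map]
  exact TensorProduct.norm_assoc v

theorem inclLeft_tmul (x : H) (y : K) (z : L) :
    inclLeft H K L (x ⊗ₜ y ⊗ₜ z) = incl _ _ (incl _ _ (x ⊗ₜ y) ⊗ₜ z) := rfl

theorem inclRight_tmul (x : H) (y : K) (z : L) :
    inclRight H K L (x ⊗ₜ y ⊗ₜ z) = incl _ _ (x ⊗ₜ incl _ _ (y ⊗ₜ z)) := rfl

theorem denseRange_inclLeft : DenseRange (inclLeft H K L) := by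
  refine dense_of_incl_tmul (S := LinearMap.range (inclLeft H K L)) fun w z => ?_
  refine ind (P := fun w => incl _ _ (w ⊗ₜ z) ∈
    (LinearMap.range (inclLeft H K L)).topologicalClosure) w ?_ fun x => ?_
  · exact (Submodule.isClosed_topologicalClosure _).preimage
      (continuous_incl_tmul continuous_id continuous_const)
  · exact Submodule.le_topologicalClosure _ ⟨x ⊗ₜ z, rfl⟩

theorem denseRange_inclRight : DenseRange (inclRight H K L) := by
  refine dense_of_incl_tmul (S := LinearMap.range (inclRight H K L)) fun x w => ?_
  refine ind (P := fun w => incl _ _ (x ⊗ₜ w) ∈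
    (LinearMap.range (inclRight H K L)).topologicalClosure) w ?_ fun y => ?_
  · exact (Submodule.isClosed_topologicalClosure _).preimage
      (continuous_incl_tmul continuous_const continuous_id)
  · refine Submodule.le_topologicalClosure _ ⟨(TensorProduct.assoc ℂ H K L).symm (x ⊗ₜ y), ?_⟩
    simp only [inclRight, LinearMap.comp_apply, LinearEquiv.coe_coe, LinearEquiv.apply_symm_apply]
    rfl

theorem opTensor_inclLeft (R : H →L[ℂ] H) (S : K →L[ℂ] K) (T : L →L[ℂ] L)
    (v : (H ⊗[ℂ] K) ⊗[ℂ] L) : opTensor (opTensor R S) T (inclLeft H K L v) =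
      inclLeft H K L (TensorProduct.map (TensorProduct.map R.toLinearMap S.toLinearMap)
        T.toLinearMap v) := by
  induction v with
  | zero => simp
  | add v w hv hw => rw [map_add, map_add, map_add, map_add, hv, hw]
  | tmul v z =>
    induction v with
    | zero => simp
    | add v w hv hw => rw [TensorProduct.add_tmul, map_add, map_add, map_add, map_add, hv, hw]
    | tmul x y =>
      rw [inclLeft_tmul, opTensor_tmul, opTensor_tmul]
      rfl

theorem opTensor_inclRight (R : H →L[ℂ] H) (S : K →L[ℂ] K) (T : L →L[ℂ] L)
    (v : (H ⊗[ℂ] K) ⊗[ℂ] L) : opTensor R (opTensor S T) (inclRight H K L v) =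
      inclRight H K L (TensorProduct.map (TensorProduct.map R.toLinearMap S.toLinearMap)
        T.toLinearMap v) := by
  induction v with
  | zero => simp
  | add v w hv hw => rw [map_add, map_add, map_add, map_add, hv, hw]
  | tmul v z =>
    induction v with
    | zero => simp
    | add v w hv hw => rw [TensorProduct.add_tmul, map_add, map_add, map_add, map_add, hv, hw]
    | tmul x y =>
      rw [inclRight_tmul, opTensor_tmul, opTensor_tmul]
      rfl

end Assoc

end HilbertRep

namespace MinTensor

variable (A B C : Type) [NonUnitalCStarAlgebra A] [NonUnitalCStarAlgebra B]
  [NonUnitalCStarAlgebra C]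

/-- The canonical map of the algebraic triple tensor product into `(A ⊗ B) ⊗ C`. -/
def ofAlgLeft : (A ⊗[ℂ] B) ⊗[ℂ] C →ₗ[ℂ] (A ⊗ᵐ B) ⊗ᵐ C :=
  ofAlgₗ (A ⊗ᵐ B) C ∘ₗ TensorProduct.map (ofAlgₗ A B) LinearMap.id

/-- The canonical map of the algebraic triple tensor product into `A ⊗ (B ⊗ C)`. -/
def ofAlgRight : (A ⊗[ℂ] B) ⊗[ℂ] C →ₗ[ℂ] A ⊗ᵐ (B ⊗ᵐ C) :=
  ofAlgₗ A (B ⊗ᵐ C) ∘ₗ TensorProduct.map LinearMap.id (ofAlgₗ B C) ∘ₗ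
    (TensorProduct.assoc ℂ A B C).toLinearMap

variable {A B C}

theorem denseRange_ofAlgLeft : DenseRange (ofAlgLeft A B C) := by
  refine dense_span_of_tmul_mem (S := LinearMap.range (ofAlgLeft A B C)) fun t c => ?_
  refine denseRange_ofAlg.induction_on (p := fun t => tmul t c ∈
    (LinearMap.range (ofAlgLeft A B C)).topologicalClosure) t ?_ fun x => ?_
  · exact (Submodule.isClosed_topologicalClosure _).preimage (by fun_prop)
  · exact Submodule.le_topologicalClosure _ ⟨x ⊗ₜ c, rfl⟩

theorem denseRange_ofAlgRight : DenseRange (ofAlgRight A B C) := by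
  refine dense_span_of_tmul_mem (S := LinearMap.range (ofAlgRight A B C)) fun a t => ?_
  refine denseRange_ofAlg.induction_on (p := fun t => tmul a t ∈
    (LinearMap.range (ofAlgRight A B C)).topologicalClosure) t ?_ fun y => ?_
  · exact (Submodule.isClosed_topologicalClosure _).preimage (by fun_prop)
  · refine Submodule.le_topologicalClosure _ ⟨(TensorProduct.assoc ℂ A B C).symm (a ⊗ₜ y), ?_⟩
    simp only [ofAlgRight, LinearMap.comp_apply, LinearEquiv.coe_coe,
      LinearEquiv.apply_symm_apply]
    rfl

/-- Under the two embeddings of the algebraic triple tensor product of Hilbert spaces, both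
bracketings of the representation act by the same algebraic operator. Together with
`norm_le_of_intertwine` this gives equal operator norms. -/
theorem exists_intertwine (π : HilbertRep A) (σ : HilbertRep B) (τ : HilbertRep C)
    (x : (A ⊗[ℂ] B) ⊗[ℂ] C) (v : (π.H ⊗[ℂ] σ.H) ⊗[ℂ] τ.H) :
    ∃ w, HilbertRep.tensorLin (π.minTensor σ) τ
        (TensorProduct.map (ofAlgₗ A B) LinearMap.id x) (HilbertRep.inclLeft _ _ _ v) =
          HilbertRep.inclLeft _ _ _ w ∧
      HilbertRep.tensorLin π (σ.minTensor τ) (TensorProduct.map LinearMap.id (ofAlgₗ B C)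
        (TensorProduct.assoc ℂ A B C x)) (HilbertRep.inclRight _ _ _ v) =
          HilbertRep.inclRight _ _ _ w := by
  induction x generalizing v with
  | zero => exact ⟨0, by simp; rfl, by simp; rfl⟩
  | add x y hx hy =>
    simp only [map_add]
    exact HilbertRep.intertwine_add hx hy v
  | tmul x c =>
    induction x generalizing v with
    | zero => exact ⟨0, by simp; rfl, by simp; rfl⟩
    | add x y hx hy =>
      simp only [TensorProduct.add_tmul, map_add]
      exact HilbertRep.intertwine_add hx hy v
    | tmul a b =>
      refine ⟨TensorProduct.map (TensorProduct.map (π.hom a).toLinearMap (σ.hom b).toLinearMap)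
        (τ.hom c).toLinearMap v, ?_, ?_⟩
      · rw [← HilbertRep.opTensor_inclLeft, ← HilbertRep.minTensor_tmul]
        rfl
      · rw [← HilbertRep.opTensor_inclRight, ← HilbertRep.minTensor_tmul]
        rfl

theorem norm_tensorLin_assoc (π : HilbertRep A) (σ : HilbertRep B) (τ : HilbertRep C)
    (x : (A ⊗[ℂ] B) ⊗[ℂ] C) :
    ‖HilbertRep.tensorLin (π.minTensor σ) τ (TensorProduct.map (ofAlgₗ A B) LinearMap.id x)‖ =
      ‖HilbertRep.tensorLin π (σ.minTensor τ) (TensorProduct.map LinearMap.id (ofAlgₗ B C)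
        (TensorProduct.assoc ℂ A B C x))‖ := by
  have h : ∀ v : (π.H ⊗[ℂ] σ.H) ⊗[ℂ] τ.H,
      ‖HilbertRep.inclLeft _ _ _ v‖ = ‖HilbertRep.inclRight _ _ _ v‖ := fun v =>
    (HilbertRep.norm_inclLeft v).trans (HilbertRep.norm_inclRight v).symm
  refine le_antisymm ?_ ?_
  · exact HilbertRep.norm_le_of_intertwine HilbertRep.denseRange_inclLeft h _ _
      (exists_intertwine π σ τ x)
  · refine HilbertRep.norm_le_of_intertwine HilbertRep.denseRange_inclRight (fun v => (h v).symm)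
      _ _ fun v => ?_
    obtain ⟨w, h, h'⟩ := exists_intertwine π σ τ x v
    exact ⟨w, h', h⟩

/-- Each norm is a supremum over arbitrary representations of an inner tensor product, not only over
products of representations. The products are jointly faithful, so they suffice, and for products
the two bracketings have the same norm. -/
theorem norm_ofAlgRight (x : (A ⊗[ℂ] B) ⊗[ℂ] C) : ‖ofAlgRight A B C x‖ = ‖ofAlgLeft A B C x‖ := by
  refine le_antisymm ?_ ?_
  · refine norm_ofAlg_le (norm_nonneg _) fun π ρ => ?_
    refine HilbertRep.norm_tensorLin_le_of_faithful π ρ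
      (fun i : HilbertRep B × HilbertRep C => i.1.minTensor i.2)
      (fun t => HilbertRep.eq_zero_of_minTensor) _ (norm_nonneg _) fun i => ?_
    exact (norm_tensorLin_assoc π i.1 i.2 x).symm.trans_le (norm_tensorLin_le _ _ _)
  · refine norm_ofAlg_le (norm_nonneg _) fun ρ τ => ?_
    refine HilbertRep.norm_tensorLin_le_of_faithful_left ρ τ
      (fun i : HilbertRep A × HilbertRep B => i.1.minTensor i.2)
      (fun t => HilbertRep.eq_zero_of_minTensor) _ (norm_nonneg _) fun i => ?_
    exact (norm_tensorLin_assoc i.1 i.2 τ x).trans_le (norm_tensorLin_le _ _ _)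

theorem induction_left {P : (A ⊗ᵐ B) ⊗ᵐ C → Prop} (hc : IsClosed {t | P t})
    (hadd : ∀ s t, P s → P t → P (s + t)) (h : ∀ a b c, P (tmul (tmul a b) c))
    (t : (A ⊗ᵐ B) ⊗ᵐ C) : P t := by
  refine induction hc hadd (fun s c => ?_) t
  refine induction (P := fun s => P (tmul s c)) (hc.preimage (by fun_prop)) (fun s t hs ht => ?_)
    (fun a b => h a b c) s
  rw [add_tmul]
  exact hadd _ _ hs ht

variable (A B C) in
/-- The canonical isomorphism `(A ⊗ B) ⊗ C ≅ A ⊗ (B ⊗ C)`. -/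
def assoc : (A ⊗ᵐ B) ⊗ᵐ C ≃⋆ₐ[ℂ] A ⊗ᵐ (B ⊗ᵐ C) :=
  let e : (A ⊗ᵐ B) ⊗ᵐ C ≃ₗᵢ[ℂ] A ⊗ᵐ (B ⊗ᵐ C) :=
    (LinearEquiv.refl ℂ ((A ⊗[ℂ] B) ⊗[ℂ] C)).extendOfIsometry (ofAlgLeft A B C)
      (ofAlgRight A B C) denseRange_ofAlgLeft denseRange_ofAlgRight norm_ofAlgRight
  have he : ∀ a b c, e (tmul (tmul a b) c) = tmul a (tmul b c) := fun a b c =>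
    LinearEquiv.extendOfIsometry_eq _ _ _ _ _ _ ((a ⊗ₜ b) ⊗ₜ c)
  { e with
    map_smul' := map_smul e
    map_mul' := fun s t => by
      refine induction_left (P := fun s => e (s * t) = e s * e t) ?_ (fun s s' h h' => ?_)
        (fun a b c => ?_) s
      · exact isClosed_eq (by fun_prop) (by fun_prop)
      · rw [add_mul, map_add, map_add, h, h', add_mul]
      refine induction_left (P := fun t => e (tmul (tmul a b) c * t) = e (tmul (tmul a b) c) * e t)
        ?_ (fun s s' h h' => ?_) (fun a' b' c' => ?_) t
      · exact isClosed_eq (by fun_prop) (by fun_prop)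
      · rw [mul_add, map_add, map_add, h, h', mul_add]
      · simp only [tmul_mul_tmul, he]
    map_star' := fun s => by
      refine induction_left (P := fun s => e (star s) = star (e s)) ?_ (fun s t h h' => ?_)
        (fun a b c => ?_) s
      · exact isClosed_eq (by fun_prop) (by fun_prop)
      · rw [star_add, map_add, map_add, h, h', star_add]
      · simp only [star_tmul, he] }

variable (A B C) in
theorem isAssociator_assoc : IsAssociator (assoc A B C) := fun a b c =>
  LinearEquiv.extendOfIsometry_eq _ _ _ _ _ _ ((a ⊗ₜ b) ⊗ₜ c)

@[simp]
theorem assoc_tmul (a : A) (b : B) (c : C) :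
    assoc A B C (tmul (tmul a b) c) = tmul a (tmul b c) := isAssociator_assoc A B C a b c

variable {A' B' C' : Type} [NonUnitalCStarAlgebra A'] [NonUnitalCStarAlgebra B']
  [NonUnitalCStarAlgebra C']

theorem hom_ext_left {E : Type*} [NonUnitalCStarAlgebra E] {f g : (A ⊗ᵐ B) ⊗ᵐ C →⋆ₙₐ[ℂ] E}
    (h : ∀ a b c, f (tmul (tmul a b) c) = g (tmul (tmul a b) c)) : f = g := by
  ext t
  exact induction_left (P := fun t => f t = g t)
    (isClosed_eq (map_continuous f) (map_continuous g))
    (fun s t hs ht => by rw [map_add, map_add, hs, ht]) h t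

theorem assoc_map (f : A →⋆ₙₐ[ℂ] A') (g : B →⋆ₙₐ[ℂ] B') (h : C →⋆ₙₐ[ℂ] C')
    (t : (A ⊗ᵐ B) ⊗ᵐ C) : assoc A' B' C' (map (map f g) h t) = map f (map g h) (assoc A B C t) := by
  have e : ((assoc A' B' C' : _ →⋆ₙₐ[ℂ] _).comp (map (map f g) h)) =
      (map f (map g h)).comp (assoc A B C : _ →⋆ₙₐ[ℂ] _) := hom_ext_left fun a b c => by
    simp
  exact DFunLike.congr_fun e t

end MinTensor

/-! ### Sums of orthogonal `*`-homomorphisms -/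

section SumHom

variable {ι X D : Type} [NonUnitalCStarAlgebra X] [NonUnitalCStarAlgebra D]

/-- The sum of finitely many `*`-homomorphisms with pairwise orthogonal ranges. -/
def sumHom (s : Finset ι) (f : ι → X →⋆ₙₐ[ℂ] D)
    (hf : ∀ i j, i ≠ j → ∀ x y, f i x * f j y = 0) : X →⋆ₙₐ[ℂ] D where
  toFun x := ∑ i ∈ s, f i x
  map_smul' c x := by simp [Finset.smul_sum]
  map_zero' := by simp
  map_add' x y := by simp [Finset.sum_add_distrib]
  map_mul' x y := by
    simp only [map_mul, Finset.sum_mul, Finset.mul_sum]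
    refine Finset.sum_congr rfl fun i hi => ?_
    exact (Finset.sum_eq_single i (fun j _ hj => hf j i hj x y) (fun h => absurd hi h)).symm
  map_star' x := by simp [map_star]

theorem sumHom_apply (s : Finset ι) (f : ι → X →⋆ₙₐ[ℂ] D)
    (hf : ∀ i j, i ≠ j → ∀ x y, f i x * f j y = 0) (x : X) :
    sumHom s f hf x = ∑ i ∈ s, f i x := rfl

end SumHom

/-! ### Homomorphisms on C*-algebraic direct sums -/

section DirectSum

variable {ι : Type} {E : ι → Type} [∀ i, NonUnitalCStarAlgebra (E i)]

variable (E) in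
/-- The projection of the C*-algebraic direct sum onto a summand. -/
def c0Proj (i : ι) : c0Sum E →⋆ₙₐ[ℂ] E i where
  toFun x := x.1 i
  map_smul' _ _ := rfl
  map_zero' := rfl
  map_add' _ _ := rfl
  map_mul' _ _ := rfl
  map_star' _ := rfl

variable [DecidableEq ι]

@[simp]
theorem c0Proj_incl_self (i : ι) (a : E i) : c0Proj E i (c0Incl i a) = a :=
  lp.single_apply_self ∞ i a

theorem c0Proj_incl_of_ne {i j : ι} (h : j ≠ i) (a : E i) : c0Proj E j (c0Incl i a) = 0 :=
  lp.single_apply_ne ∞ i a h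

theorem c0_ext {x y : c0Sum E} (h : ∀ i, c0Proj E i x = c0Proj E i y) : x = y :=
  Subtype.ext (lp.ext (funext h))

theorem c0Incl_mul_of_ne {i j : ι} (h : i ≠ j) (a : E i) (b : E j) :
    c0Incl i a * c0Incl j b = 0 := by
  refine c0_ext fun k => ?_
  rw [map_mul, map_zero]
  rcases eq_or_ne k i with rfl | hk
  · rw [c0Proj_incl_of_ne h, mul_zero]
  · rw [c0Proj_incl_of_ne hk, zero_mul]

theorem mul_c0Incl (x : c0Sum E) (i : ι) (a : E i) :
    x * c0Incl i a = c0Incl i (c0Proj E i x * a) := by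
  refine c0_ext fun k => ?_
  rw [map_mul]
  rcases eq_or_ne k i with rfl | hk
  · rw [c0Proj_incl_self, c0Proj_incl_self]
  · rw [c0Proj_incl_of_ne hk, c0Proj_incl_of_ne hk, mul_zero]

theorem norm_c0_le {x : c0Sum E} {M : ℝ} (hM : 0 ≤ M) (h : ∀ i, ‖c0Proj E i x‖ ≤ M) : ‖x‖ ≤ M :=
  lp.norm_le_of_forall_le hM h

theorem c0Proj_sub_sum (x : c0Sum E) (s : Finset ι) (i : ι) :
    c0Proj E i (x - ∑ j ∈ s, c0Incl j (c0Proj E j x)) = if i ∈ s then 0 else c0Proj E i x := by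
  rw [map_sub, map_sum]
  split_ifs with h
  · rw [Finset.sum_eq_single i (fun j _ hj => c0Proj_incl_of_ne hj.symm _)
      (fun hi => absurd h hi), c0Proj_incl_self, sub_self]
  · rw [Finset.sum_eq_zero fun j hj => c0Proj_incl_of_ne (ne_of_mem_of_not_mem hj h).symm _, sub_zero]

theorem hasSum_c0Incl (x : c0Sum E) : HasSum (fun i => c0Incl i (c0Proj E i x)) x := by
  rw [HasSum, SummationFilter.unconditional_filter, Metric.tendsto_atTop]
  intro ε hε
  -- Only finitely many coordinates have norm at least `ε / 2`; a partial sum containing all of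
  -- these leaves a remainder of supremum norm at most `ε / 2`.
  have hfin : {i | ¬ ‖c0Proj E i x‖ < ε / 2}.Finite :=
    (mem_c0Sum E).1 x.2 |>.eventually (gt_mem_nhds (half_pos hε))
  refine ⟨hfin.toFinset, fun s hs => ?_⟩
  rw [dist_comm, dist_eq_norm]
  refine (norm_c0_le (half_pos hε).le fun i => ?_).trans_lt (half_lt_self hε)
  rw [c0Proj_sub_sum]
  split_ifs with h
  · rw [norm_zero]; positivity
  · by_contra hi
    exact h (hs (hfin.mem_toFinset.2 fun h => hi h.le))

theorem c0_induction {P : c0Sum E → Prop} (hc : IsClosed {x | P x})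
    (hadd : ∀ x y, P x → P y → P (x + y)) (h0 : P 0) (h : ∀ i a, P (c0Incl i a)) (x : c0Sum E) :
    P x := by
  refine hc.mem_of_tendsto (hasSum_c0Incl x) (Filter.Eventually.of_forall fun s => ?_)
  exact Finset.sum_induction _ P hadd h0 fun i _ => h i _

variable {D : Type} [NonUnitalCStarAlgebra D]

/-- By orthogonality each finite partial sum of the `f i` is itself a `*`-homomorphism, hence
contractive. The Cauchy criterion for the expansion of `x` therefore transfers to its image with the
same `ε`. -/
theorem summable_of_orthogonal (f : ∀ i, E i →⋆ₙₐ[ℂ] D)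
    (hf : ∀ i j, i ≠ j → ∀ x y, f i x * f j y = 0) (x : c0Sum E) :
    Summable fun i => f i (c0Proj E i x) := by
  rw [summable_iff_vanishing_norm]
  intro ε hε
  obtain ⟨s, hs⟩ := (summable_iff_vanishing_norm.1 (hasSum_c0Incl x).summable) ε hε
  refine ⟨s, fun t ht => ?_⟩
  let F := sumHom t (fun i => (f i).comp (c0Proj E i)) fun i j h x y => hf i j h _ _
  have hF : ∑ i ∈ t, f i (c0Proj E i x) = F (∑ i ∈ t, c0Incl i (c0Proj E i x)) := by
    refine Finset.sum_congr rfl fun i hi => ?_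
    change f i (c0Proj E i x) = f i (c0Proj E i _)
    rw [map_sum, Finset.sum_eq_single i (fun j _ hj => c0Proj_incl_of_ne hj.symm _)
      (fun h => absurd hi h), c0Proj_incl_self]
  rw [hF]
  exact (NonUnitalStarAlgHom.norm_apply_le F _).trans_lt (hs t ht)

/-- The `*`-homomorphism on a C*-algebraic direct sum given by `*`-homomorphisms on the summands
with pairwise orthogonal ranges. -/
def c0Lift (f : ∀ i, E i →⋆ₙₐ[ℂ] D) (hf : ∀ i j, i ≠ j → ∀ x y, f i x * f j y = 0) :
    c0Sum E →⋆ₙₐ[ℂ] D :=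
  let F := fun s : Finset ι =>
    sumHom s (fun i => (f i).comp (c0Proj E i)) fun i j h x y => hf i j h _ _
  have hF : ∀ x, Filter.Tendsto (fun s => F s x) Filter.atTop
      (𝓝 (∑' i, f i (c0Proj E i x))) := fun x => (summable_of_orthogonal f hf x).hasSum
  { toFun := fun x => ∑' i, f i (c0Proj E i x)
    map_smul' := fun c x => tendsto_nhds_unique (hF (c • x)) (by
      simp only [map_smul]
      exact (hF x).const_smul c)
    map_zero' := by simp
    map_add' := fun x y => tendsto_nhds_unique (hF (x + y)) (by
      simp only [map_add]
      exact (hF x).add (hF y))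
    map_mul' := fun x y => tendsto_nhds_unique (hF (x * y)) (by
      simp only [map_mul]
      exact (hF x).mul (hF y))
    map_star' := fun x => tendsto_nhds_unique (hF (star x)) (by
      simp only [map_star]
      exact (hF x).star) }

@[simp]
theorem c0Lift_incl (f : ∀ i, E i →⋆ₙₐ[ℂ] D) (hf : ∀ i j, i ≠ j → ∀ x y, f i x * f j y = 0)
    (i : ι) (a : E i) : c0Lift f hf (c0Incl i a) = f i a := by
  change ∑' j, f j (c0Proj E j (c0Incl i a)) = f i a
  rw [tsum_eq_single i fun j hj => by rw [c0Proj_incl_of_ne hj, map_zero], c0Proj_incl_self]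

end DirectSum

/-! ### Strict limits of `*`-homomorphisms -/

section StrictLimit

variable {κ D E : Type*} [NonUnitalCStarAlgebra D] [NonUnitalCStarAlgebra E]

/-- The norm of a multiplier equals that of its left action, so the left action determines it. -/
theorem DoubleCentralizer.ext_fst {a b : 𝓜(ℂ, E)} (h : ∀ t, a.fst t = b.fst t) : a = b := by
  rw [← sub_eq_zero, ← norm_eq_zero, ← DoubleCentralizer.norm_fst, norm_eq_zero,
    DoubleCentralizer.sub_fst, sub_eq_zero]
  exact ContinuousLinearMap.ext h

/-- A family of `*`-homomorphisms into `E` converges strictly. -/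
def StrictlyConverges (l : Filter κ) (θ : κ → D →⋆ₙₐ[ℂ] E) : Prop :=
  ∀ m t, ∃ s, Filter.Tendsto (fun k => θ k m * t) l (𝓝 s)

/-- `*`-homomorphisms are contractive, so the operators `t ↦ θ k m * t` are bounded by `‖m‖`
uniformly in `k`, and convergence on a total set extends to all of `E` by completeness. -/
theorem strictlyConverges_of_dense {l : Filter κ} [l.NeBot] {θ : κ → D →⋆ₙₐ[ℂ] E} {W : Set E}
    (hW : Dense (Submodule.span ℂ W : Set E))
    (h : ∀ m, ∀ t ∈ W, ∃ s, Filter.Tendsto (fun k => θ k m * t) l (𝓝 s)) :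
    StrictlyConverges l θ := by
  intro m t
  have hspan : ∀ t ∈ Submodule.span ℂ W, ∃ s, Filter.Tendsto (fun k => θ k m * t) l (𝓝 s) := by
    intro t ht
    induction ht using Submodule.span_induction with
    | mem t ht => exact h m t ht
    | zero => exact ⟨0, by simp⟩
    | add x y _ _ hx hy =>
      obtain ⟨s, hs⟩ := hx
      obtain ⟨s', hs'⟩ := hy
      exact ⟨s + s', by simpa only [mul_add] using hs.add hs'⟩
    | smul c x _ hx =>
      obtain ⟨s, hs⟩ := hx
      exact ⟨c • s, by simpa only [mul_smul_comm] using hs.const_smul c⟩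
  rw [← cauchy_map_iff_exists_tendsto, Metric.cauchy_iff]
  refine ⟨inferInstance, fun ε hε => ?_⟩
  -- With this tolerance, replacing `t` by `t'` costs at most `ε / 4` for every `k`; the summand `1`
  -- keeps the denominator positive when `m = 0`.
  have hδ : 0 < ε / (4 * (‖m‖ + 1)) := by positivity
  obtain ⟨t', ht', htt'⟩ := Metric.mem_closure_iff.1 (hW t) _ hδ
  obtain ⟨s, hs⟩ := hspan t' ht'
  refine ⟨(fun k => θ k m * t) '' {k | dist (θ k m * t') s < ε / 4},
    Filter.image_mem_map (Metric.tendsto_nhds.1 hs (ε / 4) (by positivity)), ?_⟩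
  have hd : ∀ k, dist (θ k m * t) (θ k m * t') ≤ ε / 4 := fun k => by
    rw [dist_eq_norm, ← mul_sub]
    rw [dist_eq_norm] at htt'
    calc _ ≤ ‖θ k m‖ * ‖t - t'‖ := norm_mul_le _ _
      _ ≤ (‖m‖ + 1) * (ε / (4 * (‖m‖ + 1))) := by
        gcongr
        exact (NonUnitalStarAlgHom.norm_apply_le (θ k) m).trans (by linarith)
      _ = ε / 4 := by field_simp
  have hd' : ∀ k, dist (θ k m * t') s < ε / 4 → dist (θ k m * t) s < ε / 2 := fun k hk =>
    (dist_triangle _ (θ k m * t') _).trans_lt (by linarith [hd k])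
  rintro _ ⟨k, hk, rfl⟩ _ ⟨k', hk', rfl⟩
  refine (dist_triangle_right _ _ s).trans_lt ?_
  linarith [hd' k hk, hd' k' hk']

variable {l : Filter κ} [l.NeBot] {θ : κ → D →⋆ₙₐ[ℂ] E} (hθ : StrictlyConverges l θ)

namespace StrictlyConverges

/-- The action of the strict limit of a family of `*`-homomorphisms. -/
def act (hθ : StrictlyConverges l θ) (m : D) (t : E) : E := (hθ m t).choose

theorem tendsto_act (m : D) (t : E) :
    Filter.Tendsto (fun k => θ k m * t) l (𝓝 (hθ.act m t)) := (hθ m t).choose_spec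

theorem act_eq {m : D} {t s : E} (h : Filter.Tendsto (fun k => θ k m * t) l (𝓝 s)) :
    hθ.act m t = s := tendsto_nhds_unique (hθ.tendsto_act m t) h

theorem norm_act_le (m : D) (t : E) : ‖hθ.act m t‖ ≤ ‖m‖ * ‖t‖ :=
  le_of_tendsto (hθ.tendsto_act m t).norm (Filter.Eventually.of_forall fun k =>
    (norm_mul_le _ _).trans (mul_le_mul_of_nonneg_right
      (NonUnitalStarAlgHom.norm_apply_le (θ k) m) (norm_nonneg _)))

/-- The action of the strict limit as a continuous linear map. -/
def actL (m : D) : E →L[ℂ] E :=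
  LinearMap.mkContinuous
    { toFun := hθ.act m
      map_add' := fun s t => hθ.act_eq (by
        simpa only [mul_add] using (hθ.tendsto_act m s).add (hθ.tendsto_act m t))
      map_smul' := fun c t => hθ.act_eq (by
        simp only [mul_smul_comm]
        exact (hθ.tendsto_act m t).const_smul c) } ‖m‖
    fun t => hθ.norm_act_le m t

/-- This is the centrality condition linking the left action of the limit to the right action `s ↦
(m* s*)*`. -/
theorem star_act_mul (m : D) (s t : E) :
    star (hθ.act (star m) s) * t = star s * hθ.act m t := by
  refine tendsto_nhds_unique ((hθ.tendsto_act (star m) s).star.mul_const t) ?_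
  simpa only [star_mul, map_star, star_star, mul_assoc] using
    (hθ.tendsto_act m t).const_mul (star s)

/-- The strict limit at an element, as a multiplier. -/
def multiplier (m : D) : 𝓜(ℂ, E) where
  fst := hθ.actL m
  snd := ((starL ℂ : E ≃L⋆[ℂ] E) : E →L⋆[ℂ] E).comp ((hθ.actL (star m)).comp
    ((starL ℂ : E ≃L⋆[ℂ] E) : E →L⋆[ℂ] E))
  central s t := by
    have := hθ.star_act_mul m (star s) t
    rwa [star_star] at this

/-- The strict limit of a family of `*`-homomorphisms, as a `*`-homomorphism into the multiplier
algebra. -/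
def limit : D →⋆ₙₐ[ℂ] 𝓜(ℂ, E) where
  toFun := hθ.multiplier
  map_smul' c m := DoubleCentralizer.ext_fst fun t => hθ.act_eq (by
    simp only [map_smul, smul_mul_assoc]
    exact (hθ.tendsto_act m t).const_smul c)
  map_zero' := DoubleCentralizer.ext_fst fun t => hθ.act_eq (by simp)
  map_add' m m' := DoubleCentralizer.ext_fst fun t => hθ.act_eq (by
    simp only [map_add, add_mul]
    exact (hθ.tendsto_act m t).add (hθ.tendsto_act m' t))
  map_mul' m m' := DoubleCentralizer.ext_fst fun t => hθ.act_eq (by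
    change Filter.Tendsto _ l (𝓝 (hθ.act m (hθ.act m' t)))
    -- Strict limits are multiplicative because the family is uniformly bounded: the inner product
    -- may be replaced by its limit before the outer factor is applied.
    have h1 : Filter.Tendsto (fun k => θ k m * (θ k m' * t - hθ.act m' t)) l (𝓝 0) := by
      refine squeeze_zero_norm (a := fun k => ‖m‖ * ‖θ k m' * t - hθ.act m' t‖) (fun k => ?_) ?_
      · exact (norm_mul_le _ _).trans (mul_le_mul_of_nonneg_right
          (NonUnitalStarAlgHom.norm_apply_le (θ k) m) (norm_nonneg _))
      · simpa using ((hθ.tendsto_act m' t).sub_const (hθ.act m' t)).norm.const_mul ‖m‖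
    simpa [mul_sub, mul_assoc] using h1.add (hθ.tendsto_act m (hθ.act m' t)))
  map_star' m := DoubleCentralizer.ext_fst fun t => by
    rw [DoubleCentralizer.star_fst]
    change hθ.act (star m) t = star (star (hθ.act (star m) (star (star t))))
    rw [star_star, star_star]

theorem limit_fst_eq {m : D} {t s : E} (h : Filter.Tendsto (fun k => θ k m * t) l (𝓝 s)) :
    (hθ.limit m).fst t = s := hθ.act_eq h

end StrictlyConverges

end StrictLimit

theorem NonUnitalStarAlgHom.id_apply_eq {A : Type} [NonUnitalCStarAlgebra A] (a : A) :
    NonUnitalStarAlgHom.id ℂ A a = a := rfl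

/-! ### Homomorphisms and representations of unitizations -/

section Unitization

variable {A D : Type} [NonUnitalCStarAlgebra A] [NonUnitalCStarAlgebra D]

/-- The extension of a `*`-homomorphism to the unitization which maps the unit to a given
projection. -/
def unitLift (f : A →⋆ₙₐ[ℂ] D) (e : D) (hstar : star e = e) (hmul : e * e = e)
    (hl : ∀ a, e * f a = f a) (hr : ∀ a, f a * e = f a) : Unitization ℂ A →⋆ₙₐ[ℂ] D where
  toFun x := x.fst • e + f x.snd
  map_smul' c x := by simp [mul_smul]
  map_zero' := by simp
  map_add' x y := by
    simp only [Unitization.fst_add, Unitization.snd_add, map_add, add_smul]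
    abel
  map_mul' x y := by
    simp only [Unitization.fst_mul, Unitization.snd_mul, map_add, map_smul, map_mul, add_mul,
      mul_add, smul_mul_assoc, mul_smul_comm, hmul, hl, hr, mul_smul, smul_add]
    rw [smul_comm x.fst y.fst e]
    abel
  map_star' x := by simp [hstar, map_star]

theorem unitLift_apply (f : A →⋆ₙₐ[ℂ] D) (e : D) (hstar : star e = e) (hmul : e * e = e)
    (hl : ∀ a, e * f a = f a) (hr : ∀ a, f a * e = f a) (x : Unitization ℂ A) :
    unitLift f e hstar hmul hl hr x = x.fst • e + f x.snd := rfl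

theorem unitEmb_fst (a : A) : (unitEmb a).fst = 0 := rfl

theorem unitEmb_snd (a : A) : (unitEmb a).snd = a := rfl

@[simp]
theorem unitLift_unitEmb (f : A →⋆ₙₐ[ℂ] D) (e : D) (hstar : star e = e) (hmul : e * e = e)
    (hl : ∀ a, e * f a = f a) (hr : ∀ a, f a * e = f a) (a : A) :
    unitLift f e hstar hmul hl hr (unitEmb a) = f a := by
  rw [unitLift_apply, unitEmb_fst, unitEmb_snd, zero_smul, zero_add]

@[simp]
theorem unitLift_one (f : A →⋆ₙₐ[ℂ] D) (e : D) (hstar : star e = e) (hmul : e * e = e)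
    (hl : ∀ a, e * f a = f a) (hr : ∀ a, f a * e = f a) :
    unitLift f e hstar hmul hl hr 1 = e := by
  rw [unitLift_apply, Unitization.fst_one, Unitization.snd_one, one_smul, map_zero, add_zero]

theorem unit_hom_ext {f g : Unitization ℂ A →⋆ₙₐ[ℂ] D} (h1 : f 1 = g 1)
    (h : ∀ a, f (unitEmb a) = g (unitEmb a)) : f = g := by
  ext x
  have hx : x = x.fst • (1 : Unitization ℂ A) + unitEmb x.snd := by
    ext
    · simp [unitEmb_fst]
    · simp [unitEmb_snd]
  rw [hx, map_add, map_add, map_smul, map_smul, h1, h]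

/-- The extension of a representation to the unitization, on the same Hilbert space. -/
def HilbertRep.unitize (π : HilbertRep A) : HilbertRep (Unitization ℂ A) where
  H := π.H
  hom := unitLift π.hom 1 (star_one _) (one_mul _) (fun _ => one_mul _) (fun _ => mul_one _)

theorem HilbertRep.unitize_unitEmb (π : HilbertRep A) (a : A) :
    π.unitize.hom (unitEmb a) = π.hom a :=
  unitLift_unitEmb π.hom 1 (star_one _) (one_mul _) (fun _ => one_mul _) (fun _ => mul_one _) a

theorem HilbertRep.unitize_apply (π : HilbertRep A) (x : Unitization ℂ A) :
    π.unitize.hom x = x.fst • (1 : π.H →L[ℂ] π.H) + π.hom x.snd := rfl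

/-- The representation of `ℂ` on the one-dimensional Hilbert space. -/
def HilbertRep.scalar : HilbertRep ℂ where
  H := ℂ
  hom :=
    { toFun := fun c => c • 1
      map_smul' := fun c d => by simp [mul_smul]
      map_zero' := by simp
      map_add' := fun c d => add_smul c d 1
      map_mul' := fun c d => by rw [smul_mul_smul_comm, one_mul]
      map_star' := fun c => by simp [star_smul] }

theorem HilbertRep.scalar_hom_one : HilbertRep.scalar.hom 1 = 1 := one_smul _ _

/-- The family of all representations separates points. -/
def SeparatedByReps (A : Type) [NonUnitalCStarAlgebra A] : Prop :=
  ∀ a : A, (∀ π : HilbertRep A, π.hom a = 0) → a = 0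

/-! ### Algebras separated by their representations -/

theorem separatedByReps_complex : SeparatedByReps ℂ := fun c h => by
  have h1 := congrArg (fun T => T (1 : ℂ)) (h HilbertRep.scalar)
  have h2 : c * 1 = 0 := h1
  simpa using h2

/-- The scalar part is detected by pulling representations of `ℂ` back along the character with
kernel `A`; the remaining part lies in `A` and is detected by the extended representations. -/
theorem SeparatedByReps.unitization (h : SeparatedByReps A) :
    SeparatedByReps (Unitization ℂ A) := fun x hx => by
  have h1 : x.fst = 0 := separatedByReps_complex _ fun π => by
    have hl := hx (π.comap (unitLift (0 : A →⋆ₙₐ[ℂ] ℂ) 1 (star_one _) (one_mul _)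
      (fun _ => one_mul _) (fun _ => mul_one _)))
    have e : x.fst • (1 : ℂ) + (0 : A →⋆ₙₐ[ℂ] ℂ) x.snd = x.fst := by simp
    rw [HilbertRep.comap_hom_apply, unitLift_apply, e] at hl
    exact hl
  have h2 : x.snd = 0 := h _ fun π => by
    have hl := (π.unitize_apply x).symm.trans (hx π.unitize)
    rw [h1, zero_smul, zero_add] at hl
    exact hl
  ext
  · exact h1
  · exact h2

theorem SeparatedByReps.c0Sum {ι : Type} {E : ι → Type} [∀ i, NonUnitalCStarAlgebra (E i)]
    [DecidableEq ι] (h : ∀ i, SeparatedByReps (E i)) : SeparatedByReps (c0Sum E) := fun x hx =>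
  c0_ext fun i => by
    rw [map_zero]
    exact h i _ fun π => hx (π.comap (c0Proj E i))

theorem GroupCStar.denseRange_ofAlg {G : Type} [Group G] :
    DenseRange (GroupCStar.ofAlg : MonoidAlgebra ℂ G → GroupCStar G) :=
  CStarSeminorm.Completion.denseRange_of (fullSeminorm G)

/-- The norm is by definition a supremum over representations of the group algebra, and each of them
extends to the completion. A vector killed by all of them has norm at most `ε` by approximation from
the group algebra, so no state or GNS construction is needed. -/
theorem separatedByReps_groupCStar (G : Type) [Group G] : SeparatedByReps (GroupCStar G) := by
  intro t ht
  have hle : ‖t‖ ≤ 0 := by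
    refine le_of_forall_pos_le_add fun ε hε => ?_
    obtain ⟨x, hx⟩ := GroupCStar.denseRange_ofAlg.exists_dist_lt t (half_pos hε)
    rw [dist_eq_norm] at hx
    have h1 : ‖(GroupCStar.ofAlg x : GroupCStar G)‖ ≤ ε / 2 := by
      refine (CStarSeminorm.Completion.norm_of (fullSeminorm G) x).trans_le ?_
      refine Real.iSup_le (fun π => ?_) (half_pos hε).le
      let ρ : HilbertRep (GroupCStar G) :=
        { H := π.H
          hom := CStarSeminorm.Completion.lift (fullSeminorm G) π.hom
            (HilbertRep.le_seminorm_val (fun π : HilbertRep (MonoidAlgebra ℂ G) => π)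
              bddAbove_groupAlg π) }
      have h2 : ρ.hom (GroupCStar.ofAlg x) = π.hom x :=
        CStarSeminorm.Completion.lift_of (fullSeminorm G) _ _ x
      have h3 : ρ.hom (GroupCStar.ofAlg x) = - ρ.hom (t - GroupCStar.ofAlg x) := by
        rw [map_sub, ht ρ, zero_sub, neg_neg]
      rw [← h2, h3, norm_neg]
      exact (NonUnitalStarAlgHom.norm_apply_le ρ.hom _).trans hx.le
    calc ‖t‖ ≤ ‖t - GroupCStar.ofAlg x‖ + ‖(GroupCStar.ofAlg x : GroupCStar G)‖ := by
          simpa using norm_add_le (t - GroupCStar.ofAlg x) (GroupCStar.ofAlg x)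
      _ ≤ 0 + ε := by linarith
  simpa using hle

/-- Identities in `ℂ ⊗ A` can be read in `A`: each representation of `A` is recovered from its
tensor product with the one-dimensional representation of `ℂ`. -/
theorem MinTensor.eq_zero_of_one_tmul (hA : SeparatedByReps A) {a : A}
    (h : MinTensor.tmul (1 : ℂ) a = 0) : a = 0 := by
  refine hA a fun π => ContinuousLinearMap.ext fun v => ?_
  have h1 : HilbertRep.opTensor (1 : ℂ →L[ℂ] ℂ) (π.hom a) = 0 := by
    refine (congrArg (fun T : ℂ →L[ℂ] ℂ => HilbertRep.opTensor T (π.hom a))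
      HilbertRep.scalar_hom_one).symm.trans ?_
    refine (HilbertRep.minTensor_tmul HilbertRep.scalar π 1 a).symm.trans ?_
    rw [h]
    exact map_zero _
  have h2 := congrArg (fun T => T (HilbertRep.incl ℂ π.H ((1 : ℂ) ⊗ₜ v))) h1
  have h3 : ‖HilbertRep.incl ℂ π.H ((1 : ℂ) ⊗ₜ π.hom a v)‖ = 0 := by
    rw [← one_apply_eq_self (F := ℂ →L[ℂ] ℂ) (1 : ℂ), ← HilbertRep.opTensor_tmul, h2]
    simp
  rw [LinearIsometry.norm_map, TensorProduct.norm_tmul, norm_one, one_mul, norm_eq_zero] at h3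
  exact h3

theorem MinTensor.tensorLin_unitize (π σ : HilbertRep A) (t : A ⊗ᵐ A) :
    (π.unitize.minTensor σ.unitize).hom (unitEmb₂ t) = (π.minTensor σ).hom t := by
  have h : (π.unitize.minTensor σ.unitize).hom.comp unitEmb₂ = (π.minTensor σ).hom := by
    refine MinTensor.hom_ext fun a b => ?_
    rw [NonUnitalStarAlgHom.comp_apply, unitEmb₂, MinTensor.map_tmul]
    refine (HilbertRep.minTensor_tmul _ _ _ _).trans ?_
    rw [HilbertRep.unitize_unitEmb, HilbertRep.unitize_unitEmb]
    exact (HilbertRep.minTensor_tmul _ _ _ _).symm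
  exact DFunLike.congr_fun h t

/-- Every pair of representations of `A` extends to the unitization on the same Hilbert spaces, so
no norm is lost. It follows that the range of the embedding is closed, as the cancellation law
requires. -/
theorem norm_unitEmb₂ (t : A ⊗ᵐ A) : ‖unitEmb₂ t‖ = ‖t‖ := by
  refine le_antisymm (NonUnitalStarAlgHom.norm_apply_le unitEmb₂ t) ?_
  refine HilbertRep.norm_le_of_minTensor (norm_nonneg _) fun π σ => ?_
  rw [← MinTensor.tensorLin_unitize]
  exact NonUnitalStarAlgHom.norm_apply_le (π.unitize.minTensor σ.unitize).hom _

theorem isClosed_range_unitEmb₂ : IsClosed (Set.range (unitEmb₂ (A := A))) :=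
  (AddMonoidHomClass.isometry_of_norm unitEmb₂ norm_unitEmb₂).isClosedEmbedding.isClosed_range

end Unitization

/-! ### Unitizations of bialgebras -/

section UnitizedBialgebra

open MinTensor

variable {A : Type} [NonUnitalCStarAlgebra A] (Δ : A →⋆ₙₐ[ℂ] A ⊗ᵐ A) (ε : A →⋆ₙₐ[ℂ] ℂ)

theorem one_tmul_one_mul {A B : Type} [CStarAlgebra A] [CStarAlgebra B] (t : A ⊗ᵐ B) :
    tmul 1 1 * t = t :=
  induction (P := fun t => tmul 1 1 * t = t) (isClosed_eq (by fun_prop) (by fun_prop))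
    (fun s t hs ht => by rw [mul_add, hs, ht]) (fun a b => by simp) t

theorem mul_one_tmul_one {A B : Type} [CStarAlgebra A] [CStarAlgebra B] (t : A ⊗ᵐ B) :
    t * tmul 1 1 = t :=
  induction (P := fun t => t * tmul 1 1 = t) (isClosed_eq (by fun_prop) (by fun_prop))
    (fun s t hs ht => by rw [add_mul, hs, ht]) (fun a b => by simp) t

/-- The unital extension of a comultiplication to the unitization. -/
def unitComul : Unitization ℂ A →⋆ₙₐ[ℂ] Unitization ℂ A ⊗ᵐ Unitization ℂ A :=
  unitLift (unitEmb₂.comp Δ) (tmul 1 1) (by rw [star_tmul, star_one])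
    (one_tmul_one_mul _) (fun _ => one_tmul_one_mul _) (fun _ => mul_one_tmul_one _)

@[simp]
theorem unitComul_unitEmb (a : A) : unitComul Δ (unitEmb a) = unitEmb₂ (Δ a) :=
  unitLift_unitEmb _ _ _ _ _ _ a

@[simp]
theorem unitComul_one : unitComul Δ 1 = tmul 1 1 := unitLift_one _ _ _ _ _ _

/-- The unital extension of a character to the unitization. -/
def unitCounit : Unitization ℂ A →⋆ₙₐ[ℂ] ℂ :=
  unitLift ε 1 (star_one _) (one_mul _) (fun _ => one_mul _) (fun _ => mul_one _)

@[simp]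
theorem unitCounit_unitEmb (a : A) : unitCounit ε (unitEmb a) = ε a :=
  unitLift_unitEmb _ _ _ _ _ _ a

@[simp]
theorem unitCounit_one : unitCounit ε 1 = 1 := unitLift_one _ _ _ _ _ _

variable {Δ ε}

/-- At `1` both sides are `1 ⊗ (1 ⊗ 1)`. On `A` both sides come from `A` through the triple
embedding, and naturality of the associator reduces the claim to `h`. -/
theorem unitComul_coassoc (h : ∀ x, assoc A A A (map Δ (NonUnitalStarAlgHom.id ℂ A) (Δ x)) =
    map (NonUnitalStarAlgHom.id ℂ A) Δ (Δ x)) (x : Unitization ℂ A) :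
    assoc _ _ _ (map (unitComul Δ) (NonUnitalStarAlgHom.id ℂ _) (unitComul Δ x)) =
      map (NonUnitalStarAlgHom.id ℂ _) (unitComul Δ) (unitComul Δ x) := by
  have hc : (unitComul Δ).comp unitEmb = unitEmb₂.comp Δ :=
    NonUnitalStarAlgHom.ext fun a => unitComul_unitEmb Δ a
  have e : ((assoc (Unitization ℂ A) (Unitization ℂ A) (Unitization ℂ A) : _ →⋆ₙₐ[ℂ] _).comp
      ((map (unitComul Δ) (NonUnitalStarAlgHom.id ℂ _)).comp (unitComul Δ))) =
      (map (NonUnitalStarAlgHom.id ℂ _) (unitComul Δ)).comp (unitComul Δ) := by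
    refine unit_hom_ext ?_ fun a => ?_
    · simp
    · simp only [NonUnitalStarAlgHom.comp_apply, unitComul_unitEmb]
      have h1 : map (unitComul Δ) (NonUnitalStarAlgHom.id ℂ _) (unitEmb₂ (Δ a)) =
          map (map unitEmb unitEmb) unitEmb (map Δ (NonUnitalStarAlgHom.id ℂ A) (Δ a)) := by
        rw [unitEmb₂, map_map, map_map, hc]
        rfl
      have h2 : map (NonUnitalStarAlgHom.id ℂ _) (unitComul Δ) (unitEmb₂ (Δ a)) =
          map unitEmb (map unitEmb unitEmb) (map (NonUnitalStarAlgHom.id ℂ A) Δ (Δ a)) := by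
        rw [unitEmb₂, map_map, map_map, hc]
        rfl
      rw [h1, h2, ← h]
      exact assoc_map _ _ _ _
  exact DFunLike.congr_fun e x

theorem isStrictlyProperBialgebra_unitComul
    (h : ∀ x, assoc A A A (map Δ (NonUnitalStarAlgHom.id ℂ A) (Δ x)) =
      map (NonUnitalStarAlgHom.id ℂ A) Δ (Δ x)) : IsStrictlyProperBialgebra (unitComul Δ) where
  -- The value at `1` is `1 ⊗ 1`, so every elementary tensor already belongs to the spanning set.
  dense_span := dense_span_of_tmul_mem fun a b => Submodule.le_topologicalClosure _
    (Submodule.subset_span ⟨1, a, b, by rw [unitComul_one, one_tmul_one_mul]⟩)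
  coassoc := ⟨assoc _ _ _, isAssociator_assoc _ _ _, unitComul_coassoc h⟩

theorem unit_eq_smul_one_add (x : Unitization ℂ A) :
    x = x.fst • (1 : Unitization ℂ A) + unitEmb x.snd := by
  ext
  · simp [unitEmb_fst]
  · simp [unitEmb_snd]

theorem isCounit_unitCounit (h : IsCounit Δ ε) : IsCounit (unitComul Δ) (unitCounit ε) := by
  have hc : (unitCounit ε).comp unitEmb = ε :=
    NonUnitalStarAlgHom.ext fun a => unitCounit_unitEmb ε a
  intro x
  constructor
  · have h1 : ∀ a, map (unitCounit ε) (NonUnitalStarAlgHom.id ℂ _) (unitEmb₂ (Δ a)) =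
        tmul 1 (unitEmb a) := fun a => by
      have e : tmul (1 : ℂ) (unitEmb a) = map (NonUnitalStarAlgHom.id ℂ ℂ) unitEmb (tmul 1 a) := by
        rw [map_tmul, NonUnitalStarAlgHom.id_apply_eq]
      rw [unitEmb₂, map_map, hc, e, ← (h a).1, map_map, NonUnitalStarAlgHom.id_comp,
        NonUnitalStarAlgHom.id_comp, NonUnitalStarAlgHom.comp_id]
    have h2 : map (unitCounit ε) (NonUnitalStarAlgHom.id ℂ (Unitization ℂ A)) (tmul 1 1) =
        tmul 1 1 := by
      rw [map_tmul, unitCounit_one, NonUnitalStarAlgHom.id_apply_eq]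
    conv_lhs => rw [unit_eq_smul_one_add x]
    rw [map_add, map_add, map_smul, map_smul, unitComul_one, unitComul_unitEmb, h1, h2,
      ← tmul_smul, ← tmul_add, ← unit_eq_smul_one_add]
  · have h1 : ∀ a, map (NonUnitalStarAlgHom.id ℂ _) (unitCounit ε) (unitEmb₂ (Δ a)) =
        tmul (unitEmb a) 1 := fun a => by
      have e : tmul (unitEmb a) (1 : ℂ) = map unitEmb (NonUnitalStarAlgHom.id ℂ ℂ) (tmul a 1) := by
        rw [map_tmul, NonUnitalStarAlgHom.id_apply_eq]
      rw [unitEmb₂, map_map, hc, e, ← (h a).2, map_map, NonUnitalStarAlgHom.id_comp,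
        NonUnitalStarAlgHom.id_comp, NonUnitalStarAlgHom.comp_id]
    have h2 : map (NonUnitalStarAlgHom.id ℂ (Unitization ℂ A)) (unitCounit ε) (tmul 1 1) =
        tmul 1 1 := by
      rw [map_tmul, unitCounit_one, NonUnitalStarAlgHom.id_apply_eq]
    conv_lhs => rw [unit_eq_smul_one_add x]
    rw [map_add, map_add, map_smul, map_smul, unitComul_one, unitComul_unitEmb, h1, h2,
      ← smul_tmul, ← add_tmul, ← unit_eq_smul_one_add]

/-- The extended comultiplication maps `A` into the image of `A ⊗ A`, where the character with
kernel `A` vanishes on the first leg; only the unit contributes. This is why that character absorbs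
under convolution. -/
theorem map_unitCounit_zero (x : Unitization ℂ A) :
    map (unitCounit (0 : A →⋆ₙₐ[ℂ] ℂ)) (NonUnitalStarAlgHom.id ℂ _) (unitComul Δ x) =
      tmul 1 (unitCounit (0 : A →⋆ₙₐ[ℂ] ℂ) x • (1 : Unitization ℂ A)) := by
  have h0 : ∀ t : A ⊗ᵐ A,
      map (unitCounit (0 : A →⋆ₙₐ[ℂ] ℂ)) (NonUnitalStarAlgHom.id ℂ _) (unitEmb₂ t) = 0 := fun t => by
    rw [unitEmb₂, map_map]
    refine induction (P := fun t => map _ _ t = 0) (isClosed_eq (map_continuous _) continuous_const)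
      (fun s t hs ht => by rw [map_add, hs, ht, add_zero]) (fun a b => ?_) t
    rw [map_tmul, NonUnitalStarAlgHom.comp_apply, unitCounit_unitEmb]
    exact zero_tmul _
  have h1 : map (unitCounit (0 : A →⋆ₙₐ[ℂ] ℂ)) (NonUnitalStarAlgHom.id ℂ (Unitization ℂ A))
      (tmul 1 1) = tmul 1 1 := by
    rw [map_tmul, unitCounit_one, NonUnitalStarAlgHom.id_apply_eq]
  have h2 : unitCounit (0 : A →⋆ₙₐ[ℂ] ℂ) x = x.fst := by
    rw [unitCounit, unitLift_apply]
    simp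
  conv_lhs => rw [unit_eq_smul_one_add x]
  rw [map_add, map_add, map_smul, map_smul, unitComul_one, unitComul_unitEmb, h0, h1, h2,
    add_zero, tmul_smul]

/-- A dense subbialgebra of the unitization of a nonunital counital bialgebra has no antipode: the
character with kernel `A` is an absorbing element of the convolution monoid. -/
theorem not_exists_isAntipode (hA : SeparatedByReps A) (hε : ∃ a, ε a ≠ 0)
    (S : Subalgebra ℂ (Unitization ℂ A)) (δ : S →ₗ[ℂ] S ⊗[ℂ] S)
    (hS : Dense (S : Set (Unitization ℂ A))) (hδ : IsSubbialgebra (unitComul Δ) S δ) :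
    ¬ ∃ T : S →ₗ[ℂ] S, IsAntipode (unitCounit ε) S δ T := by
  rintro ⟨T, hT⟩
  let ω : Unitization ℂ A →⋆ₙₐ[ℂ] ℂ := unitCounit (0 : A →⋆ₙₐ[ℂ] ℂ)
  let ωS : S →ₗ[ℂ] ℂ :=
    { toFun := fun s => ω s
      map_add' := fun s t => map_add ω (s : Unitization ℂ A) t
      map_smul' := fun c s => map_smul ω c (s : Unitization ℂ A) }
  let r : S ⊗[ℂ] S →ₗ[ℂ] S :=
    (TensorProduct.lid ℂ S).toLinearMap ∘ₗ TensorProduct.map ωS LinearMap.id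
  -- `r` is the algebraic form of `ω ⊗ id` on `S ⊙ S`; the next two facts translate the absorbing
  -- property of `ω` from the completed tensor product to `r ∘ δ`.
  have hmap : ∀ t : S ⊗[ℂ] S, map ω (NonUnitalStarAlgHom.id ℂ _)
      (ofAlg (TensorProduct.map S.val.toLinearMap S.val.toLinearMap t)) =
        tmul (1 : ℂ) (r t : Unitization ℂ A) := fun t => by
    induction t with
    | zero => simp
    | add s t hs ht =>
      rw [map_add, map_add, map_add, hs, ht, map_add, ← tmul_add]
      rfl
    | tmul s t =>
      have h1 : map ω (NonUnitalStarAlgHom.id ℂ _)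
          (tmul (s : Unitization ℂ A) (t : Unitization ℂ A)) =
            tmul (ω s) (t : Unitization ℂ A) := map_tmul _ _ _ _
      have h2 : ω s = ω s • (1 : ℂ) := by simp
      refine h1.trans ?_
      rw [h2, smul_tmul, ← tmul_smul]
      rfl
  have hr : ∀ s : S, r (δ s) = ω s • (1 : S) := fun s => by
    have h1 := hmap (δ s)
    rw [hδ s, map_unitCounit_zero] at h1
    have h2 : tmul (1 : ℂ) ((r (δ s) : Unitization ℂ A) - ω s • (1 : Unitization ℂ A)) = 0 := by
      rw [← tmulBilin_apply, map_sub, tmulBilin_apply, tmulBilin_apply, ← h1, sub_self]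
    exact Subtype.ext (sub_eq_zero.1 (eq_zero_of_one_tmul hA.unitization h2))
  -- Multiplicativity of `ω` moves it past the product: `ω(s T(t)) = ω(T(ω(s) t))`.
  have hω : ∀ t : S ⊗[ℂ] S,
      ωS (LinearMap.mul' ℂ S (TensorProduct.map LinearMap.id T t)) = ωS (T (r t)) := fun t => by
    induction t with
    | zero => simp
    | add s t hs ht => simp only [map_add, hs, ht]
    | tmul s t =>
      have h1 : ωS (s * T t) = ωS s * ωS (T t) :=
        map_mul ω (s : Unitization ℂ A) (T t : Unitization ℂ A)
      have h2 : r (s ⊗ₜ t) = ωS s • t := rfl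
      simp [h1, h2]
  have hωc : ∀ c : ℂ, ωS (algebraMap ℂ S c) = c := fun c => by
    have h1 : ωS 1 = 1 := unitCounit_one _
    rw [Algebra.algebraMap_eq_smul_one, map_smul, h1, smul_eq_mul, mul_one]
  -- Applying `ω` to the left antipode equation and using `r (δ s) = ω(s) 1` gives this formula; at
  -- `s = 1` it forces `ω(T 1) = 1`.
  have hmain : ∀ s : S, unitCounit ε s = ω s * ωS (T 1) := fun s => by
    rw [← hωc (unitCounit ε s), ← (hT s).1, hω, hr, map_smul, map_smul, smul_eq_mul]
  have hone : ωS (T 1) = 1 := by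
    have h1 := hmain 1
    have h2 : ω ((1 : S) : Unitization ℂ A) = 1 := unitCounit_one _
    have h3 : unitCounit ε ((1 : S) : Unitization ℂ A) = 1 := unitCounit_one _
    rw [h2, h3, one_mul] at h1
    exact h1.symm
  -- The counit and `ω` agree on `S`, hence everywhere by density, although `ω` vanishes on `A` and
  -- the counit does not.
  have heq : ∀ x, unitCounit ε x = ω x := fun x => by
    refine hS.induction (P := fun x => unitCounit ε x = ω x) (fun s hs => ?_)
      (isClosed_eq (map_continuous _) (map_continuous _)) x
    rw [hmain ⟨s, hs⟩, hone, mul_one]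
  obtain ⟨a, ha⟩ := hε
  apply ha
  rw [← unitCounit_unitEmb, heq]
  exact unitCounit_unitEmb 0 a

end UnitizedBialgebra

open MinTensor

/-! ### Elementary properties of full group C*-algebras -/

namespace GroupCStar

variable {G : Type} [Group G]

theorem ofAlg_single (g : G) (c : ℂ) : ofAlg (MonoidAlgebra.single g c) = c • u g := by
  rw [u, ← map_smul]
  simp

theorem induction {P : GroupCStar G → Prop} (hc : IsClosed {x | P x})
    (hadd : ∀ x y, P x → P y → P (x + y)) (hsmul : ∀ (c : ℂ) x, P x → P (c • x))
    (h : ∀ g, P (u g)) (x : GroupCStar G) : P x := by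
  refine denseRange_ofAlg.induction_on x hc fun y => ?_
  induction y using MonoidAlgebra.induction_linear with
  | zero =>
    rw [map_zero, ← zero_smul ℂ (u (1 : G))]
    exact hsmul _ _ (h 1)
  | add y z hy hz => rw [map_add]; exact hadd _ _ hy hz
  | single g c => rw [ofAlg_single]; exact hsmul _ _ (h g)

theorem one_mul (x : GroupCStar G) : u 1 * x = x :=
  induction (P := fun x => u 1 * x = x) (isClosed_eq (by fun_prop) (by fun_prop))
    (fun x y hx hy => by rw [mul_add, hx, hy]) (fun c x hx => by rw [mul_smul_comm, hx])
    (fun g => by rw [← u_mul, _root_.one_mul]) x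

theorem mul_one (x : GroupCStar G) : x * u 1 = x :=
  induction (P := fun x => x * u 1 = x) (isClosed_eq (by fun_prop) (by fun_prop))
    (fun x y hx hy => by rw [add_mul, hx, hy]) (fun c x hx => by rw [smul_mul_assoc, hx])
    (fun g => by rw [← u_mul, _root_.mul_one]) x

theorem star_one : star (u (1 : G)) = u 1 := by rw [← u_inv, inv_one]

/-- The character of `C*(G)` given by a character of `G`. -/
def char (χ : G →* Circle) : GroupCStar G →⋆ₙₐ[ℂ] ℂ :=
  CStarSeminorm.Completion.lift (fullSeminorm G)
    (groupAlgLift (fun g => (χ g : ℂ)) (fun g h => by simp)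
      (fun g => by rw [map_inv, Circle.coe_inv_eq_conj]; rfl)) fun x => by
    -- The character, viewed as a representation on the one-dimensional space, is one of those over
    -- which the universal norm takes its supremum.
    refine le_trans ?_ (HilbertRep.le_seminorm_val (fun π : HilbertRep (MonoidAlgebra ℂ G) => π)
      bddAbove_groupAlg (HilbertRep.scalar.comap (groupAlgLift (fun g => (χ g : ℂ))
        (fun g h => by simp) (fun g => by rw [map_inv, Circle.coe_inv_eq_conj]; rfl))) x)
    have h : ∀ c : ℂ, ‖c‖ = ‖HilbertRep.scalar.hom c‖ := fun c => by
      have : ‖c • (1 : ℂ →L[ℂ] ℂ)‖ = ‖c‖ := by simp [norm_smul]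
      exact this.symm
    exact (h _).le

@[simp]
theorem char_u (χ : G →* Circle) (g : G) : char χ (u g) = χ g := by
  refine (CStarSeminorm.Completion.lift_of (fullSeminorm G) _ _ _).trans ?_
  exact (groupAlgLift_single _ _ _ g 1).trans (one_smul ℂ _)

end GroupCStar

/-! ### The comultiplication and the counit -/

section FreeComul

/-- Orthogonality in a single leg already makes the products of elementary tensors vanish, and this
extends by bilinearity and continuity. -/
theorem MinTensor.map_mul_map_eq_zero {A A' B B' C D : Type} [NonUnitalCStarAlgebra A]
    [NonUnitalCStarAlgebra A'] [NonUnitalCStarAlgebra B] [NonUnitalCStarAlgebra B']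
    [NonUnitalCStarAlgebra C] [NonUnitalCStarAlgebra D] {f : A →⋆ₙₐ[ℂ] C} {f' : A' →⋆ₙₐ[ℂ] C}
    {g : B →⋆ₙₐ[ℂ] D} {g' : B' →⋆ₙₐ[ℂ] D}
    (h : (∀ a a', f a * f' a' = 0) ∨ ∀ b b', g b * g' b' = 0) (s : A ⊗ᵐ B) (t : A' ⊗ᵐ B') :
    map f g s * map f' g' t = 0 := by
  refine induction₂ (P := fun s t => map f g s * map f' g' t = 0)
    (fun s => isClosed_eq (continuous_const.mul (map_continuous _)) continuous_const)
    (fun s => isClosed_eq ((map_continuous _).mul continuous_const) continuous_const)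
    (fun s s' t h h' => ?_) (fun s t t' h h' => ?_) (fun a b a' b' => ?_) s t
  · rw [map_add, add_mul, h, h', add_zero]
  · rw [map_add, mul_add, h, h', add_zero]
  · rw [map_tmul, map_tmul, tmul_mul_tmul]
    rcases h with h | h
    · rw [h, zero_tmul]
    · rw [h, tmul_zero]

theorem map_c0Incl_mul_of_ne {ι κ : Type} [DecidableEq ι] [DecidableEq κ] {E : ι → Type}
    {E' : κ → Type} [∀ i, NonUnitalCStarAlgebra (E i)] [∀ i, NonUnitalCStarAlgebra (E' i)]
    {i j : ι} {k l : κ} (h : i ≠ j ∨ k ≠ l) (s : E i ⊗ᵐ E' k) (t : E j ⊗ᵐ E' l) :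
    map (c0Incl i) (c0Incl k) s * map (c0Incl j) (c0Incl l) t = 0 :=
  map_mul_map_eq_zero (h.imp c0Incl_mul_of_ne c0Incl_mul_of_ne) s t

/-- The component `φ_{m,l}` of the comultiplication, with values in the tensor square of the direct
sum. -/
def freeComulPart (n : ℕ+) (p : {p : ℕ+ × ℕ+ // p.1 * p.2 = n}) :
    FreeCStar n →⋆ₙₐ[ℂ] FreeSum ⊗ᵐ FreeSum :=
  (map (freeIncl p.1.1) (freeIncl p.1.2)).comp (phi p.2)

theorem freeComulPart_mul_of_ne {n n' : ℕ+} (p : {p : ℕ+ × ℕ+ // p.1 * p.2 = n})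
    (q : {p : ℕ+ × ℕ+ // p.1 * p.2 = n'}) (h : p.1 ≠ q.1) (x : FreeCStar n) (y : FreeCStar n') :
    freeComulPart n p x * freeComulPart n' q y = 0 := by
  refine map_c0Incl_mul_of_ne (E := FreeCStar) (E' := FreeCStar) ?_ _ _
  by_contra hc
  push Not at hc
  exact h (Prod.ext hc.1 hc.2)

/-- The restriction of the comultiplication to a summand. -/
def freeComulSummand (n : ℕ+) : FreeCStar n →⋆ₙₐ[ℂ] FreeSum ⊗ᵐ FreeSum :=
  sumHom Finset.univ (freeComulPart n) fun p q h x y =>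
    freeComulPart_mul_of_ne p q (fun e => h (Subtype.ext e)) x y

theorem freeComulSummand_apply (n : ℕ+) (x : FreeCStar n) :
    freeComulSummand n x = ∑ p, freeComulPart n p x := rfl

/-- The comultiplication of the direct sum of the free group C*-algebras. -/
def freeComul : FreeSum →⋆ₙₐ[ℂ] FreeSum ⊗ᵐ FreeSum :=
  c0Lift freeComulSummand fun n n' h x y => by
    rw [freeComulSummand_apply, freeComulSummand_apply, Finset.sum_mul_sum]
    refine Finset.sum_eq_zero fun p _ => Finset.sum_eq_zero fun q _ => ?_
    -- Equal pairs of factors would have equal products, contrary to `n ≠ n'`.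
    refine freeComulPart_mul_of_ne p q (fun e => h ?_) x y
    rw [← p.2, ← q.2, e]

theorem freeComul_incl (n : ℕ+) (x : FreeCStar n) : freeComul (freeIncl n x) =
    ∑ p : {p : ℕ+ × ℕ+ // p.1 * p.2 = n}, map (freeIncl p.1.1) (freeIncl p.1.2) (phi p.2 x) :=
  c0Lift_incl freeComulSummand _ n x

theorem freeComul_u (n : ℕ+) (g : FreeGroup (Fin n)) : freeComul (freeIncl n (GroupCStar.u g)) =
    ∑ p : {p : ℕ+ × ℕ+ // p.1 * p.2 = n},
      tmul (freeIncl p.1.1 (GroupCStar.u (FreeGroup.map (idxDiv p.2) g)))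
        (freeIncl p.1.2 (GroupCStar.u (FreeGroup.map (fun k : Fin n => idxMod p.1.2 k) g))) := by
  rw [freeComul_incl]
  refine Finset.sum_congr rfl fun p _ => ?_
  rw [phi, GroupCStar.comul_u, map_tmul]

theorem freeSum_induction {P : FreeSum → Prop} (hc : IsClosed {x | P x})
    (hadd : ∀ x y, P x → P y → P (x + y)) (hsmul : ∀ (c : ℂ) x, P x → P (c • x))
    (h : ∀ n g, P (freeIncl n (GroupCStar.u g))) (x : FreeSum) : P x := by
  refine c0_induction hc hadd ?_ (fun n a => ?_) x
  · rw [← zero_smul ℂ (freeIncl 1 (GroupCStar.u 1))]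
    exact hsmul _ _ (h _ _)
  · refine GroupCStar.induction (P := fun a => P (freeIncl n a)) ?_ (fun x y hx hy => ?_)
      (fun c x hx => ?_) (h n) a
    · exact hc.preimage (map_continuous (freeIncl n))
    · rw [map_add]; exact hadd _ _ hx hy
    · rw [map_smul]; exact hsmul _ _ hx

theorem freeSum_hom_ext {D : Type*} [NonUnitalCStarAlgebra D] {f g : FreeSum →⋆ₙₐ[ℂ] D}
    (h : ∀ n x, f (freeIncl n (GroupCStar.u x)) = g (freeIncl n (GroupCStar.u x))) : f = g := by
  ext x
  exact freeSum_induction (P := fun x => f x = g x)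
    (isClosed_eq (map_continuous f) (map_continuous g))
    (fun x y hx hy => by rw [map_add, map_add, hx, hy])
    (fun c x hx => by rw [map_smul, map_smul, hx]) h x

/-- The two ways to write an index as a product of three factors. -/
def factorizationEquiv (n : ℕ+) :
    (Σ p : {p : ℕ+ × ℕ+ // p.1 * p.2 = n}, {q : ℕ+ × ℕ+ // q.1 * q.2 = p.1.1}) ≃
      (Σ p : {p : ℕ+ × ℕ+ // p.1 * p.2 = n}, {q : ℕ+ × ℕ+ // q.1 * q.2 = p.1.2}) where
  toFun x := ⟨⟨(x.2.1.1, x.2.1.2 * x.1.1.2), by rw [← mul_assoc, x.2.2, x.1.2]⟩,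
    ⟨(x.2.1.2, x.1.1.2), rfl⟩⟩
  invFun x := ⟨⟨(x.1.1.1 * x.2.1.1, x.2.1.2), by rw [mul_assoc, x.2.2, x.1.2]⟩,
    ⟨(x.1.1.1, x.2.1.1), rfl⟩⟩
  left_inv := by
    rintro ⟨⟨⟨m, l⟩, h⟩, ⟨⟨j, k⟩, h'⟩⟩
    dsimp only at h'
    subst h'
    rfl
  right_inv := by
    rintro ⟨⟨⟨m, l⟩, h⟩, ⟨⟨j, k⟩, h'⟩⟩
    dsimp only at h'
    subst h'
    rfl

/-- The leading digit of an index with respect to the factors `j, k, l`. The two lemmas that follow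
treat the middle and the last digit. -/
theorem idxDiv_idxDiv {n m l j k : ℕ+} (h : m * l = n) (h' : j * k = m) (h'' : j * (k * l) = n)
    (g : FreeGroup (Fin n)) : FreeGroup.map (idxDiv h') (FreeGroup.map (idxDiv h) g) =
      FreeGroup.map (idxDiv h'') g := by
  rw [FreeGroup.map.comp]
  congr 2
  funext x
  refine Fin.ext ?_
  change (x : ℕ) / l / k = x / ((k * l : ℕ+) : ℕ)
  rw [PNat.mul_coe, Nat.div_div_eq_div_mul, mul_comm]

theorem idxMod_idxDiv {n m l k : ℕ+} (h : m * l = n) (g : FreeGroup (Fin n)) :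
    FreeGroup.map (fun x : Fin m => idxMod k x) (FreeGroup.map (idxDiv h) g) =
      FreeGroup.map (idxDiv (rfl : k * l = k * l))
        (FreeGroup.map (fun x : Fin n => idxMod (k * l) x) g) := by
  rw [FreeGroup.map.comp, FreeGroup.map.comp]
  congr 2
  funext x
  refine Fin.ext ?_
  change (x : ℕ) / l % k = x % ((k * l : ℕ+) : ℕ) / l
  rw [PNat.mul_coe, Nat.mod_mul_left_div_self]

theorem idxMod_idxMod {n l k : ℕ+} (g : FreeGroup (Fin n)) :
    FreeGroup.map (fun x : Fin (k * l : ℕ+) => idxMod l x)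
      (FreeGroup.map (fun x : Fin n => idxMod (k * l) x) g) =
        FreeGroup.map (fun x : Fin n => idxMod l x) g := by
  rw [FreeGroup.map.comp]
  congr 2
  funext x
  refine Fin.ext ?_
  change (x : ℕ) % ((k * l : ℕ+) : ℕ) % l = x % l
  rw [PNat.mul_coe, Nat.mod_mul_left_mod]

theorem tmul_idx_assoc {n m l j k : ℕ+} (h : m * l = n) (h' : j * k = m) (h'' : j * (k * l) = n)
    (g : FreeGroup (Fin n)) :
    tmul (freeIncl j (GroupCStar.u (FreeGroup.map (idxDiv h') (FreeGroup.map (idxDiv h) g))))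
      (tmul (freeIncl k (GroupCStar.u (FreeGroup.map (fun x : Fin m => idxMod k x)
          (FreeGroup.map (idxDiv h) g))))
        (freeIncl l (GroupCStar.u (FreeGroup.map (fun x : Fin n => idxMod l x) g)))) =
    tmul (freeIncl j (GroupCStar.u (FreeGroup.map (idxDiv h'') g)))
      (tmul (freeIncl k (GroupCStar.u (FreeGroup.map (idxDiv (rfl : k * l = k * l))
          (FreeGroup.map (fun x : Fin n => idxMod (k * l) x) g))))
        (freeIncl l (GroupCStar.u (FreeGroup.map (fun x : Fin (k * l : ℕ+) => idxMod l x)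
          (FreeGroup.map (fun x : Fin n => idxMod (k * l) x) g))))) := by
  rw [idxDiv_idxDiv h h' h'', idxMod_idxDiv h, idxMod_idxMod]

/-- On a group element both sides are sums over triples of factors of `n`, bracketed differently.
`factorizationEquiv` matches the index sets, and `tmul_idx_assoc` matches the summands digit by
digit. -/
theorem freeComul_coassoc (x : FreeSum) :
    assoc _ _ _ (map freeComul (NonUnitalStarAlgHom.id ℂ _) (freeComul x)) =
      map (NonUnitalStarAlgHom.id ℂ _) freeComul (freeComul x) := by
  have e : ((assoc FreeSum FreeSum FreeSum : _ →⋆ₙₐ[ℂ] _).comp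
      ((map freeComul (NonUnitalStarAlgHom.id ℂ _)).comp freeComul)) =
      (map (NonUnitalStarAlgHom.id ℂ _) freeComul).comp freeComul := by
    refine freeSum_hom_ext fun n g => ?_
    change assoc _ _ _ (map freeComul (NonUnitalStarAlgHom.id ℂ _) (freeComul _)) =
      map (NonUnitalStarAlgHom.id ℂ _) freeComul (freeComul _)
    simp only [freeComul_u, map_sum, map_tmul, NonUnitalStarAlgHom.id_apply_eq, sum_tmul, tmul_sum,
      assoc_tmul]
    rw [← Fintype.sum_sigma', ← Fintype.sum_sigma']
    refine Fintype.sum_equiv (factorizationEquiv n) _ _ ?_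
    rintro ⟨⟨⟨m, l⟩, h⟩, ⟨⟨j, k⟩, h'⟩⟩
    exact tmul_idx_assoc h h' ((mul_assoc j k l).symm.trans (h' ▸ h)) g
  exact DFunLike.congr_fun e x

/-- Among the factorizations of `k * l` only `(k, l)` has second factor `l`, by cancellation; the
other terms are orthogonal in the second leg. -/
theorem freeComul_mul_tmul (k l : ℕ+) (g : FreeGroup (Fin (k * l : ℕ+))) (x : FreeCStar k)
    (y : FreeCStar l) :
    freeComul (freeIncl (k * l) (GroupCStar.u g)) * tmul (freeIncl k x) (freeIncl l y) =
      tmul (freeIncl k (GroupCStar.u (FreeGroup.map (idxDiv rfl) g) * x))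
        (freeIncl l (GroupCStar.u
          (FreeGroup.map (fun i : Fin (k * l : ℕ+) => idxMod l i) g) * y)) := by
  rw [freeComul_u, Finset.sum_mul, Fintype.sum_eq_single ⟨(k, l), rfl⟩]
  · rw [tmul_mul_tmul, ← map_mul, ← map_mul]
  · rintro ⟨⟨k', l'⟩, h⟩ hne
    have hl : l' ≠ l := by
      rintro rfl
      exact hne (Subtype.ext (Prod.ext (mul_right_cancel h) rfl))
    rw [tmul_mul_tmul, c0Incl_mul_of_ne (E := FreeCStar) hl, tmul_zero]

theorem freeComul_one_mul_tmul (k l : ℕ+) (x : FreeCStar k) (y : FreeCStar l) :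
    freeComul (freeIncl (k * l) (GroupCStar.u 1)) * tmul (freeIncl k x) (freeIncl l y) =
      tmul (freeIncl k x) (freeIncl l y) := by
  rw [freeComul_mul_tmul, map_one, map_one, GroupCStar.one_mul, GroupCStar.one_mul]

/-- The density principle for separately continuous bilinear maps. It is stated for general `f` so
as to apply both to the elementary tensor and to its image in the tensor square of the unitization.
-/
theorem freeSum_tmul_mem {V : Type*} [AddCommGroup V] [Module ℂ V] [TopologicalSpace V]
    [ContinuousAdd V] [ContinuousConstSMul ℂ V] (S : Submodule ℂ V)
    (f : FreeSum →ₗ[ℂ] FreeSum →ₗ[ℂ] V) (hf : ∀ x, Continuous (f x))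
    (hf' : ∀ y, Continuous fun x => f x y)
    (h : ∀ m l g k, f (freeIncl m (GroupCStar.u g)) (freeIncl l (GroupCStar.u k)) ∈
      S.topologicalClosure) (x y : FreeSum) : f x y ∈ S.topologicalClosure := by
  have hc := S.isClosed_topologicalClosure
  refine freeSum_induction (P := fun x => f x y ∈ S.topologicalClosure) (hc.preimage (hf' y))
    (fun x x' hx hx' => ?_) (fun c x hx => ?_) (fun m g => ?_) x
  · rw [map_add]; exact add_mem hx hx'
  · rw [map_smul]; exact Submodule.smul_mem _ c hx
  refine freeSum_induction (P := fun y => f _ y ∈ S.topologicalClosure) (hc.preimage (hf _))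
    (fun x x' hx hx' => ?_) (fun c x hx => ?_) (fun l k => h m l g k) y
  · rw [map_add]; exact add_mem hx hx'
  · rw [map_smul]; exact Submodule.smul_mem _ c hx

theorem isStrictlyProperBialgebra_freeComul : IsStrictlyProperBialgebra freeComul where
  dense_span := dense_span_of_tmul_mem <| freeSum_tmul_mem _ (tmulBilin _ _)
    (fun x => show Continuous fun y => tmul x y by fun_prop)
    (fun y => show Continuous fun x => tmul x y by fun_prop) fun m l g k => by
      -- The comultiplication of the unit of the summand `m * l` acts as the identity on the block
      -- `(m, l)`.
      exact Submodule.le_topologicalClosure _ (Submodule.subset_span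
        ⟨_, _, _, (freeComul_one_mul_tmul m l _ _).symm⟩)
  coassoc := ⟨assoc _ _ _, isAssociator_assoc _ _ _, freeComul_coassoc⟩

/-- The character of the direct sum given by a character of the group `F_n`. -/
def freeChar (n : ℕ+) (χ : FreeGroup (Fin n) →* Circle) : FreeSum →⋆ₙₐ[ℂ] ℂ :=
  (GroupCStar.char χ).comp (c0Proj FreeCStar n)

theorem freeChar_incl_u {n : ℕ+} (χ : FreeGroup (Fin n) →* Circle) (g : FreeGroup (Fin n)) :
    freeChar n χ (freeIncl n (GroupCStar.u g)) = χ g := by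
  rw [freeChar, NonUnitalStarAlgHom.comp_apply, c0Proj_incl_self, GroupCStar.char_u]

theorem freeChar_of_ne {n k : ℕ+} (χ : FreeGroup (Fin n) →* Circle) (h : k ≠ n)
    (x : FreeCStar k) : freeChar n χ (freeIncl k x) = 0 := by
  rw [freeChar, NonUnitalStarAlgHom.comp_apply, c0Proj_incl_of_ne h.symm, map_zero]

/-- The counit of the direct sum of the free group C*-algebras. -/
def freeCounit : FreeSum →⋆ₙₐ[ℂ] ℂ := freeChar 1 1

theorem freeCounit_one (g : FreeGroup (Fin (1 : ℕ+))) :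
    freeCounit (freeIncl 1 (GroupCStar.u g)) = 1 :=
  (freeChar_incl_u 1 g).trans Circle.coe_one

theorem freeCounit_of_ne {n : ℕ+} (h : n ≠ 1) (x : FreeCStar n) :
    freeCounit (freeIncl n x) = 0 := freeChar_of_ne 1 h x

theorem isCounit_freeCounit : IsCounit freeComul freeCounit := by
  intro a
  constructor
  · refine freeSum_induction (P := fun a => map freeCounit (NonUnitalStarAlgHom.id ℂ _)
      (freeComul a) = tmul 1 a) (isClosed_eq ((map_continuous _).comp (map_continuous freeComul))
        (by fun_prop)) (fun x y hx hy => ?_) (fun c x hx => ?_) (fun n g => ?_) a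
    · rw [map_add, map_add, hx, hy, tmul_add]
    · rw [map_smul, map_smul, hx, tmul_smul]
    -- The counit kills every term except the one whose first factor is `1`; there the remainder
    -- modulo `n` does not change an index below `n`.
    · rw [freeComul_u, map_sum, Fintype.sum_eq_single ⟨(1, n), one_mul n⟩]
      · dsimp only
        rw [map_tmul, freeCounit_one, NonUnitalStarAlgHom.id_apply_eq]
        congr 3
        have : (fun k : Fin n => idxMod n k) = id := by
          funext k
          exact Fin.ext (Nat.mod_eq_of_lt k.2)
        rw [this, FreeGroup.map.id]
      · rintro ⟨⟨m, l⟩, h⟩ hne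
        dsimp only at h ⊢
        rw [map_tmul, freeCounit_of_ne, zero_tmul]
        rintro rfl
        exact hne (Subtype.ext (Prod.ext rfl ((one_mul l).symm.trans h)))
  · refine freeSum_induction (P := fun a => map (NonUnitalStarAlgHom.id ℂ _) freeCounit
      (freeComul a) = tmul a 1) (isClosed_eq ((map_continuous _).comp (map_continuous freeComul))
        (by fun_prop)) (fun x y hx hy => ?_) (fun c x hx => ?_) (fun n g => ?_) a
    · rw [map_add, map_add, hx, hy, add_tmul]
    · rw [map_smul, map_smul, hx, smul_tmul]
    -- Symmetrically, only the term with second factor `1` survives, and division by `1` does not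
    -- change the index.
    · rw [freeComul_u, map_sum, Fintype.sum_eq_single ⟨(n, 1), mul_one n⟩]
      · dsimp only
        rw [map_tmul, freeCounit_one, NonUnitalStarAlgHom.id_apply_eq]
        congr 3
        have : idxDiv (mul_one n) = id := by
          funext k
          exact Fin.ext (Nat.div_one k)
        rw [this, FreeGroup.map.id]
      · rintro ⟨⟨m, l⟩, h⟩ hne
        dsimp only at h ⊢
        rw [map_tmul, freeCounit_of_ne, tmul_zero]
        rintro rfl
        exact hne (Subtype.ext (Prod.ext ((mul_one m).symm.trans h) rfl))

/-- The index `1` below `4 = 2 * 2` has quotient `0` and remainder `1`, so the `(2, 2)` component at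
this generator is `g_0 ⊗ g_1`. A character of `F_2` with different values at `g_0` and `g_1`, paired
with the trivial one, tells it from its flip. -/
theorem not_isCocommutative_freeComul : ¬ IsCocommutative freeComul := by
  intro hcc
  have h22 : (2 : ℕ+) * 2 = 4 := rfl
  let g : FreeGroup (Fin (4 : ℕ+)) := FreeGroup.of ⟨1, by decide⟩
  have h1 := hcc (flip _ _) (fun a b => flip_tmul a b) (freeIncl 4 (GroupCStar.u g))
  let χ : FreeGroup (Fin (2 : ℕ+)) →* Circle :=
    FreeGroup.lift fun k => if (k : ℕ) = 0 then 1 else -1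
  have hne : ∀ (p : {p : ℕ+ × ℕ+ // p.1 * p.2 = 4}), p ≠ ⟨(2, 2), h22⟩ →
      p.1.1 ≠ 2 ∨ p.1.2 ≠ 2 := fun p hp => by
    by_contra hc
    push Not at hc
    exact hp (Subtype.ext (Prod.ext hc.1 hc.2))
  have h2 := congrArg (map (freeChar 2 χ) (freeChar 2 1)) h1
  rw [freeComul_u, map_sum, map_sum, map_sum, Fintype.sum_eq_single ⟨(2, 2), h22⟩,
    Fintype.sum_eq_single ⟨(2, 2), h22⟩, flip_tmul, map_tmul, map_tmul, freeChar_incl_u,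
    freeChar_incl_u, freeChar_incl_u, freeChar_incl_u] at h2
  · have e1 : χ (FreeGroup.map (fun k : Fin (4 : ℕ+) => idxMod 2 k) g) = -1 := by
      rw [FreeGroup.map.of, FreeGroup.lift_apply_of]
      exact if_neg (by decide)
    have e2 : χ (FreeGroup.map (idxDiv h22) g) = 1 := by
      rw [FreeGroup.map.of, FreeGroup.lift_apply_of]
      exact if_pos (show 1 / ((2 : ℕ+) : ℕ) = 0 from rfl)
    have h3 : tmul ((χ (FreeGroup.map (fun k : Fin (4 : ℕ+) => idxMod 2 k) g) : Circle) : ℂ)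
        (1 : ℂ) = tmul ((χ (FreeGroup.map (idxDiv h22) g) : Circle) : ℂ) (1 : ℂ) := h2
    rw [e1, e2, Circle.coe_neg, Circle.coe_one] at h3
    -- From `(-1) ⊗ 1 = 1 ⊗ 1` it follows that `1 ⊗ 2 = 0` in `ℂ ⊗ ℂ`, which is impossible.
    have h4 : tmul (1 : ℂ) (2 : ℂ) = 0 := by
      rw [show (2 : ℂ) = 1 + 1 by norm_num, tmul_add]
      nth_rw 1 [← h3]
      rw [← add_tmul, neg_add_cancel, zero_tmul]
    exact two_ne_zero (eq_zero_of_one_tmul separatedByReps_complex h4)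
  · intro p hp
    rw [map_tmul]
    rcases hne p hp with h | h
    · rw [freeChar_of_ne _ h, zero_tmul]
    · rw [freeChar_of_ne _ h, tmul_zero]
  · intro p hp
    rw [flip_tmul, map_tmul]
    rcases hne p hp with h | h
    · rw [freeChar_of_ne _ h, tmul_zero]
    · rw [freeChar_of_ne _ h, zero_tmul]

end FreeComul

/-! ### The cancellation law -/

section Cancellation

@[simp]
theorem unitEmb₂_tmul {A : Type} [NonUnitalCStarAlgebra A] (a b : A) :
    unitEmb₂ (tmul a b) = tmul (unitEmb a) (unitEmb b) := map_tmul _ _ a b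

theorem unitEmb₂_mul_one_tmul_mem {A : Type} [NonUnitalCStarAlgebra A] (t : A ⊗ᵐ A) (b : A) :
    unitEmb₂ t * tmul 1 (unitEmb b) ∈ Set.range (unitEmb₂ (A := A)) := by
  refine MinTensor.induction
    (P := fun t => unitEmb₂ t * tmul 1 (unitEmb b) ∈ Set.range (unitEmb₂ (A := A)))
    (isClosed_range_unitEmb₂.preimage (show Continuous fun t => _ * _ from
      (map_continuous unitEmb₂).mul continuous_const)) ?_ ?_ t
  · rintro s t ⟨s', hs⟩ ⟨t', ht⟩
    exact ⟨s' + t', by rw [map_add, map_add, add_mul, hs, ht]⟩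
  · intro a a'
    exact ⟨tmul a (a' * b), by
      rw [unitEmb₂_tmul, unitEmb₂_tmul, tmul_mul_tmul, mul_one, map_mul]⟩

theorem unitEmb₂_mul_tmul_one_mem {A : Type} [NonUnitalCStarAlgebra A] (t : A ⊗ᵐ A) (b : A) :
    unitEmb₂ t * tmul (unitEmb b) 1 ∈ Set.range (unitEmb₂ (A := A)) := by
  refine MinTensor.induction
    (P := fun t => unitEmb₂ t * tmul (unitEmb b) 1 ∈ Set.range (unitEmb₂ (A := A)))
    (isClosed_range_unitEmb₂.preimage (show Continuous fun t => _ * _ from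
      (map_continuous unitEmb₂).mul continuous_const)) ?_ ?_ t
  · rintro s t ⟨s', hs⟩ ⟨t', ht⟩
    exact ⟨s' + t', by rw [map_add, map_add, add_mul, hs, ht]⟩
  · intro a a'
    exact ⟨tmul (a * b) a', by
      rw [unitEmb₂_tmul, unitEmb₂_tmul, tmul_mul_tmul, mul_one, map_mul]⟩

/-- One inclusion holds because the range is a closed subspace, the other because the tensors of
canonical unitaries are total in it. Both halves of the cancellation law reduce to this. -/
theorem closure_span_eq_range_unitEmb₂
    {X : Set (Unitization ℂ FreeSum ⊗ᵐ Unitization ℂ FreeSum)}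
    (hX : X ⊆ Set.range (unitEmb₂ (A := FreeSum)))
    (h : ∀ m l g k, tmul (unitEmb (freeIncl m (GroupCStar.u g)))
      (unitEmb (freeIncl l (GroupCStar.u k))) ∈ X) :
    closure (Submodule.span ℂ X : Set (Unitization ℂ FreeSum ⊗ᵐ Unitization ℂ FreeSum)) =
      Set.range (unitEmb₂ (A := FreeSum)) := by
  let φ : FreeSum ⊗ᵐ FreeSum →ₗ[ℂ] Unitization ℂ FreeSum ⊗ᵐ Unitization ℂ FreeSum :=
    { toFun := unitEmb₂, map_add' := map_add _, map_smul' := map_smul _ }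
  have hφ : Continuous φ := map_continuous unitEmb₂
  apply Set.Subset.antisymm
  · refine closure_minimal ?_ isClosed_range_unitEmb₂
    have : Submodule.span ℂ X ≤ LinearMap.range φ := Submodule.span_le.2 hX
    exact this
  · rintro _ ⟨t, rfl⟩
    refine MinTensor.induction (P := fun t => φ t ∈ (Submodule.span ℂ X).topologicalClosure)
      ((Submodule.isClosed_topologicalClosure _).preimage hφ)
      (fun s t hs ht => by rw [map_add]; exact add_mem hs ht) (fun x y => ?_) t
    refine freeSum_tmul_mem (Submodule.span ℂ X) ((tmulBilin _ _).compr₂ φ)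
      (fun x => hφ.comp (show Continuous fun y => tmul x y by fun_prop))
      (fun y => hφ.comp (show Continuous fun x => tmul x y by fun_prop)) (fun m l g k => ?_) x y
    refine Submodule.le_topologicalClosure _ (Submodule.subset_span ?_)
    have e := h m l g k
    rw [← unitEmb₂_tmul] at e
    exact e

/-- Fixing the summand `l` in the second leg determines the first factor as well, so a single term
of the comultiplication is left. -/
theorem unitEmb₂_freeComul_mul_one_tmul (m l : ℕ+) (g : FreeGroup (Fin (m * l : ℕ+)))
    (k : FreeGroup (Fin l)) :
    unitEmb₂ (freeComul (freeIncl (m * l) (GroupCStar.u g))) *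
      tmul 1 (unitEmb (freeIncl l (GroupCStar.u k))) =
    tmul (unitEmb (freeIncl m (GroupCStar.u (FreeGroup.map (idxDiv rfl) g))))
      (unitEmb (freeIncl l (GroupCStar.u
        (FreeGroup.map (fun x : Fin (m * l : ℕ+) => idxMod l x) g * k)))) := by
  rw [freeComul_u, map_sum, Finset.sum_mul, Fintype.sum_eq_single ⟨(m, l), rfl⟩]
  · rw [unitEmb₂_tmul, tmul_mul_tmul, mul_one, ← map_mul, ← map_mul, ← GroupCStar.u_mul]
  · rintro ⟨⟨m', l'⟩, h⟩ hne
    have hl : l' ≠ l := by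
      rintro rfl
      exact hne (Subtype.ext (Prod.ext (mul_right_cancel h) rfl))
    rw [unitEmb₂_tmul, tmul_mul_tmul, ← map_mul, c0Incl_mul_of_ne (E := FreeCStar) hl, map_zero,
      tmul_zero]

theorem unitEmb₂_freeComul_mul_tmul_one (m l : ℕ+) (g : FreeGroup (Fin (m * l : ℕ+)))
    (k : FreeGroup (Fin m)) :
    unitEmb₂ (freeComul (freeIncl (m * l) (GroupCStar.u g))) *
      tmul (unitEmb (freeIncl m (GroupCStar.u k))) 1 =
    tmul (unitEmb (freeIncl m (GroupCStar.u (FreeGroup.map (idxDiv rfl) g * k))))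
      (unitEmb (freeIncl l (GroupCStar.u
        (FreeGroup.map (fun x : Fin (m * l : ℕ+) => idxMod l x) g)))) := by
  rw [freeComul_u, map_sum, Finset.sum_mul, Fintype.sum_eq_single ⟨(m, l), rfl⟩]
  · rw [unitEmb₂_tmul, tmul_mul_tmul, mul_one, ← map_mul, ← map_mul, ← GroupCStar.u_mul]
  · rintro ⟨⟨m', l'⟩, h⟩ hne
    have hm : m' ≠ m := by
      rintro rfl
      exact hne (Subtype.ext (Prod.ext rfl (mul_left_cancel h)))
    rw [unitEmb₂_tmul, tmul_mul_tmul, ← map_mul, c0Incl_mul_of_ne (E := FreeCStar) hm, map_zero,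
      zero_tmul]

theorem idxDiv_surjective (m l : ℕ+) :
    Function.Surjective (idxDiv (rfl : m * l = m * l)) := fun i => by
  have hi : (i : ℕ) * l < (m * l : ℕ+) := by
    rw [PNat.mul_coe]
    exact Nat.mul_lt_mul_of_pos_right i.2 l.pos
  exact ⟨⟨i * l, hi⟩, Fin.ext (Nat.mul_div_cancel _ l.pos)⟩

theorem idxMod_surjective (m l : ℕ+) :
    Function.Surjective (fun x : Fin (m * l : ℕ+) => idxMod l x) := fun j => by
  have hj : (j : ℕ) < (m * l : ℕ+) := by
    rw [PNat.mul_coe]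
    exact j.2.trans_le (Nat.le_mul_of_pos_left _ m.pos)
  exact ⟨⟨j, hj⟩, Fin.ext (Nat.mod_eq_of_lt j.2)⟩

/-- Any group element can be realized in one leg, because quotients and remainders induce
surjections of free groups; the inverse of the unwanted element in the other leg is absorbed into
the multiplier. Tensors of canonical unitaries are therefore single products, with no approximation.
-/
theorem cancellationLaw_freeComul : CancellationLaw freeComul := by
  constructor
  · refine closure_span_eq_range_unitEmb₂ ?_ fun m l g k => ?_
    · rintro _ ⟨a, b, rfl⟩
      exact unitEmb₂_mul_one_tmul_mem _ b
    · obtain ⟨g', rfl⟩ := FreeGroup.map_surjective (idxDiv_surjective m l) g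
      refine ⟨freeIncl (m * l) (GroupCStar.u g'), freeIncl l (GroupCStar.u
        ((FreeGroup.map (fun x : Fin (m * l : ℕ+) => idxMod l x) g')⁻¹ * k)), ?_⟩
      rw [unitEmb₂_freeComul_mul_one_tmul, mul_inv_cancel_left]
  · refine closure_span_eq_range_unitEmb₂ ?_ fun m l g k => ?_
    · rintro _ ⟨a, b, rfl⟩
      exact unitEmb₂_mul_tmul_one_mem _ b
    · obtain ⟨k', rfl⟩ := FreeGroup.map_surjective (idxMod_surjective m l) k
      refine ⟨freeIncl (m * l) (GroupCStar.u k'), freeIncl m (GroupCStar.u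
        ((FreeGroup.map (idxDiv rfl) k')⁻¹ * g)), ?_⟩
      rw [unitEmb₂_freeComul_mul_tmul_one, mul_inv_cancel_left]

end Cancellation

/-! ### The algebraic direct sum of the group algebras -/

section AlgebraicSum

theorem freeAlgIncl_lof (n : ℕ+) (x : MonoidAlgebra ℂ (FreeGroup (Fin n))) :
    freeAlgIncl (DirectSum.lof ℂ ℕ+ (fun n : ℕ+ => MonoidAlgebra ℂ (FreeGroup (Fin n))) n x) =
      freeIncl n (GroupCStar.ofAlg x) := by
  rw [freeAlgIncl, DirectSum.toModule_lof]
  rfl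

theorem exists_freeComul_freeAlgIncl (x : FreeAlgSum) : ∃ t : FreeAlgSum ⊗[ℂ] FreeAlgSum,
    freeComul (freeAlgIncl x) = MinTensor.ofAlg (TensorProduct.map freeAlgIncl freeAlgIncl t) := by
  induction x using DirectSum.induction_on with
  | zero => exact ⟨0, by simp only [map_zero]⟩
  | add x y hx hy =>
    obtain ⟨s, hs⟩ := hx
    obtain ⟨t, ht⟩ := hy
    exact ⟨s + t, by simp only [map_add, hs, ht]⟩
  | of n x =>
    change ∃ t : FreeAlgSum ⊗[ℂ] FreeAlgSum, freeComul (freeAlgIncl (DirectSum.lof ℂ ℕ+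
      (fun n : ℕ+ => MonoidAlgebra ℂ (FreeGroup (Fin n))) n x)) =
        MinTensor.ofAlg (TensorProduct.map freeAlgIncl freeAlgIncl t)
    induction x using MonoidAlgebra.induction_linear with
    | zero => exact ⟨0, by simp only [map_zero]⟩
    | add x y hx hy =>
      obtain ⟨s, hs⟩ := hx
      obtain ⟨t, ht⟩ := hy
      exact ⟨s + t, by simp only [map_add, hs, ht]⟩
    | single g c =>
      -- The formula for the comultiplication at a group element is a finite sum of tensors of group
      -- elements, so it lifts to the algebraic tensor product term by term.
      refine ⟨c • ∑ p : {p : ℕ+ × ℕ+ // p.1 * p.2 = n},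
        (DirectSum.lof ℂ ℕ+ (fun n : ℕ+ => MonoidAlgebra ℂ (FreeGroup (Fin n))) p.1.1
          (MonoidAlgebra.single (FreeGroup.map (idxDiv p.2) g) 1)) ⊗ₜ[ℂ]
        (DirectSum.lof ℂ ℕ+ (fun n : ℕ+ => MonoidAlgebra ℂ (FreeGroup (Fin n))) p.1.2
          (MonoidAlgebra.single (FreeGroup.map (fun k : Fin n => idxMod p.1.2 k) g) 1)), ?_⟩
      rw [freeAlgIncl_lof, GroupCStar.ofAlg_single, map_smul, map_smul, freeComul_u, map_smul,
        map_smul, map_sum, map_sum]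
      refine congrArg (c • ·) (Finset.sum_congr rfl fun p _ => ?_)
      rw [TensorProduct.map_tmul, freeAlgIncl_lof, freeAlgIncl_lof]
      rfl

theorem separatedByReps_freeSum : SeparatedByReps FreeSum :=
  SeparatedByReps.c0Sum fun _ => separatedByReps_groupCStar _

end AlgebraicSum

/-! ### Strict sums of orthogonal families and corners of multiplier algebras -/

section StrictSum

variable {ι : Type} {D E : Type} [NonUnitalCStarAlgebra D] [NonUnitalCStarAlgebra E]

/-- The net of finite sums is eventually constant on such a `t`: it is stationary as soon as the
index `n` is included. -/
theorem tendsto_sumHom {f : ι → D →⋆ₙₐ[ℂ] E}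
    (hf : ∀ i j, i ≠ j → ∀ x y, f i x * f j y = 0) (x : D) {t : E} {n : ι}
    (h : ∀ i, i ≠ n → f i x * t = 0) :
    Filter.Tendsto (fun F : Finset ι => sumHom F f hf x * t) Filter.atTop (𝓝 (f n x * t)) := by
  refine tendsto_const_nhds.congr' ?_
  filter_upwards [Filter.eventually_ge_atTop {n}] with F hF
  rw [sumHom_apply, Finset.sum_mul, Finset.sum_eq_single n (fun i _ hi => h i hi)
    (fun hn => absurd (Finset.singleton_subset_iff.1 hF) hn)]

/-- `W` has dense span, and each element of `W` is annihilated by all but one of the maps `f i`. -/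
structure LocalizedBy (f : ι → D →⋆ₙₐ[ℂ] E) (W : Set E) : Prop where
  orthogonal : ∀ i j, i ≠ j → ∀ x y, f i x * f j y = 0
  dense : Dense (Submodule.span ℂ W : Set E)
  localized : ∀ t ∈ W, ∃ n, ∀ i, i ≠ n → ∀ x, f i x * t = 0

variable {f : ι → D →⋆ₙₐ[ℂ] E} {W : Set E}

theorem LocalizedBy.strictlyConverges (h : LocalizedBy f W) :
    StrictlyConverges Filter.atTop fun F : Finset ι => sumHom F f h.orthogonal :=
  strictlyConverges_of_dense h.dense fun x t ht =>
    let ⟨n, hn⟩ := h.localized t ht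
    ⟨f n x * t, tendsto_sumHom h.orthogonal x fun i hi => hn i hi x⟩

/-- The sum of an orthogonal family of `*`-homomorphisms in the strict topology. -/
def LocalizedBy.strictSum (h : LocalizedBy f W) : D →⋆ₙₐ[ℂ] 𝓜(ℂ, E) := h.strictlyConverges.limit

theorem LocalizedBy.strictSum_fst (h : LocalizedBy f W) (x : D) {t : E} {n : ι}
    (hn : ∀ i, i ≠ n → f i x * t = 0) : (h.strictSum x).fst t = f n x * t :=
  h.strictlyConverges.limit_fst_eq (tendsto_sumHom h.orthogonal x hn)

theorem DoubleCentralizer.ext_of_dense (hW : Dense (Submodule.span ℂ W : Set E)) {a b : 𝓜(ℂ, E)}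
    (h : ∀ t ∈ W, a.fst t = b.fst t) : a = b :=
  ext_fst fun t => by rw [ContinuousLinearMap.ext_on hW h]

/-- The difference of the two sides is annihilated from the left by every `z`, by centrality; taking
`z` to be its own adjoint shows that it vanishes. -/
theorem DoubleCentralizer.fst_mul (m : 𝓜(ℂ, E)) (x y : E) : m.fst (x * y) = m.fst x * y := by
  have h : ∀ z, z * (m.fst (x * y) - m.fst x * y) = 0 := fun z => by
    rw [mul_sub, ← mul_assoc, ← m.central, ← m.central, mul_assoc, sub_self]
  exact sub_eq_zero.1 (CStarRing.star_mul_self_eq_zero_iff _ |>.1 (h _))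

theorem DoubleCentralizer.snd_mul (m : 𝓜(ℂ, E)) (x y : E) : m.snd (x * y) = x * m.snd y := by
  have h : ∀ z, (m.snd (x * y) - x * m.snd y) * z = 0 := fun z => by
    rw [sub_mul, mul_assoc, m.central, m.central, mul_assoc, sub_self]
  exact sub_eq_zero.1 (CStarRing.mul_star_self_eq_zero_iff _ |>.1 (h _))

/-- `p` is a central projection. -/
structure IsCentralProjection (p : E) : Prop where
  isStarProjection : IsStarProjection p
  comm : ∀ x, p * x = x * p

variable {p : E}

theorem IsCentralProjection.mul_self (hp : IsCentralProjection p) : p * p = p :=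
  hp.isStarProjection.isIdempotentElem

theorem IsCentralProjection.fst_mul (hp : IsCentralProjection p) (m : 𝓜(ℂ, E)) :
    m.fst p * p = m.fst p := by rw [← DoubleCentralizer.fst_mul, hp.mul_self]

/-- Both sides lie in the corner of `p`, where centrality of `p` and of the multiplier makes left
and right action coincide. This yields compatibility of `corner` with the involution. -/
theorem IsCentralProjection.snd_eq_fst (hp : IsCentralProjection p) (m : 𝓜(ℂ, E)) :
    m.snd p = m.fst p := by
  rw [← hp.fst_mul, ← hp.comm, ← m.central, ← hp.comm, ← DoubleCentralizer.snd_mul, hp.mul_self]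

/-- Multipliers restrict to the corner given by a central projection. -/
def IsCentralProjection.corner (hp : IsCentralProjection p) : 𝓜(ℂ, E) →⋆ₙₐ[ℂ] E where
  toFun m := m.fst p
  map_smul' c m := rfl
  map_zero' := rfl
  map_add' m n := rfl
  map_mul' m n := by
    change m.fst (n.fst p) = m.fst p * n.fst p
    rw [← DoubleCentralizer.fst_mul, hp.comm, hp.fst_mul]
  map_star' m := by
    rw [DoubleCentralizer.star_fst, hp.isStarProjection.isSelfAdjoint.star_eq, hp.snd_eq_fst]

theorem IsCentralProjection.corner_apply (hp : IsCentralProjection p) (m : 𝓜(ℂ, E)) :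
    hp.corner m = m.fst p := rfl

theorem IsCentralProjection.corner_coe (hp : IsCentralProjection p) (t : E) :
    hp.corner (DoubleCentralizer.coe ℂ t) = t * p := rfl

/-- How the corner of a multiplier acts after `ψ` depends only on `ψ p * t`, so a vector annihilated
by `ψ p` is annihilated by the whole corner. The extensions to multipliers are localized in this
way. -/
theorem IsCentralProjection.hom_corner_mul {E' : Type} [NonUnitalCStarAlgebra E']
    (hp : IsCentralProjection p) (ψ : E →⋆ₙₐ[ℂ] E') (m : 𝓜(ℂ, E)) (t : E') :
    ψ (hp.corner m) * t = ψ (hp.corner m) * (ψ p * t) := by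
  rw [← mul_assoc, ← map_mul, hp.corner_apply, hp.fst_mul]

theorem IsCentralProjection.hom_corner_mul_eq_zero {E' : Type} [NonUnitalCStarAlgebra E']
    (hp : IsCentralProjection p) (ψ : E →⋆ₙₐ[ℂ] E') (m : 𝓜(ℂ, E)) {t : E'} (h : ψ p * t = 0) :
    ψ (hp.corner m) * t = 0 := by
  rw [hp.hom_corner_mul, h, mul_zero]

theorem IsCentralProjection.corner_mul_corner {q : E} (hp : IsCentralProjection p)
    (hq : IsCentralProjection q) (h : p * q = 0) (m n : 𝓜(ℂ, E)) :
    hp.corner m * hq.corner n = 0 := by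
  rw [hp.corner_apply, hq.corner_apply, ← hp.fst_mul, ← hq.fst_mul, ← hq.comm,
    mul_assoc, ← mul_assoc p, h, zero_mul, mul_zero]

/-- A `*`-homomorphism preserving the unit, as a unital `*`-homomorphism. -/
def NonUnitalStarAlgHom.toUnital {D E : Type} [CStarAlgebra D] [CStarAlgebra E]
    (φ : D →⋆ₙₐ[ℂ] E) (h : φ 1 = 1) : D →⋆ₐ[ℂ] E where
  __ := φ
  map_one' := h
  commutes' c := by
    change φ (algebraMap ℂ D c) = _
    rw [Algebra.algebraMap_eq_smul_one, Algebra.algebraMap_eq_smul_one, map_smul, h]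

end StrictSum

/-! ### Total subsets of tensor products -/

/-- The second variable is closed up first, for first entries in `U` only; then the first variable,
with arbitrary second entry. -/
theorem MinTensor.dense_span_image2 {A B : Type} [NonUnitalCStarAlgebra A]
    [NonUnitalCStarAlgebra B] {U : Set A} {V : Set B} (hU : Dense (Submodule.span ℂ U : Set A))
    (hV : Dense (Submodule.span ℂ V : Set B)) :
    Dense (Submodule.span ℂ (Set.image2 tmul U V) : Set (A ⊗ᵐ B)) := by
  refine dense_span_of_tmul_mem fun a b => ?_
  have hV' : ∀ a ∈ U, ∀ b,
      tmulBilin A B a b ∈ (Submodule.span ℂ (Set.image2 tmul U V)).topologicalClosure :=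
    fun a ha b => closure_minimal (s := (Submodule.span ℂ V : Set B)) (t := ((Submodule.span ℂ
        (Set.image2 tmul U V)).topologicalClosure.comap (tmulBilin A B a) : Set B))
      (Submodule.span_le.2 fun b hb => Submodule.le_topologicalClosure _
        (Submodule.subset_span ⟨a, ha, b, hb, rfl⟩))
      ((Submodule.isClosed_topologicalClosure _).preimage
        (show Continuous fun b => tmul a b by fun_prop)) (hV b)
  exact closure_minimal (s := (Submodule.span ℂ U : Set A)) (t := ((Submodule.span ℂ
        (Set.image2 tmul U V)).topologicalClosure.comap ((tmulBilin A B).flip b) : Set A))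
      (Submodule.span_le.2 fun a ha => hV' a ha b)
      ((Submodule.isClosed_topologicalClosure _).preimage
        (show Continuous fun a => tmul a b by fun_prop)) (hU a)

theorem GroupCStar.dense_span_u (G : Type) [Group G] :
    Dense (Submodule.span ℂ (Set.range (u : G → GroupCStar G)) : Set (GroupCStar G)) := by
  intro x
  exact induction (P := fun x => x ∈ (Submodule.span ℂ (Set.range (u : G → _))).topologicalClosure)
    (Submodule.isClosed_topologicalClosure _) (fun _ _ => add_mem)
    (fun c _ => Submodule.smul_mem _ c)
    (fun g => Submodule.le_topologicalClosure _ (Submodule.subset_span ⟨g, rfl⟩)) x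

/-- The canonical unitaries of the summands of the direct sum. -/
def freeUnitaries : Set FreeSum := {x | ∃ n g, x = freeIncl n (GroupCStar.u g)}

theorem dense_span_freeUnitaries : Dense (Submodule.span ℂ freeUnitaries : Set FreeSum) := by
  intro x
  exact freeSum_induction (P := fun x => x ∈ (Submodule.span ℂ freeUnitaries).topologicalClosure)
    (Submodule.isClosed_topologicalClosure _) (fun _ _ => add_mem)
    (fun c _ => Submodule.smul_mem _ c)
    (fun n g => Submodule.le_topologicalClosure _ (Submodule.subset_span ⟨n, g, rfl⟩)) x

/-! ### The coaction on the full C*-algebra of the free group of infinite rank -/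

section Coaction

theorem MinTensor.continuous_assoc (A B C : Type) [NonUnitalCStarAlgebra A]
    [NonUnitalCStarAlgebra B] [NonUnitalCStarAlgebra C] : Continuous (assoc A B C) :=
  map_continuous (assoc A B C : (A ⊗ᵐ B) ⊗ᵐ C →⋆ₙₐ[ℂ] A ⊗ᵐ (B ⊗ᵐ C))

/-- The component `φ_{∞,n}` of the coaction, with values in the tensor product with the direct
sum. -/
def freeCoactPart (n : ℕ+) : FreeCStarInf →⋆ₙₐ[ℂ] FreeCStarInf ⊗ᵐ FreeSum :=
  (map (NonUnitalStarAlgHom.id ℂ FreeCStarInf) (freeIncl n)).comp (phiInf n)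

theorem freeCoactPart_apply (n : ℕ+) (x : FreeCStarInf) : freeCoactPart n x =
    map (NonUnitalStarAlgHom.id ℂ FreeCStarInf) (freeIncl n) (phiInf n x) := rfl

theorem freeCoactPart_u (n : ℕ+) (g : FreeGroup ℕ) : freeCoactPart n (GroupCStar.u g) =
    tmul (GroupCStar.u (FreeGroup.map (fun k : ℕ => k / (n : ℕ)) g))
      (freeIncl n (GroupCStar.u (FreeGroup.map (idxMod n) g))) := by
  rw [freeCoactPart_apply, phiInf, GroupCStar.comul_u, map_tmul, NonUnitalStarAlgHom.id_apply_eq]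

theorem freeCoactPart_one (n : ℕ+) : freeCoactPart n (GroupCStar.u 1) =
    tmul (GroupCStar.u 1) (freeIncl n (GroupCStar.u 1)) := by
  rw [freeCoactPart_u, map_one, map_one]

theorem freeCoactPart_mul_map {n k : ℕ+} (h : n ≠ k) (x : FreeCStarInf)
    (t : FreeCStarInf ⊗ᵐ FreeCStar k) :
    freeCoactPart n x * map (NonUnitalStarAlgHom.id ℂ FreeCStarInf) (freeIncl k) t = 0 :=
  map_mul_map_eq_zero (Or.inr fun a b => c0Incl_mul_of_ne (E := FreeCStar) h a b) _ _

theorem freeCoactPart_mul_tmul {n k : ℕ+} (h : n ≠ k) (x a : FreeCStarInf) (b : FreeCStar k) :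
    freeCoactPart n x * tmul a (freeIncl k b) = 0 := by
  have := freeCoactPart_mul_map h x (tmul a b)
  rwa [map_tmul, NonUnitalStarAlgHom.id_apply_eq] at this

theorem freeIncl_one_mul (n : ℕ+) (x : FreeCStar n) :
    freeIncl n (GroupCStar.u 1) * freeIncl n x = freeIncl n x := by
  rw [← map_mul, GroupCStar.one_mul]

theorem localizedBy_freeCoactPart : LocalizedBy freeCoactPart
    (Set.image2 tmul (Set.range (GroupCStar.u : FreeGroup ℕ → _)) freeUnitaries) where
  orthogonal _ _ h x _ := freeCoactPart_mul_map h x _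
  dense := dense_span_image2 (GroupCStar.dense_span_u _) dense_span_freeUnitaries
  localized := by
    rintro _ ⟨_, ⟨g, rfl⟩, _, ⟨n, k, rfl⟩, rfl⟩
    exact ⟨n, fun i hi x => freeCoactPart_mul_tmul hi x _ _⟩

/-- The coaction `Γ_φ`. -/
def freeCoact : FreeCStarInf →⋆ₙₐ[ℂ] 𝓜(ℂ, FreeCStarInf ⊗ᵐ FreeSum) :=
  localizedBy_freeCoactPart.strictSum

theorem freeCoact_fst_map (x : FreeCStarInf) (n : ℕ+) (t : FreeCStarInf ⊗ᵐ FreeCStar n) :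
    (freeCoact x).fst (map (NonUnitalStarAlgHom.id ℂ FreeCStarInf) (freeIncl n) t) =
      map (NonUnitalStarAlgHom.id ℂ FreeCStarInf) (freeIncl n) (phiInf n x * t) := by
  rw [map_mul]
  exact localizedBy_freeCoactPart.strictSum_fst x fun i hi => freeCoactPart_mul_map hi x t

theorem freeCoact_fst_tmul (x : FreeCStarInf) (n : ℕ+) (a : FreeCStarInf) (b : FreeCStar n) :
    (freeCoact x).fst (tmul a (freeIncl n b)) = freeCoactPart n x * tmul a (freeIncl n b) :=
  localizedBy_freeCoactPart.strictSum_fst x fun _ hi => freeCoactPart_mul_tmul hi x a b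

/-- The unit of the summand `C*(F_∞) ⊗ C*(F_n)`. -/
def freeUnit (n : ℕ+) : FreeCStarInf ⊗ᵐ FreeSum :=
  tmul (GroupCStar.u 1) (freeIncl n (GroupCStar.u 1))

/-- Multiplication on the right by the unit of a summand projects onto that summand; the left
version follows by taking adjoints. -/
theorem freeIncl_one_comm (n : ℕ+) (b : FreeSum) :
    freeIncl n (GroupCStar.u 1) * b = b * freeIncl n (GroupCStar.u 1) := by
  rw [mul_c0Incl (E := FreeCStar), ← star_inj, star_mul, ← map_star, ← map_star,
    GroupCStar.star_one, mul_c0Incl (E := FreeCStar), star_mul, GroupCStar.star_one, map_star,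
    GroupCStar.one_mul, GroupCStar.mul_one]

theorem freeUnit_comm (n : ℕ+) (x : FreeCStarInf ⊗ᵐ FreeSum) :
    freeUnit n * x = x * freeUnit n := by
  refine MinTensor.induction (P := fun x => freeUnit n * x = x * freeUnit n)
    (isClosed_eq (continuous_const.mul continuous_id) (continuous_id.mul continuous_const))
    (fun s t hs ht => by rw [mul_add, add_mul, hs, ht]) (fun a b => ?_) x
  rw [freeUnit, tmul_mul_tmul, tmul_mul_tmul, GroupCStar.one_mul, GroupCStar.mul_one,
    freeIncl_one_comm]

theorem isCentralProjection_freeUnit (n : ℕ+) : IsCentralProjection (freeUnit n) where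
  isStarProjection :=
    { isIdempotentElem := by
        rw [IsIdempotentElem, freeUnit, tmul_mul_tmul, GroupCStar.one_mul, freeIncl_one_mul]
      isSelfAdjoint := by
        rw [IsSelfAdjoint, freeUnit, star_tmul, ← map_star, GroupCStar.star_one,
          GroupCStar.star_one] }
  comm := freeUnit_comm n

theorem freeUnit_mul_freeUnit {n k : ℕ+} (h : n ≠ k) : freeUnit n * freeUnit k = 0 := by
  rw [freeUnit, freeUnit, tmul_mul_tmul, c0Incl_mul_of_ne (E := FreeCStar) h, tmul_zero]

/-- The restriction of multipliers to the summand `C*(F_∞) ⊗ C*(F_n)`. -/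
def freeCorner (n : ℕ+) : 𝓜(ℂ, FreeCStarInf ⊗ᵐ FreeSum) →⋆ₙₐ[ℂ] FreeCStarInf ⊗ᵐ FreeSum :=
  (isCentralProjection_freeUnit n).corner

/-- The blocks of the coaction are recovered from the multiplier, so the comodule identity can be
tested block by block. -/
theorem freeCorner_freeCoact (n : ℕ+) (x : FreeCStarInf) :
    freeCorner n (freeCoact x) = freeCoactPart n x := by
  change (freeCoact x).fst (freeUnit n) = _
  rw [freeUnit, freeCoact_fst_tmul, ← freeCoactPart_one, ← map_mul, GroupCStar.mul_one]

/-- The components of the extension of `Γ_φ ⊗ id` to multipliers. -/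
def coactMapPart (p : ℕ+ × ℕ+) :
    𝓜(ℂ, FreeCStarInf ⊗ᵐ FreeSum) →⋆ₙₐ[ℂ] (FreeCStarInf ⊗ᵐ FreeSum) ⊗ᵐ FreeSum :=
  (map (freeCoactPart p.1) (NonUnitalStarAlgHom.id ℂ FreeSum)).comp (freeCorner p.2)

/-- The components of the extension of `id ⊗ Δ_φ` to multipliers. -/
def comulMapPart (n : ℕ+) :
    𝓜(ℂ, FreeCStarInf ⊗ᵐ FreeSum) →⋆ₙₐ[ℂ] FreeCStarInf ⊗ᵐ (FreeSum ⊗ᵐ FreeSum) :=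
  (map (NonUnitalStarAlgHom.id ℂ FreeCStarInf) freeComul).comp (freeCorner n)

theorem map_freeCoactPart_freeUnit (k n : ℕ+) :
    map (freeCoactPart k) (NonUnitalStarAlgHom.id ℂ FreeSum) (freeUnit n) =
      tmul (tmul (GroupCStar.u 1) (freeIncl k (GroupCStar.u 1)))
        (freeIncl n (GroupCStar.u 1)) := by
  rw [freeUnit, map_tmul, freeCoactPart_one, NonUnitalStarAlgHom.id_apply_eq]

/-- The component `p` maps a central projection to the unit of the block `p`, which annihilates
every other block. -/
theorem coactMapPart_mul_eq_zero {p : ℕ+ × ℕ+} {k n : ℕ+} (h : p ≠ (k, n))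
    (m : 𝓜(ℂ, FreeCStarInf ⊗ᵐ FreeSum)) (a : FreeCStarInf) (b : FreeCStar k) (c : FreeCStar n) :
    coactMapPart p m * tmul (tmul a (freeIncl k b)) (freeIncl n c) = 0 := by
  refine (isCentralProjection_freeUnit p.2).hom_corner_mul_eq_zero
    (map (freeCoactPart p.1) (NonUnitalStarAlgHom.id ℂ FreeSum)) m ?_
  rw [map_freeCoactPart_freeUnit, tmul_mul_tmul, tmul_mul_tmul]
  by_cases hk : p.1 = k
  · have hn : p.2 ≠ n := fun hn => h (Prod.ext hk hn)
    rw [c0Incl_mul_of_ne (E := FreeCStar) hn, tmul_zero]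
  · rw [c0Incl_mul_of_ne (E := FreeCStar) hk, tmul_zero, zero_tmul]

theorem freeComul_mul_tmul_eq_zero {n k l : ℕ+} (h : n ≠ k * l) (x : FreeCStar n)
    (y : FreeCStar k) (z : FreeCStar l) :
    freeComul (freeIncl n x) * tmul (freeIncl k y) (freeIncl l z) = 0 := by
  rw [freeComul_incl, Finset.sum_mul]
  refine Finset.sum_eq_zero fun p _ => ?_
  rw [← map_tmul]
  refine map_c0Incl_mul_of_ne (E := FreeCStar) (E' := FreeCStar) ?_ _ _
  by_contra hc
  push Not at hc
  exact h (by rw [← p.2, hc.1, hc.2])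

/-- The block `(k, l)` of `FreeSum ⊗ᵐ FreeSum` is reached by the comultiplication only from the
summand `k * l`. -/
theorem comulMapPart_mul_eq_zero {n k l : ℕ+} (h : n ≠ k * l)
    (m : 𝓜(ℂ, FreeCStarInf ⊗ᵐ FreeSum)) (a : FreeCStarInf) (b : FreeCStar k) (c : FreeCStar l) :
    comulMapPart n m * tmul a (tmul (freeIncl k b) (freeIncl l c)) = 0 := by
  refine (isCentralProjection_freeUnit n).hom_corner_mul_eq_zero
    (map (NonUnitalStarAlgHom.id ℂ FreeCStarInf) freeComul) m ?_
  rw [freeUnit, map_tmul, tmul_mul_tmul, freeComul_mul_tmul_eq_zero h, tmul_zero]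

theorem map_freeComul_freeUnit_mul (k l : ℕ+) (a : FreeCStarInf) (b : FreeCStar k)
    (c : FreeCStar l) :
    map (NonUnitalStarAlgHom.id ℂ FreeCStarInf) freeComul (freeUnit (k * l)) *
      tmul a (tmul (freeIncl k b) (freeIncl l c)) =
        tmul a (tmul (freeIncl k b) (freeIncl l c)) := by
  rw [freeUnit, map_tmul, tmul_mul_tmul, freeComul_one_mul_tmul, NonUnitalStarAlgHom.id_apply_eq,
    GroupCStar.one_mul]

theorem map_freeCoactPart_freeUnit_mul (k n : ℕ+) (a : FreeCStarInf) (b : FreeCStar k)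
    (c : FreeCStar n) :
    map (freeCoactPart k) (NonUnitalStarAlgHom.id ℂ FreeSum) (freeUnit n) *
      tmul (tmul a (freeIncl k b)) (freeIncl n c) =
        tmul (tmul a (freeIncl k b)) (freeIncl n c) := by
  rw [map_freeCoactPart_freeUnit, tmul_mul_tmul, tmul_mul_tmul, GroupCStar.one_mul,
    freeIncl_one_mul, freeIncl_one_mul]

theorem localizedBy_coactMapPart : LocalizedBy coactMapPart
    (Set.image2 tmul (Set.image2 tmul (Set.range (GroupCStar.u : FreeGroup ℕ → _)) freeUnitaries)
      freeUnitaries) where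
  orthogonal p q h m m' := by
    by_cases h1 : p.1 = q.1
    · have h2 : p.2 ≠ q.2 := fun h2 => h (Prod.ext h1 h2)
      rw [coactMapPart, coactMapPart, h1, NonUnitalStarAlgHom.comp_apply,
        NonUnitalStarAlgHom.comp_apply, ← map_mul, freeCorner, freeCorner,
        IsCentralProjection.corner_mul_corner _ _ (freeUnit_mul_freeUnit h2), map_zero]
    · exact map_mul_map_eq_zero
        (Or.inl fun x y => localizedBy_freeCoactPart.orthogonal _ _ h1 x y) _ _
  dense := dense_span_image2 (dense_span_image2 (GroupCStar.dense_span_u _)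
    dense_span_freeUnitaries) dense_span_freeUnitaries
  localized := by
    rintro _ ⟨_, ⟨_, ⟨g, rfl⟩, _, ⟨k, h, rfl⟩, rfl⟩, _, ⟨n, h', rfl⟩, rfl⟩
    exact ⟨(k, n), fun p hp m => coactMapPart_mul_eq_zero hp m _ _ _⟩

theorem localizedBy_comulMapPart : LocalizedBy comulMapPart
    (Set.image2 tmul (Set.range (GroupCStar.u : FreeGroup ℕ → _))
      (Set.image2 tmul freeUnitaries freeUnitaries)) where
  orthogonal n n' h m m' := by
    rw [comulMapPart, comulMapPart, NonUnitalStarAlgHom.comp_apply,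
      NonUnitalStarAlgHom.comp_apply, ← map_mul, freeCorner, freeCorner,
      IsCentralProjection.corner_mul_corner _ _ (freeUnit_mul_freeUnit h), map_zero]
  dense := dense_span_image2 (GroupCStar.dense_span_u _)
    (dense_span_image2 dense_span_freeUnitaries dense_span_freeUnitaries)
  localized := by
    rintro _ ⟨_, ⟨g, rfl⟩, _, ⟨_, ⟨k, h, rfl⟩, _, ⟨l, h', rfl⟩, rfl⟩, rfl⟩
    exact ⟨k * l, fun n hn m => comulMapPart_mul_eq_zero hn m _ _ _⟩

theorem coactMap_fst_tmul (m : 𝓜(ℂ, FreeCStarInf ⊗ᵐ FreeSum)) (k n : ℕ+) (a : FreeCStarInf)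
    (b : FreeCStar k) (c : FreeCStar n) :
    (localizedBy_coactMapPart.strictSum m).fst (tmul (tmul a (freeIncl k b)) (freeIncl n c)) =
      map (freeCoactPart k) (NonUnitalStarAlgHom.id ℂ FreeSum) (freeCorner n m) *
        tmul (tmul a (freeIncl k b)) (freeIncl n c) :=
  localizedBy_coactMapPart.strictSum_fst m (n := (k, n))
    fun _ hp => coactMapPart_mul_eq_zero hp m a b c

theorem comulMap_fst_tmul (m : 𝓜(ℂ, FreeCStarInf ⊗ᵐ FreeSum)) (k l : ℕ+) (a : FreeCStarInf)
    (b : FreeCStar k) (c : FreeCStar l) :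
    (localizedBy_comulMapPart.strictSum m).fst (tmul a (tmul (freeIncl k b) (freeIncl l c))) =
      map (NonUnitalStarAlgHom.id ℂ FreeCStarInf) freeComul (freeCorner (k * l) m) *
        tmul a (tmul (freeIncl k b) (freeIncl l c)) :=
  localizedBy_comulMapPart.strictSum_fst m fun _ hn => comulMapPart_mul_eq_zero hn m a b c

/-- The extension of `Γ_φ ⊗ id` to multipliers. -/
def coactMap : 𝓜(ℂ, FreeCStarInf ⊗ᵐ FreeSum) →⋆ₐ[ℂ]
    𝓜(ℂ, (FreeCStarInf ⊗ᵐ FreeSum) ⊗ᵐ FreeSum) :=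
  localizedBy_coactMapPart.strictSum.toUnital <|
    DoubleCentralizer.ext_of_dense localizedBy_coactMapPart.dense <| by
      rintro _ ⟨_, ⟨_, ⟨g, rfl⟩, _, ⟨k, h, rfl⟩, rfl⟩, _, ⟨n, h', rfl⟩, rfl⟩
      rw [coactMap_fst_tmul]
      -- The corner of the multiplier `1` is the unit of the block, so the extension fixes each
      -- total vector and hence is unital.
      exact map_freeCoactPart_freeUnit_mul k n _ _ _

/-- The extension of `id ⊗ Δ_φ` to multipliers. -/
def comulMap : 𝓜(ℂ, FreeCStarInf ⊗ᵐ FreeSum) →⋆ₐ[ℂ]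
    𝓜(ℂ, FreeCStarInf ⊗ᵐ (FreeSum ⊗ᵐ FreeSum)) :=
  localizedBy_comulMapPart.strictSum.toUnital <|
    DoubleCentralizer.ext_of_dense localizedBy_comulMapPart.dense <| by
      rintro _ ⟨_, ⟨g, rfl⟩, _, ⟨_, ⟨k, h, rfl⟩, _, ⟨l, h', rfl⟩, rfl⟩, rfl⟩
      rw [comulMap_fst_tmul]
      exact map_freeComul_freeUnit_mul k l _ _ _

theorem comulMap_coe (t : FreeCStarInf ⊗ᵐ FreeSum) : comulMap (DoubleCentralizer.coe ℂ t) =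
    DoubleCentralizer.coe ℂ (map (NonUnitalStarAlgHom.id ℂ FreeCStarInf) freeComul t) := by
  refine DoubleCentralizer.ext_of_dense localizedBy_comulMapPart.dense ?_
  rintro _ ⟨_, ⟨g, rfl⟩, _, ⟨_, ⟨k, h, rfl⟩, _, ⟨l, h', rfl⟩, rfl⟩, rfl⟩
  refine (comulMap_fst_tmul _ k l _ _ _).trans ?_
  rw [freeCorner, IsCentralProjection.corner_coe, map_mul, mul_assoc, map_freeComul_freeUnit_mul]
  rfl

/-- On a single block both sides are products with the same component of the coaction. Continuity
extends the formula first in `a'`, with `s` an elementary tensor of canonical unitaries, and then in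
`s`. -/
theorem coactMap_coe_fst (b : FreeCStarInf) (a : FreeSum) (s : FreeCStarInf ⊗ᵐ FreeSum)
    (a' : FreeSum) :
    (coactMap (DoubleCentralizer.coe ℂ (tmul b a))).fst (tmul s a') =
      tmul ((freeCoact b).fst s) (a * a') := by
  have h : ∀ s ∈ Set.image2 tmul (Set.range (GroupCStar.u : FreeGroup ℕ → _)) freeUnitaries,
      ∀ a', (coactMap (DoubleCentralizer.coe ℂ (tmul b a))).fst (tmul s a') =
        tmul ((freeCoact b).fst s) (a * a') := by
    rintro _ ⟨_, ⟨g, rfl⟩, _, ⟨k, h, rfl⟩, rfl⟩ a'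
    refine DFunLike.congr_fun (ContinuousLinearMap.ext_on
      (f := (coactMap (DoubleCentralizer.coe ℂ (tmul b a))).fst.comp
        (tmulL _ _ (tmul (GroupCStar.u g) (freeIncl k (GroupCStar.u h)))))
      (g := (tmulL _ _ ((freeCoact b).fst (tmul (GroupCStar.u g)
        (freeIncl k (GroupCStar.u h))))).comp (ContinuousLinearMap.mul ℂ FreeSum a))
      dense_span_freeUnitaries ?_) a'
    rintro _ ⟨n, h', rfl⟩
    refine (coactMap_fst_tmul _ k n _ _ _).trans ?_
    rw [freeCorner, IsCentralProjection.corner_coe, map_mul, mul_assoc,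
      map_freeCoactPart_freeUnit_mul, map_tmul, tmul_mul_tmul, NonUnitalStarAlgHom.id_apply_eq,
      ← freeCoact_fst_tmul]
    rfl
  exact DFunLike.congr_fun (ContinuousLinearMap.ext_on
    (f := (coactMap (DoubleCentralizer.coe ℂ (tmul b a))).fst.comp ((tmulL _ _).flip a'))
    (g := ((tmulL _ _).flip (a * a')).comp (freeCoact b).fst)
    localizedBy_freeCoactPart.dense fun s hs => h s hs a') s

/-- The comodule identity on the block `(k, l)`: for a group element it is the agreement of the
three digits `i / (k * l)`, `(i / l) % k` and `i % l`, now with `i` an arbitrary natural number.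
Linearity and continuity extend it to all of `C*(F_∞)`. -/
theorem coaction_identity_tmul (b : FreeCStarInf) (k l : ℕ+) (x : FreeCStarInf) (y : FreeCStar k)
    (z : FreeCStar l) :
    assoc FreeCStarInf FreeSum FreeSum
      (map (freeCoactPart k) (NonUnitalStarAlgHom.id ℂ FreeSum) (freeCoactPart l b) *
        tmul (tmul x (freeIncl k y)) (freeIncl l z)) =
      map (NonUnitalStarAlgHom.id ℂ FreeCStarInf) freeComul (freeCoactPart (k * l) b) *
        tmul x (tmul (freeIncl k y) (freeIncl l z)) := by
  refine GroupCStar.induction (P := fun b => assoc FreeCStarInf FreeSum FreeSum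
      (map (freeCoactPart k) (NonUnitalStarAlgHom.id ℂ FreeSum) (freeCoactPart l b) *
        tmul (tmul x (freeIncl k y)) (freeIncl l z)) =
      map (NonUnitalStarAlgHom.id ℂ FreeCStarInf) freeComul (freeCoactPart (k * l) b) *
        tmul x (tmul (freeIncl k y) (freeIncl l z))) (isClosed_eq ?_ ?_)
    (fun b b' h h' => ?_) (fun c b h => ?_) (fun g => ?_) b
  · exact (continuous_assoc FreeCStarInf FreeSum FreeSum).comp
      (((map_continuous _).comp (map_continuous (freeCoactPart l))).mul continuous_const)
  · exact ((map_continuous _).comp (map_continuous (freeCoactPart (k * l)))).mul continuous_const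
  · simp only [map_add, add_mul, h, h']
  · simp only [map_smul, smul_mul_assoc, h]
  · rw [freeCoactPart_u, freeCoactPart_u, map_tmul, map_tmul, freeCoactPart_u, tmul_mul_tmul,
      tmul_mul_tmul, tmul_mul_tmul, assoc_tmul, NonUnitalStarAlgHom.id_apply_eq,
      NonUnitalStarAlgHom.id_apply_eq, freeComul_mul_tmul, ← map_mul, ← map_mul]
    simp only [FreeGroup.map.comp]
    congr 6
    · funext i
      change i / l / k = i / ((k * l : ℕ+) : ℕ)
      rw [PNat.mul_coe, Nat.div_div_eq_div_mul, mul_comm]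
    · congr 1
      funext i
      refine Fin.ext ?_
      change i / l % k = i % ((k * l : ℕ+) : ℕ) / l
      rw [PNat.mul_coe, Nat.mod_mul_left_div_self]
    · congr 1
      funext i
      refine Fin.ext ?_
      change i % l = i % ((k * l : ℕ+) : ℕ) % l
      rw [PNat.mul_coe, Nat.mod_mul_left_mod]

theorem isRightComodule_freeCoact : IsRightComodule freeComul freeCoact where
  nondegenerate := by
    refine localizedBy_freeCoactPart.dense.mono (Submodule.span_mono ?_)
    rintro _ ⟨_, ⟨g, rfl⟩, _, ⟨n, h, rfl⟩, rfl⟩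
    -- The coaction of the unit acts as the identity on every block, so each total vector is itself
    -- a value `(Γ b).fst s`.
    refine ⟨GroupCStar.u 1, tmul (GroupCStar.u g) (freeIncl n (GroupCStar.u h)), ?_⟩
    rw [freeCoact_fst_tmul, freeCoactPart_one, tmul_mul_tmul, GroupCStar.one_mul, freeIncl_one_mul]
  coaction := by
    refine ⟨coactMap, comulMap, assoc _ _ _, coactMap_coe_fst, comulMap_coe,
      isAssociator_assoc _ _ _, fun b s => ?_⟩
    let α : (FreeCStarInf ⊗ᵐ FreeSum) ⊗ᵐ FreeSum →L[ℂ] FreeCStarInf ⊗ᵐ (FreeSum ⊗ᵐ FreeSum) :=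
      { toFun := assoc FreeCStarInf FreeSum FreeSum
        map_add' := map_add _
        map_smul' := map_smul _
        cont := continuous_assoc FreeCStarInf FreeSum FreeSum }
    -- Both sides are continuous and linear in `s`, so they are compared on elementary tensors of
    -- canonical unitaries, where each extension reduces to one block.
    refine DFunLike.congr_fun (ContinuousLinearMap.ext_on
      (f := α.comp (coactMap (freeCoact b)).fst) (g := (comulMap (freeCoact b)).fst.comp α)
      localizedBy_coactMapPart.dense ?_) s
    rintro _ ⟨_, ⟨_, ⟨g, rfl⟩, _, ⟨k, h, rfl⟩, rfl⟩, _, ⟨l, h', rfl⟩, rfl⟩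
    change assoc _ _ _ ((coactMap (freeCoact b)).fst _) =
      (comulMap (freeCoact b)).fst (assoc _ _ _ _)
    rw [assoc_tmul]
    refine (congrArg _ (coactMap_fst_tmul _ k l _ _ _)).trans
      (Eq.trans ?_ (comulMap_fst_tmul _ k l _ _ _).symm)
    rw [freeCorner_freeCoact, freeCorner_freeCoact, coaction_identity_tmul]

end Coaction

end

/-! ### The main theorem -/

theorem theorem1p1 :
    ∃ (Δ : FreeSum →⋆ₙₐ[ℂ] FreeSum ⊗ᵐ FreeSum) (ε : FreeSum →⋆ₙₐ[ℂ] ℂ)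
      (Γ : FreeCStarInf →⋆ₙₐ[ℂ] 𝓜(ℂ, FreeCStarInf ⊗ᵐ FreeSum)),
      -- the definitions of the comultiplication, the counit and the coaction
      (∀ (n : ℕ+) (x : FreeCStar n), Δ (freeIncl n x) =
        ∑ p : {p : ℕ+ × ℕ+ // p.1 * p.2 = n},
          MinTensor.map (freeIncl p.1.1) (freeIncl p.1.2) (phi p.2 x)) ∧
      ((∀ g : FreeGroup (Fin (1 : ℕ+)), ε (freeIncl 1 (GroupCStar.u g)) = 1) ∧
        ∀ (n : ℕ+) (x : FreeCStar n), n ≠ 1 → ε (freeIncl n x) = 0) ∧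
      (∀ (x : FreeCStarInf) (n : ℕ+) (t : FreeCStarInf ⊗ᵐ FreeCStar n),
        (Γ x).fst (MinTensor.map (NonUnitalStarAlgHom.id ℂ FreeCStarInf) (freeIncl n) t) =
          MinTensor.map (NonUnitalStarAlgHom.id ℂ FreeCStarInf) (freeIncl n) (phiInf n x * t)) ∧
      -- a strictly proper, counital, non-cocommutative C*-bialgebra
      IsStrictlyProperBialgebra Δ ∧ IsCounit Δ ε ∧
      ¬ IsCocommutative Δ ∧
      -- the cancellation law
      CancellationLaw Δ ∧
      -- the extension to the unitization, and the non-existence of antipodes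
      (∃ (Δ' : Unitization ℂ FreeSum →⋆ₙₐ[ℂ] Unitization ℂ FreeSum ⊗ᵐ Unitization ℂ FreeSum)
        (ε' : Unitization ℂ FreeSum →⋆ₙₐ[ℂ] ℂ),
        (∀ a, Δ' (unitEmb a) = unitEmb₂ (Δ a)) ∧ (∀ a, ε' (unitEmb a) = ε a) ∧
        IsStrictlyProperBialgebra Δ' ∧ IsCounit Δ' ε' ∧
        Δ' 1 = MinTensor.tmul 1 1 ∧ ε' 1 = 1 ∧
        ∀ (S : Subalgebra ℂ (Unitization ℂ FreeSum)) (δ : S →ₗ[ℂ] S ⊗[ℂ] S),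
          Dense (S : Set (Unitization ℂ FreeSum)) → IsSubbialgebra Δ' S δ →
          ¬ ∃ T : S →ₗ[ℂ] S, IsAntipode ε' S δ T) ∧
      -- the algebraic direct sum of the group algebras
      (∀ x : FreeAlgSum, ∃ t : FreeAlgSum ⊗[ℂ] FreeAlgSum,
        Δ (freeAlgIncl x) = MinTensor.ofAlg (TensorProduct.map freeAlgIncl freeAlgIncl t)) ∧
      -- the comodule structure
      IsRightComodule Δ Γ := by
  refine ⟨freeComul, freeCounit, freeCoact, freeComul_incl,
    ⟨freeCounit_one, fun n x hn => freeCounit_of_ne hn x⟩, freeCoact_fst_map,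
    isStrictlyProperBialgebra_freeComul, isCounit_freeCounit, not_isCocommutative_freeComul,
    cancellationLaw_freeComul,
    ⟨unitComul freeComul, unitCounit freeCounit, unitComul_unitEmb _, unitCounit_unitEmb _,
      isStrictlyProperBialgebra_unitComul freeComul_coassoc,
      isCounit_unitCounit isCounit_freeCounit, unitComul_one _, unitCounit_one _,
      fun S δ hS hδ => not_exists_isAntipode separatedByReps_freeSum
        ⟨freeIncl 1 (GroupCStar.u 1), by rw [freeCounit_one]; exact one_ne_zero⟩ S δ hS hδ⟩,
    exists_freeComul_freeAlgIncl, isRightComodule_freeCoact⟩
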